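/- **Setting.** Let $N$ agents $\mathcal V=\{1,\dots,N\}$ have decision variables $x^i\in\mathbb R^{n^i}$, costs $f^i(x^i)=\sum_{l=1}^{n^i}f^i_l(x^i_l)$ with $f^i_l:\mathbb R\to\mathbb R$, and matrices $w^i\in\mathbb R^{p\times n^i}$ with $k$-th row $[w^i]_k$; let $b\in\mathbb R^p$. Consider $$\min_{x=(x^1,\dots,x^N)}\ \sum_{i=1}^N f^i(x^i)\quad\text{subject to}\quad \sum_{i=1}^N[w^i]_k x^i=b_k,\qquad k=1,\dots,p. \tag{P}$$ Assume: every $f^i_l$ is convex and differentiable; every $\nabla f^i$ is locally Lipschitz; $W=[w^1,\dots,w^N]$ has full row rank $p$; the feasible set of (P) is non-empty; and (P) attains a finite minimum. Let $\mathsf A=(a_{ij})\in\mathbb R^{N\times N}$ be symmetric with non-negative entries, the adjacency matrix of a weighted undirected graph $\mathcal G$ on $\mathcal V$ whose edges are the pairs with $a_{ij}>0$. For each $k$ let $\mathcal V_k\subseteq\mathcal V$ contain every agent $i$ with $[w^i]_k\ne 0$, and let $\mathcal G_k$ be the subgraph of $\mathcal G$ induced on $\mathcal V_k$ (its adjacency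 matrix is the corresponding submatrix of $\mathsf A$). Put $\mathcal T^i=\{k: i\in\mathcal V_k\}$. Given reals $\beta_k>0$, $\rho^i>0$ and $\bar b^l_k$ ($l\in\mathcal V_k$), the algorithm is the system of differential equations, for $t\ge 0$, $k=1,\dots,p$, $l\in\mathcal V_k$, $i\in\mathcal V$, $$\begin{aligned} \dot y^l_k&=\beta_k\sum_{j\in\mathcal V_k}a_{lj}(v^l_k-v^j_k),\\ \dot v^l_k&=\big([w^l]_kx^l-\bar b^l_k\big)-\beta_k\sum_{j\in\mathcal V_k}a_{lj}(v^l_k-v^j_k)-y^l_k,\\ \dot x^i&=-(1+\rho^i)\nabla f^i(x^i)-\rho^i\sum_{k\in\mathcal T^i}[w^i]_k^\top\big([w^i]_kx^i-\bar b^i_k\big)+\rho^i\sum_{k\in\mathcal T^i}[w^i]_k^\top y^i_k-(1+\rho^i)\sum_{k\in\mathcal T^i}[w^i]_k^\top v^i_k . \end{aligned}\tag{A}$$ **Theorem.** Suppose that every $\mathcal G_k$ is connected and that $\sum_{l\in\mathcal V_k}\bar b^l_k=b_k$ for every $k$. Then for all $\beta_k>0$ and $\rho^i>0$, and all initial values $x^i(0)\in\mathbb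 R^{n^i}$, $v^l_k(0),y^l_k(0)\in\mathbb R$ with $\sum_{l\in\mathcal V_k}y^l_k(0)=0$ for every $k$, the system (A) has a solution on $[0,\infty)$, and for every such solution there are $\nu^\star\in\mathbb R^p$ and $x^\star=(x^{1\star},\dots,x^{N\star})$ satisfying the KKT conditions of (P), $$\nabla f^i(x^{i\star})+(w^i)^\top\nu^\star=0\ \ (i\in\mathcal V),\qquad \sum_{i=1}^N[w^i]_kx^{i\star}=b_k\ \ (k=1,\dots,p),$$ such that, as $t\to\infty$, $v^l_k(t)\to\nu^\star_k$ for all $k$ and all $l\in\mathcal V_k$, and $x^i(t)\to x^{i\star}$ for all $i\in\mathcal V$. -/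

import Mathlib

open Filter Topology

noncomputable section

namespace ClusterAllocation

/-- The data of the problem: minimize `∑ i, f^i(x^i)`, with `f^i(x^i) = ∑ l, f^i_l(x^i_l)`,
over `x^i ∈ ℝ^{n i}`, subject to `∑ i, [w^i]_k x^i = b_k` for `k = 1, …, p`. -/
structure Problem (N p : ℕ) (n : Fin N → ℕ) where
  /-- cost `f^i_l` of subagent `l` of agent `i` -/
  f : (i : Fin N) → Fin (n i) → ℝ → ℝ
  /-- weighting factor matrix `w^i ∈ ℝ^{p × n i}` of agent `i` -/
  w : (i : Fin N) → Matrix (Fin p) (Fin (n i)) ℝ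
  /-- right-hand side of the equality constraints -/
  b : Fin p → ℝ

/-- The stacked decision variable `x = (x^1, …, x^N)`. -/
abbrev Decision {N : ℕ} (n : Fin N → ℕ) : Type :=
  (i : Fin N) → EuclideanSpace ℝ (Fin (n i))

namespace Problem

variable {N p : ℕ} {n : Fin N → ℕ} (P : Problem N p n)

/-- The cost `f^i` of agent `i`. -/
def localCost (i : Fin N) (x : EuclideanSpace ℝ (Fin (n i))) : ℝ :=
  ∑ l, P.f i l (x l)

/-- The total cost. -/
def cost (x : Decision n) : ℝ := ∑ i, P.localCost i (x i)

/-- The `k`-th row of `w^i`, as a vector of `ℝ^{n i}`. -/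
def row (i : Fin N) (k : Fin p) : EuclideanSpace ℝ (Fin (n i)) :=
  WithLp.toLp 2 (P.w i k)

/-- The matrix `W = [w^1, …, w^N]`. -/
def stackedMatrix : Matrix (Fin p) ((i : Fin N) × Fin (n i)) ℝ :=
  Matrix.of fun k il => P.w il.1 k il.2

/-- The set of points that satisfy all equality constraints. -/
def feasibleSet : Set (Decision n) :=
  {x | ∀ k, ∑ i, inner ℝ (P.row i k) (x i) = P.b k}

/-- The standing assumptions on the problem (without inequality constraints). -/
structure Assumptions : Prop where
  convex : ∀ i l, ConvexOn ℝ Set.univ (P.f i l)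
  differentiable : ∀ i l, Differentiable ℝ (P.f i l)
  locallyLipschitz : ∀ i, LocallyLipschitz (gradient (P.localCost i))
  fullRowRank : P.stackedMatrix.rank = p
  feasible : P.feasibleSet.Nonempty
  optimum : ∃ x ∈ P.feasibleSet, IsMinOn P.cost P.feasibleSet x

/-- The KKT conditions: `∇f^i(x^i) + (w^i)ᵀ ν = 0` for every agent, and feasibility. -/
def IsKKT (ν : Fin p → ℝ) (x : Decision n) : Prop :=
  (∀ i, gradient (P.localCost i) (x i) + ∑ k, ν k • P.row i k = 0) ∧
  ∀ k, ∑ i, inner ℝ (P.row i k) (x i) = P.b k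

end Problem

/-- A weighted undirected graph on the agents: a symmetric nonnegative adjacency matrix; the edges
are the pairs of positive weight. -/
structure WeightedGraph (N : ℕ) where
  a : Matrix (Fin N) (Fin N) ℝ
  nonneg : ∀ i j, 0 ≤ a i j
  symm : ∀ i j, a i j = a j i

/-- The underlying simple graph (loops play no role). -/
def WeightedGraph.graph {N : ℕ} (G : WeightedGraph N) : SimpleGraph (Fin N) :=
  SimpleGraph.fromRel fun i j => 0 < G.a i j

/-- `(v, y, x)` is a solution on `[0, ∞)` of the distributed algorithm. Here `V k` is the node set
of the subgraph attached to constraint `k`, whose adjacency matrix is the corresponding submatrix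
of that of `G`; `v t k l` and `y t k l` are kept by the agents `l ∈ V k`. -/
structure IsSolution {N p : ℕ} {n : Fin N → ℕ} (P : Problem N p n) (G : WeightedGraph N)
    (V : Fin p → Finset (Fin N)) (bbar : (k : Fin p) → V k → ℝ)
    (β : Fin p → ℝ) (ρ : Fin N → ℝ)
    (v y : ℝ → (k : Fin p) → V k → ℝ) (x : ℝ → Decision n) : Prop where
  y_eq : ∀ t, 0 ≤ t → ∀ (k : Fin p) (l : V k),
    HasDerivWithinAt (fun s => y s k l)
      (β k * ∑ j : V k, G.a l j * (v t k l - v t k j)) (Set.Ici 0) t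
  v_eq : ∀ t, 0 ≤ t → ∀ (k : Fin p) (l : V k),
    HasDerivWithinAt (fun s => v s k l)
      ((inner ℝ (P.row l k) (x t l) - bbar k l)
        - β k * ∑ j : V k, G.a l j * (v t k l - v t k j)
        - y t k l) (Set.Ici 0) t
  x_eq : ∀ t, 0 ≤ t → ∀ i : Fin N,
    HasDerivWithinAt (fun s => x s i)
      (-((1 + ρ i) • gradient (P.localCost i) (x t i))
        - ρ i • ∑ k : {k // i ∈ V k},
            (inner ℝ (P.row i k) (x t i) - bbar k ⟨i, k.2⟩) • P.row i k
        + ρ i • ∑ k : {k // i ∈ V k}, y t k ⟨i, k.2⟩ • P.row i k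
        - (1 + ρ i) • ∑ k : {k // i ∈ V k}, v t k ⟨i, k.2⟩ • P.row i k) (Set.Ici 0) t

end ClusterAllocation

end

/-! Stack the `v` and `y` variables over all pairs `(k, l)`. Then (A) becomes a flow `v' = ∑ A_i x_i
- c - L v - y`, `y' = L v`, with `x_i` driven by `-(1+ρ_i)∇f_i(x_i)` and by `B_i` applied to the
residual and to `v`. Here `L` is a direct sum of weighted Laplacians and `A_i`, `B_i` are mutually
adjoint. KKT points correspond to equilibria of this flow.

The storage function uses auxiliary filters driven by the trajectory: `ζ` filters `v` and `X`
filters `x`, both at rate 1, while `ξ`, `Γ`, `Ψ` filter `X`, `∇f(x)` and `⟨∇f(x), x⟩ - f(x)` at rate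
`a`. Suitable initial filter states give two invariant identities. `sub_ζ` says that the network
sees the agents only through `∑ A_i X_i`. `price` expresses the price `B_i ζ` received by agent `i`
through that agent's own signals. The flow thus becomes a feedback loop of agents and network,
joined by adjoint maps.

Both sides are passive for the same supply rate, `⟨X', z'⟩ + 1/4 ⟨X - u, z - z*⟩` with `z = B ζ`,
and the supplies cancel in the loop (`agentStorage_hasDerivWithinAt`, `storage_hasDerivWithinAt`).
Convexity enters through the conjugate `f*`. Since `a Γ` is a weighted mean of gradients and `a Ψ`
the same mean of the values `f*(∇f(x))`, Jensen's inequality gives `f*(a Γ) ≤ a Ψ` (`young`). Hence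
the Fenchel–Young gap `f(X) + a Ψ - ⟨a Γ, X⟩` is a nonnegative storage, and no strict convexity or
second derivative is needed.

The storage is nonincreasing and bounds `v`, `y`, `x` uniformly in time, which yields global
existence. Its dissipation rate has a bounded derivative and so tends to zero, by an argument of
Barbalat type. Any cluster point of `(X, ζ)` is then an equilibrium. The storage taken relative to
that cluster point is monotone and vanishes along a subsequence, hence tends to zero, and this gives
convergence. Finally `y` stays in a fixed coset of the range of `L`, the space of vectors with zero
sum on each cluster, so the limit satisfies the constraints. -/

namespace ClusterAllocation

/-! ### Existence for locally Lipschitz systems, linear filters, comparison arguments -/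

section ODE

variable {Z : Type*} [NormedAddCommGroup Z] [NormedSpace ℝ Z]

lemma hasDerivWithinAt_Ici_of_Ici_zero {z : ℝ → Z} {z' : Z} {t : ℝ} (ht : 0 ≤ t)
    (h : HasDerivWithinAt z z' (Set.Ici 0) t) : HasDerivWithinAt z z' (Set.Ici t) t :=
  h.mono (Set.Ici_subset_Ici.2 ht)

/-- Multiplying by a Lipschitz cutoff that is 1 up to radius `R` and 0 beyond `R + 1` makes the
field globally bounded, so that Picard–Lindelöf reaches any prescribed time. -/
lemma exists_lipschitz_cutoff [ProperSpace Z] {F : Z → Z} (hF : LocallyLipschitz F) (R : ℝ) :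
    ∃ (F' : Z → Z) (M : NNReal), (∀ z, ‖z‖ ≤ R → F' z = F z) ∧ (∀ z, ‖F' z‖ ≤ M) ∧
      ∀ (c : Z) (r : ℝ), ∃ K, LipschitzOnWith K F' (Metric.closedBall c r) := by
  have hχ : LipschitzWith 1 (fun z : Z => max 0 (min 1 (R + 1 - ‖z‖))) := by
    refine LipschitzWith.const_max (LipschitzWith.const_min ?_ 1) 0
    refine LipschitzWith.of_dist_le_mul fun x y => ?_
    have := abs_norm_sub_norm_le y x
    rw [Real.dist_eq, dist_eq_norm, NNReal.coe_one, one_mul, norm_sub_rev]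
    convert this using 2
    ring
  have hχ1 : ∀ z : Z, |max 0 (min 1 (R + 1 - ‖z‖))| ≤ 1 := fun z => by
    rw [abs_of_nonneg (le_max_left _ _)]
    exact max_le zero_le_one (min_le_left _ _)
  obtain ⟨M, hM⟩ := (isCompact_closedBall (0 : Z) (R + 1)).exists_bound_of_continuousOn
    hF.continuous.continuousOn
  have hM' : ∀ z : Z, ‖z‖ ≤ R + 1 → ‖F z‖ ≤ max M 0 := fun z hz =>
    (hM z (by simpa using hz)).trans (le_max_left _ _)
  refine ⟨fun z => (max 0 (min 1 (R + 1 - ‖z‖))) • F z, .mk (max M 0) (le_max_right _ _), ?_, ?_, ?_⟩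
  · intro z hz
    have : (1 : ℝ) ≤ R + 1 - ‖z‖ := by linarith
    simp [this]
  · intro z
    rw [norm_smul, NNReal.coe_mk]
    by_cases hz : ‖z‖ ≤ R + 1
    · exact (mul_le_of_le_one_left (norm_nonneg _) (hχ1 z)).trans (hM' z hz)
    · have : R + 1 - ‖z‖ ≤ 0 := by linarith
      have h0 : max 0 (min 1 (R + 1 - ‖z‖)) = 0 := max_eq_left ((min_le_right _ _).trans this)
      simp [h0]
  · intro c r
    obtain ⟨K, hK⟩ := (hF.locallyLipschitzOn (s := Metric.closedBall c r)).exists_lipschitzOnWith_of_compact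
      (isCompact_closedBall c r)
    obtain ⟨B, hB⟩ := (isCompact_closedBall c r).exists_bound_of_continuousOn
      hF.continuous.continuousOn
    refine ⟨K + (Real.toNNReal B), LipschitzOnWith.of_dist_le_mul fun x hx y hy => ?_⟩
    have h1 := hK.dist_le_mul x hx y hy
    have h2 := hχ.dist_le_mul x y
    rw [dist_eq_norm] at h1
    rw [Real.dist_eq, NNReal.coe_one, one_mul] at h2
    simp only [dist_eq_norm (_ • _)]
    set χ := fun z : Z => max 0 (min 1 (R + 1 - ‖z‖))
    have : χ x • F x - χ y • F y = χ x • (F x - F y) + (χ x - χ y) • F y := by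
      rw [smul_sub, sub_smul]; abel
    have h3 : ‖F y‖ ≤ Real.toNNReal B := (hB y hy).trans (Real.le_coe_toNNReal B)
    calc ‖χ x • F x - χ y • F y‖ ≤ ‖χ x • (F x - F y)‖ + ‖(χ x - χ y) • F y‖ := by
          rw [this]; exact norm_add_le _ _
      _ ≤ 1 * (K * dist x y) + dist x y * Real.toNNReal B := by
          rw [norm_smul, norm_smul]
          exact add_le_add (mul_le_mul (hχ1 x) h1 (norm_nonneg _) zero_le_one)
            (mul_le_mul h2 h3 (norm_nonneg _) dist_nonneg)
      _ = ↑(K + Real.toNNReal B) * dist x y := by push_cast; ring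

/-- A locally Lipschitz autonomous system has a solution on every interval `[0, T]` if all its
solutions are bounded by a constant that does not depend on the interval of definition. -/
theorem exists_solution_Icc_of_apriori_bound [ProperSpace Z] {F : Z → Z}
    (hF : LocallyLipschitz F) (z₀ : Z) (R : ℝ)
    (hR : ∀ T, 0 ≤ T → ∀ z : ℝ → Z, ContinuousOn z (Set.Ici 0) → z 0 = z₀ →
      (∀ t ∈ Set.Ico 0 T, HasDerivWithinAt z (F (z t)) (Set.Ici 0) t) → ‖z T‖ ≤ R)
    {T : ℝ} (hT : 0 ≤ T) :
    ∃ z : ℝ → Z, z 0 = z₀ ∧ ContinuousOn z (Set.Ici 0) ∧ (∀ t ∈ Set.Icc 0 T, ‖z t‖ ≤ R) ∧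
      ∀ t ∈ Set.Ico 0 T, HasDerivWithinAt z (F (z t)) (Set.Ici 0) t := by
  have : CompleteSpace Z := complete_of_proper
  obtain ⟨F', M, hF', hM, hK⟩ := exists_lipschitz_cutoff hF (R + 1)
  obtain ⟨K, hK⟩ := hK z₀ (M * T)
  -- A solution of the cut-off system moves at speed at most `M`, so it cannot leave the ball of
  -- radius `M * T` before time `T`.
  have hpl : IsPicardLindelof (fun _ => F') (⟨0, le_rfl, hT⟩ : Set.Icc 0 T) z₀
      (.mk (M * T) (mul_nonneg M.2 hT)) 0 M K :=
    IsPicardLindelof.of_time_independent (fun x _ => hM x) hK (by simp [hT])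
  obtain ⟨w, hw0, hw⟩ := hpl.exists_eq_forall_mem_Icc_hasDerivWithinAt₀
  have hwc : ContinuousOn w (Set.Icc 0 T) := fun t ht => (hw t ht).continuousWithinAt
  have hz : ∀ t ∈ Set.Icc 0 T, w (min t T) = w t := fun t ht => by rw [min_eq_left ht.2]
  have hzc : ContinuousOn (fun t => w (min t T)) (Set.Ici 0) :=
    hwc.comp (by fun_prop) fun t ht => ⟨le_min ht hT, min_le_right _ _⟩
  have hzd : ∀ t ∈ Set.Ico 0 T,
      HasDerivWithinAt (fun t => w (min t T)) (F' (w (min t T))) (Set.Ici 0) t := by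
    intro t ht
    have h1 := (hw t ⟨ht.1, ht.2.le⟩).congr hz (hz t ⟨ht.1, ht.2.le⟩)
    rw [← hz t ⟨ht.1, ht.2.le⟩] at h1
    refine h1.mono_of_mem_nhdsWithin ?_
    filter_upwards [self_mem_nhdsWithin, mem_nhdsWithin_of_mem_nhds (Iio_mem_nhds ht.2)] with s h1 h2
    exact ⟨h1, le_of_lt h2⟩
  have hz0 : w (min 0 T) = z₀ := by rw [min_eq_left hT]; exact hw0
  -- Up to the first time at which the norm reaches `R + 1` the curve follows `F` itself, so the a
  -- priori bound gives norm at most `R` there, a contradiction.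
  have hin : ∀ t ∈ Set.Icc 0 T, ‖w (min t T)‖ < R + 1 := by
    by_contra! hcon
    obtain ⟨t, ht, htR⟩ := hcon
    have hS : IsCompact (Set.Icc 0 T ∩ {t | R + 1 ≤ ‖w (min t T)‖}) := by
      refine isCompact_Icc.of_isClosed_subset ?_ Set.inter_subset_left
      exact ((hzc.mono Set.Icc_subset_Ici_self).norm).preimage_isClosed_of_isClosed isClosed_Icc
        isClosed_Ici
    obtain ⟨s, ⟨hs, hsR⟩, hmin⟩ := hS.exists_isLeast ⟨t, ht, htR⟩
    have := hR s hs.1 _ hzc hz0 fun r hr => by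
      have hr' : ‖w (min r T)‖ ≤ R + 1 := by
        by_contra! h
        exact absurd (hmin ⟨⟨hr.1, hr.2.le.trans hs.2⟩, h.le⟩) (not_le.2 hr.2)
      rw [← hF' _ hr']
      exact hzd r ⟨hr.1, hr.2.trans_le hs.2⟩
    have hsR' : R + 1 ≤ ‖w (min s T)‖ := hsR
    linarith
  have hd : ∀ t ∈ Set.Ico 0 T,
      HasDerivWithinAt (fun t => w (min t T)) (F (w (min t T))) (Set.Ici 0) t := fun t ht => by
    rw [← hF' _ (hin t ⟨ht.1, ht.2.le⟩).le]
    exact hzd t ht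
  exact ⟨fun t => w (min t T), hz0, hzc,
    fun t ht => hR t ht.1 _ hzc hz0 fun r hr => hd r ⟨hr.1, hr.2.trans_le ht.2⟩, hd⟩

/-- A locally Lipschitz autonomous system has a solution on `[0, ∞)` if all its solutions are
bounded by a constant that does not depend on the interval of definition. -/
theorem exists_solution_of_apriori_bound [ProperSpace Z] {F : Z → Z}
    (hF : LocallyLipschitz F) (z₀ : Z) (R : ℝ)
    (hR : ∀ T, 0 ≤ T → ∀ z : ℝ → Z, ContinuousOn z (Set.Ici 0) → z 0 = z₀ →
      (∀ t ∈ Set.Ico 0 T, HasDerivWithinAt z (F (z t)) (Set.Ici 0) t) → ‖z T‖ ≤ R) :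
    ∃ z : ℝ → Z, z 0 = z₀ ∧ ∀ t, 0 ≤ t → HasDerivWithinAt z (F (z t)) (Set.Ici 0) t := by
  choose w hw0 hwc hwR hwd using fun n : ℕ =>
    exists_solution_Icc_of_apriori_bound hF z₀ R hR (T := n) (Nat.cast_nonneg n)
  obtain ⟨K, hK⟩ := (hF.locallyLipschitzOn
    (s := Metric.closedBall 0 R)).exists_lipschitzOnWith_of_compact (isCompact_closedBall 0 R)
  have huniq : ∀ m n : ℕ, m ≤ n → Set.EqOn (w m) (w n) (Set.Icc 0 m) := by
    intro m n hmn
    have hmn' : (m : ℝ) ≤ n := by exact_mod_cast hmn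
    refine ODE_solution_unique_of_mem_Icc_right (v := fun _ => F)
      (s := fun _ => Metric.closedBall 0 R) (fun _ _ => hK)
      ((hwc m).mono Set.Icc_subset_Ici_self)
      (fun t ht => hasDerivWithinAt_Ici_of_Ici_zero ht.1 (hwd m t ht))
      (fun t ht => by simpa using hwR m t ⟨ht.1, ht.2.le⟩)
      ((hwc n).mono Set.Icc_subset_Ici_self)
      (fun t ht => hasDerivWithinAt_Ici_of_Ici_zero ht.1 (hwd n t ⟨ht.1, ht.2.trans_le hmn'⟩))
      (fun t ht => by simpa using hwR n t ⟨ht.1, ht.2.le.trans hmn'⟩) ?_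
    rw [hw0, hw0]
  have hz : ∀ (n : ℕ) (t : ℝ), 0 ≤ t → t ≤ n → w (⌈t⌉₊) t = w n t := fun n t h0 hn =>
    huniq _ _ (Nat.ceil_le.2 hn) ⟨h0, Nat.le_ceil t⟩
  refine ⟨fun t => w ⌈t⌉₊ t, by simpa using hw0 _, fun t ht => ?_⟩
  -- The index is raised by one because `w n` is known to solve the equation only on `[0, n)`, and
  -- `t` may be an integer.
  have hlt : t < (⌈t⌉₊ + 1 : ℕ) := (Nat.le_ceil t).trans_lt (by push_cast; linarith)
  have h1 := hwd (⌈t⌉₊ + 1) t ⟨ht, hlt⟩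
  change HasDerivWithinAt _ (F (w ⌈t⌉₊ t)) _ _
  rw [hz _ t ht hlt.le]
  refine h1.congr_of_eventuallyEq ?_ (hz _ t ht hlt.le)
  filter_upwards [self_mem_nhdsWithin, mem_nhdsWithin_of_mem_nhds (Iio_mem_nhds hlt)] with s h1 h2
  exact hz _ s h1 (le_of_lt h2)

/-- A first order linear filter driven by a continuous signal. -/
theorem exists_filter [CompleteSpace Z] (c : ℝ) (z₀ : Z) {g : ℝ → Z}
    (hg : ContinuousOn g (Set.Ici 0)) :
    ∃ z : ℝ → Z, z 0 = z₀ ∧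
      ∀ t, 0 ≤ t → HasDerivWithinAt z (g t - c • z t) (Set.Ici 0) t := by
  have hg' : Continuous fun t => Real.exp (c * t) • g (max t 0) := by
    refine (by fun_prop : Continuous fun t => Real.exp (c * t)).smul ?_
    exact hg.comp_continuous (by fun_prop) fun t => Set.mem_Ici.2 (le_max_right _ _)
  refine ⟨fun t => Real.exp (-(c * t)) • (z₀ + ∫ s in (0 : ℝ)..t, Real.exp (c * s) • g (max s 0)),
    by simp, fun t ht => ?_⟩
  have h1 : HasDerivAt (fun t => z₀ + ∫ s in (0 : ℝ)..t, Real.exp (c * s) • g (max s 0))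
      (Real.exp (c * t) • g (max t 0)) t :=
    (hg'.integral_hasStrictDerivAt 0 t).hasDerivAt.const_add z₀
  have h2 : HasDerivAt (fun t => Real.exp (-(c * t))) (Real.exp (-(c * t)) * (-c)) t := by
    simpa using (((hasDerivAt_id t).const_mul c).neg).exp
  refine (h2.smul h1).hasDerivWithinAt.congr_deriv ?_
  rw [smul_smul, ← Real.exp_add, neg_add_cancel, Real.exp_zero, one_smul, max_eq_left ht,
    mul_neg, neg_smul, mul_comm, mul_smul, sub_eq_add_neg]

lemma eqOn_zero_of_linear_decay {r : ℝ → Z} {c T : ℝ} (hc : ContinuousOn r (Set.Ici 0))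
    (hr : ∀ t ∈ Set.Ico 0 T, HasDerivWithinAt r (-(c • r t)) (Set.Ici 0) t) (h0 : r 0 = 0) :
    ∀ t ∈ Set.Icc 0 T, r t = 0 := by
  refine eq_zero_of_abs_deriv_le_mul_abs_self_of_eq_zero_right (K := |c|)
    (f' := fun t => -(c • r t)) (hc.mono Set.Icc_subset_Ici_self)
    (fun t ht => hasDerivWithinAt_Ici_of_Ici_zero ht.1 (hr t ht)) h0 fun t _ => ?_
  rw [norm_neg, norm_smul, Real.norm_eq_abs]

lemma hasDerivAt_of_Ici_zero {z : ℝ → Z} {z' : Z} {t : ℝ} (ht : 0 < t)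
    (h : HasDerivWithinAt z z' (Set.Ici 0) t) : HasDerivAt z z' t :=
  h.hasDerivAt (Ici_mem_nhds ht)

lemma antitoneOn_of_hasDerivWithinAt_Ici {V V' : ℝ → ℝ} {T : ℝ} (hc : ContinuousOn V (Set.Ici 0))
    (hV : ∀ t ∈ Set.Ico 0 T, HasDerivWithinAt V (V' t) (Set.Ici 0) t)
    (hV' : ∀ t ∈ Set.Ico 0 T, V' t ≤ 0) : AntitoneOn V (Set.Icc 0 T) := by
  refine antitoneOn_of_hasDerivWithinAt_nonpos (f' := V') (convex_Icc 0 T)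
    (hc.mono Set.Icc_subset_Ici_self) (fun t ht => ?_) (fun t ht => ?_) <;>
  rw [interior_Icc] at *
  · exact (hasDerivAt_of_Ici_zero ht.1 (hV t ⟨ht.1.le, ht.2⟩)).hasDerivWithinAt
  · exact hV' t ⟨ht.1.le, ht.2⟩

/-- Integrating factor: `exp (c t) * r t` is nondecreasing. -/
lemma nonneg_of_hasDerivWithinAt_ge_neg_mul {r r' : ℝ → ℝ} {c T : ℝ}
    (hc : ContinuousOn r (Set.Ici 0))
    (hr : ∀ t ∈ Set.Ico 0 T, HasDerivWithinAt r (r' t) (Set.Ici 0) t)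
    (hr' : ∀ t ∈ Set.Ico 0 T, -(c * r t) ≤ r' t) (h0 : 0 ≤ r 0) :
    ∀ t ∈ Set.Icc 0 T, 0 ≤ r t := by
  intro t ht
  have hexp : ∀ t, HasDerivAt (fun t => Real.exp (c * t)) (Real.exp (c * t) * c) t := fun t => by
    simpa using ((hasDerivAt_id t).const_mul c).exp
  have hanti := antitoneOn_of_hasDerivWithinAt_Ici (T := T)
    (V := fun t => -(Real.exp (c * t) * r t))
    (((by fun_prop : Continuous fun t => Real.exp (c * t)).continuousOn.mul hc).neg)
    (fun t ht => ((hexp t).hasDerivWithinAt.mul (hr t ht)).neg) (fun t ht => by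
      have h1 := mul_le_mul_of_nonneg_left (hr' t ht) (Real.exp_pos (c * t)).le
      linarith)
  have := hanti ⟨le_rfl, ht.1.trans ht.2⟩ ht ht.1
  simp only [mul_zero, Real.exp_zero, one_mul, neg_le_neg_iff] at this
  exact nonneg_of_mul_nonneg_right (h0.trans this) (Real.exp_pos _)

end ODE

/-! ### Barbalat-type convergence lemmas -/

section Asymptotics

variable {Z : Type*} [NormedAddCommGroup Z] [NormedSpace ℝ Z]

lemma norm_sub_le_of_hasDerivWithinAt_Ici {z z' : ℝ → Z} {C s t : ℝ} (hs : 0 ≤ s) (hst : s ≤ t)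
    (hz : ∀ r, 0 ≤ r → HasDerivWithinAt z (z' r) (Set.Ici 0) r)
    (hC : ∀ r, s ≤ r → r ≤ t → ‖z' r‖ ≤ C) : ‖z t - z s‖ ≤ C * (t - s) := by
  have := (convex_Icc s t).norm_image_sub_le_of_norm_hasDerivWithin_le
    (f := z) (f' := z') (C := C) (x := s) (y := t)
    (fun r hr => (hz r (hs.trans hr.1)).mono fun u hu => hs.trans hu.1)
    (fun r hr => hC r hr.1 hr.2) (Set.left_mem_Icc.2 hst) (Set.right_mem_Icc.2 hst)
  rwa [Real.norm_of_nonneg (sub_nonneg.2 hst)] at this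

/-- A variant of Barbalat's lemma: the dissipation rate of a nonnegative storage function tends to
zero if it has a bounded derivative. -/
theorem tendsto_zero_of_dissipation {V V' w w' : ℝ → ℝ} {K : ℝ}
    (hV : ∀ t, 0 ≤ t → HasDerivWithinAt V (V' t) (Set.Ici 0) t)
    (hV' : ∀ t, 0 ≤ t → V' t ≤ -w t) (hV0 : ∀ t, 0 ≤ t → 0 ≤ V t) (hw0 : ∀ t, 0 ≤ t → 0 ≤ w t)
    (hw : ∀ t, 0 ≤ t → HasDerivWithinAt w (w' t) (Set.Ici 0) t)
    (hK : ∀ t, 0 ≤ t → ‖w' t‖ ≤ K) : Tendsto w atTop (𝓝 0) := by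
  have hVc : ContinuousOn V (Set.Ici 0) := fun t ht => (hV t ht).continuousWithinAt
  have hK0 : 0 ≤ K := (norm_nonneg _).trans (hK 0 le_rfl)
  have hanti : Antitone fun t => V (max t 0) := by
    intro s t hst
    exact antitoneOn_of_hasDerivWithinAt_Ici (T := max t 0) hVc (fun r hr => hV r hr.1)
      (fun r hr => (hV' r hr.1).trans (neg_nonpos.2 (hw0 r hr.1)))
      ⟨le_max_right _ _, max_le_max_right 0 hst⟩ ⟨le_max_right _ _, le_rfl⟩ (max_le_max_right 0 hst)
  have hbdd : BddBelow (Set.range fun t => V (max t 0)) :=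
    ⟨0, by rintro _ ⟨t, rfl⟩; exact hV0 _ (le_max_right _ _)⟩
  have hlim := tendsto_atTop_ciInf hanti hbdd
  set l := ⨅ t, V (max t 0)
  have hl : ∀ t, 0 ≤ t → l ≤ V t := fun t ht => by
    simpa [max_eq_left ht] using ciInf_le hbdd t
  rw [Metric.tendsto_atTop]
  intro ε hε
  -- With this window length `w` loses at most `K δ ≤ ε / 2` on `[t, t + δ]`, so `V` must drop there
  -- by at least `δ (w t - K δ)`. For large `t` less than `δ ε / 2` is left to drop.
  set δ := ε / (2 * (K + 1))
  have hδ : 0 < δ := by positivity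
  have hKδ : K * δ ≤ ε / 2 := by
    have : (K + 1) * δ = ε / 2 := by simp only [δ]; field_simp
    linarith
  obtain ⟨T, hT⟩ := Metric.tendsto_atTop.1 hlim (δ * (ε / 2)) (by positivity)
  refine ⟨max T 0, fun t ht => ?_⟩
  have ht0 : 0 ≤ t := (le_max_right _ _).trans ht
  have h1 : V t - l < δ * (ε / 2) := by
    have := hT t ((le_max_left _ _).trans ht)
    rw [Real.dist_eq, max_eq_left ht0] at this
    exact (le_abs_self _).trans_lt this
  have hwt : ∀ s, t ≤ s → s ≤ t + δ → w t - K * δ ≤ w s := by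
    intro s hs hs'
    have h2 := norm_sub_le_of_hasDerivWithinAt_Ici ht0 hs hw
      (fun r hr _ => hK r (ht0.trans hr))
    have h3 : K * (s - t) ≤ K * δ := by gcongr; linarith
    have h4 := neg_abs_le (w s - w t)
    rw [Real.norm_eq_abs] at h2
    linarith
  have h2 : V (t + δ) + (w t - K * δ) * (t + δ) ≤ V t + (w t - K * δ) * t := by
    have hd : ∀ r, 0 ≤ r → HasDerivWithinAt (fun r => V r + (w t - K * δ) * r)
        (V' r + (w t - K * δ)) (Set.Ici 0) r := fun r hr =>
      (hV r hr).add (by simpa using ((hasDerivAt_id r).const_mul (w t - K * δ)).hasDerivWithinAt)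
    refine antitoneOn_of_hasDerivWithinAt_nonpos (D := Set.Icc t (t + δ))
      (f := fun r => V r + (w t - K * δ) * r) (f' := fun r => V' r + (w t - K * δ))
      (convex_Icc _ _)
      (fun r hr => (hd r (ht0.trans hr.1)).continuousWithinAt.mono fun u hu => ht0.trans hu.1)
      (fun r hr => ?_) (fun r hr => ?_) ⟨le_rfl, by linarith⟩ ⟨by linarith, le_rfl⟩ (by linarith)
    · rw [interior_Icc] at *
      exact (hd r (ht0.trans hr.1.le)).mono fun u hu => ht0.trans hu.1.le
    · rw [interior_Icc] at hr
      have := hV' r (ht0.trans hr.1.le)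
      have := hwt r hr.1.le hr.2.le
      linarith
  have h3 := hl (t + δ) (by linarith)
  have h4 : δ * (w t - K * δ) < δ * (ε / 2) := by nlinarith
  have h5 := lt_of_mul_lt_mul_left h4 hδ.le
  rw [Real.dist_eq, sub_zero, abs_of_nonneg (hw0 t ht0)]
  linarith

/-- If a signal is bounded and its second derivative tends to zero, so does its derivative. -/
theorem tendsto_zero_of_bounded_primitive {z q q' : ℝ → Z} {B : ℝ}
    (hz : ∀ t, 0 ≤ t → HasDerivWithinAt z (q t) (Set.Ici 0) t)
    (hq : ∀ t, 0 ≤ t → HasDerivWithinAt q (q' t) (Set.Ici 0) t)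
    (hB : ∀ t, 0 ≤ t → ‖z t‖ ≤ B) (hq' : Tendsto q' atTop (𝓝 0)) : Tendsto q atTop (𝓝 0) := by
  have hB0 : 0 ≤ B := (norm_nonneg _).trans (hB 0 le_rfl)
  rw [Metric.tendsto_atTop]
  intro ε hε
  -- On a window of length `τ` far out, `q` varies by at most `ε / 4`. So `τ • q t` differs from an
  -- increment of `z`, of norm at most `2 B < τ ε / 2`, by at most `τ ε / 4`.
  set τ := 4 * (B + 1) / ε
  have hτ : 0 < τ := by positivity
  obtain ⟨T, hT⟩ := Metric.tendsto_atTop.1 hq' (ε / (4 * τ)) (by positivity)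
  refine ⟨max T 0, fun t ht => ?_⟩
  have ht0 : 0 ≤ t := (le_max_right _ _).trans ht
  have h1 : ∀ r, t ≤ r → r ≤ t + τ → ‖q r - q t‖ ≤ ε / 4 := by
    intro r hr hr'
    have h2 := norm_sub_le_of_hasDerivWithinAt_Ici (C := ε / (4 * τ)) ht0 hr hq (fun s hs _ => by
      have := hT s ((le_max_left _ _).trans (ht.trans hs))
      rw [dist_zero_right] at this
      exact this.le)
    refine h2.trans ?_
    calc ε / (4 * τ) * (r - t) ≤ ε / (4 * τ) * τ := by gcongr; linarith
      _ = ε / 4 := by field_simp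
  have h2 := norm_sub_le_of_hasDerivWithinAt_Ici (z := fun r => z r - r • q t)
    (z' := fun r => q r - q t) ht0 (by linarith : t ≤ t + τ)
    (fun r hr => (hz r hr).sub (by simpa using ((hasDerivAt_id r).smul_const (q t)).hasDerivWithinAt))
    h1
  have h3 : τ • q t = (z (t + τ) - z t) - (z (t + τ) - (t + τ) • q t - (z t - t • q t)) := by
    rw [add_smul]; abel
  have h4 : τ * ‖q t‖ ≤ 2 * B + ε / 4 * τ := by
    rw [← Real.norm_of_nonneg hτ.le, ← norm_smul, h3, Real.norm_of_nonneg hτ.le]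
    refine (norm_sub_le _ _).trans (add_le_add ((norm_sub_le _ _).trans ?_) ?_)
    · have := hB t ht0
      have := hB (t + τ) (by linarith)
      linarith
    · refine h2.trans (le_of_eq ?_); ring
  have h5 : 2 * B < τ * (ε / 2) := by
    have : τ * (ε / 2) = 2 * (B + 1) := by simp only [τ]; field_simp; ring
    linarith
  have h6 : τ * ‖q t‖ < τ * ε := by nlinarith
  rw [dist_zero_right]
  exact lt_of_mul_lt_mul_left h6 hτ.le

end Asymptotics

/-! ### Positive semidefinite operators and generalized inverses -/

section Operators

variable {E : Type*} [NormedAddCommGroup E] [InnerProductSpace ℝ E]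

/-- The quadratic form is evaluated at `c • u - L u` with `c = ‖L‖ + 1`. This converts decay of `⟨u,
L u⟩` into decay of `L u`. -/
lemma norm_sq_apply_le_of_psd {L : E →L[ℝ] E} (hs : ∀ u v, inner ℝ (L u) v = inner ℝ u (L v))
    (hp : ∀ u, 0 ≤ inner ℝ u (L u)) :
    ∃ C, 0 ≤ C ∧ ∀ u, ‖L u‖ ^ 2 ≤ C * inner ℝ u (L u) := by
  refine ⟨‖L‖ + 1, by positivity, fun u => ?_⟩
  set c := ‖L‖ + 1
  have hc : 0 < c := by positivity
  have h1 := hp (c • u - L u)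
  have h2 : inner ℝ (L u) (L (L u)) ≤ c * ‖L u‖ ^ 2 := by
    refine (real_inner_le_norm _ _).trans ?_
    have := L.le_opNorm (L u)
    have h3 : ‖L u‖ * ‖L (L u)‖ ≤ ‖L u‖ * (‖L‖ * ‖L u‖) := by gcongr
    nlinarith [sq_nonneg ‖L u‖]
  simp only [map_sub, map_smul, inner_sub_left, inner_sub_right, real_inner_smul_left,
    real_inner_smul_right] at h1
  rw [← hs u (L u), real_inner_self_eq_norm_sq] at h1
  have h4 : c * ‖L u‖ ^ 2 ≤ c * (c * inner ℝ u (L u)) := by nlinarith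
  exact le_of_mul_le_mul_left h4 hc

/-- A right inverse of `L` onto its range, extended linearly to `E`. It serves to write the energy
of the integral state as a function of `y` alone. -/
lemma exists_generalized_inverse [FiniteDimensional ℝ E] (L : E →L[ℝ] E) :
    ∃ Q : E →L[ℝ] E, ∀ u, L (Q (L u)) = L u := by
  obtain ⟨g, hg⟩ := (L : E →ₗ[ℝ] E).rangeRestrict.exists_rightInverse_of_surjective
    (LinearMap.range_eq_top.2 (LinearMap.surjective_rangeRestrict _))
  obtain ⟨Q, hQ⟩ := LinearMap.exists_extend g
  refine ⟨LinearMap.toContinuousLinearMap Q, fun u => ?_⟩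
  have h1 : Q (L u) = g ((L : E →ₗ[ℝ] E).rangeRestrict u) := by
    rw [← hQ]; rfl
  have h2 := LinearMap.congr_fun hg ((L : E →ₗ[ℝ] E).rangeRestrict u)
  have h3 := congrArg Subtype.val h2
  simpa [h1] using h3

end Operators

/-! ### Passivity of a single agent -/

section Agent

variable {H : Type*} [NormedAddCommGroup H] [InnerProductSpace ℝ H]

/-- The Bregman distance from `u` to `x`. -/
def bregman (f : H → ℝ) (g : H → H) (u x : H) : ℝ := f x - f u - inner ℝ (g u) (x - u)

lemma bregman_nonneg {f : H → ℝ} {g : H → H} (hf : ∀ x y, f x + inner ℝ (g x) (y - x) ≤ f y)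
    (u x : H) : 0 ≤ bregman f g u x := by
  have := hf u x
  unfold bregman
  linarith

/-- The part of the storage function of an agent that depends on its cost function. -/
noncomputable def costStorage (f : H → ℝ) (g : H → H) (a : ℝ) (u X Γ : H) (Ψ : ℝ) : ℝ :=
  bregman f g u X + a * (Ψ + a⁻¹ * f u - inner ℝ Γ u) - a * inner ℝ (X - u) (Γ - a⁻¹ • g u)

/-- The storage function of an agent, relative to an optimal point `u`. -/
noncomputable def agentStorage (f : H → ℝ) (g : H → H) (M : H →L[ℝ] H) (ρ e a : ℝ) (u x X ξ Γ : H) (Ψ : ℝ) : ℝ :=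
  a * costStorage f g a u X Γ Ψ + e * (1 / 2 * ‖x - X‖ ^ 2)
    + ρ * e * a * (1 / 2 * inner ℝ (M (X - a • ξ)) (X - a • ξ))
    + 1 / 4 * (e * (1 / 2 * ‖X - u‖ ^ 2)
      + ρ * e * a * (1 / 2 * inner ℝ (M (ξ - a⁻¹ • u)) (ξ - a⁻¹ • u)))

lemma hasDerivWithinAt_half_inner_self {M : H →L[ℝ] H}
    (hM : ∀ u v, inner ℝ (M u) v = inner ℝ u (M v)) {z : ℝ → H} {z' : H} {s : Set ℝ} {t : ℝ}
    (hz : HasDerivWithinAt z z' s t) :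
    HasDerivWithinAt (fun t => 1 / 2 * inner ℝ (M (z t)) (z t)) (inner ℝ (M (z t)) z') s t := by
  have h1 : HasDerivWithinAt (fun t => M (z t)) (M z') s t :=
    M.hasFDerivAt.comp_hasDerivWithinAt t hz
  refine ((h1.inner ℝ hz).const_mul (1 / 2)).congr_deriv ?_
  rw [hM z' (z t), real_inner_comm z' (M (z t))]
  ring

lemma hasDerivWithinAt_half_norm_sq {z : ℝ → H} {z' : H} {s : Set ℝ} {t : ℝ}
    (hz : HasDerivWithinAt z z' s t) :
    HasDerivWithinAt (fun t => 1 / 2 * ‖z t‖ ^ 2) (inner ℝ (z t) z') s t := by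
  refine (hz.norm_sq.const_mul (1 / 2)).congr_deriv ?_
  ring

variable {f : H → ℝ} {g : H → H}

/-- Write `S = f X - a ⟨Γ, X⟩ + a Ψ` for the storage. Two gradient inequalities, between `x` and `X`
in both directions, give `S' ≤ ⟨x - X, g x - a Γ⟩ - a S`, using `a ≤ 1`. Then `a S` is weakened to
`S / (4 a)`, which splits into the supply term with factor `1 / 4` and the gap. -/
lemma costStorage_hasDerivWithinAt (hg : ∀ x, HasFDerivAt f (innerSL ℝ (g x)) x)
    (hf : ∀ x y, f x + inner ℝ (g x) (y - x) ≤ f y) {a : ℝ} (ha : 1 / 2 < a) (ha1 : a ≤ 1) (u : H)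
    {x X Γ : ℝ → H} {Ψ : ℝ → ℝ} {s : Set ℝ} {t : ℝ}
    (hX : HasDerivWithinAt X (x t - X t) s t) (hΓ : HasDerivWithinAt Γ (g (x t) - a • Γ t) s t)
    (hΨ : HasDerivWithinAt Ψ (inner ℝ (g (x t)) (x t) - f (x t) - a * Ψ t) s t)
    (hyoung : ∀ y, 0 ≤ f y - a * inner ℝ (Γ t) y + a * Ψ t) :
    ∃ S' : ℝ, HasDerivWithinAt (fun t => costStorage f g a u (X t) (Γ t) (Ψ t)) S' s t ∧
      S' ≤ inner ℝ (x t - X t) (g (x t) - a • Γ t)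
        + 1 / 4 * inner ℝ (X t - u) (Γ t - a⁻¹ • g u)
        - 1 / (4 * a) * (bregman f g u (X t) + a * (Ψ t + a⁻¹ * f u - inner ℝ (Γ t) u)) := by
  have ha0 : 0 < a := by linarith
  have hfX : HasDerivWithinAt (fun t => f (X t)) (inner ℝ (g (X t)) (x t - X t)) s t := by
    exact (hg (X t)).comp_hasDerivWithinAt t hX
  have hXu : HasDerivWithinAt (fun t => X t - u) (x t - X t) s t := hX.sub_const u
  have hΓu : HasDerivWithinAt (fun t => Γ t - a⁻¹ • g u) (g (x t) - a • Γ t) s t := hΓ.sub_const _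
  have h1 : HasDerivWithinAt (fun t => inner ℝ (g u) (X t - u)) (inner ℝ (g u) (x t - X t)) s t := by
    simpa using (hasDerivWithinAt_const t s (g u)).inner ℝ hXu
  have h2 : HasDerivWithinAt (fun t => inner ℝ (Γ t) u) (inner ℝ (g (x t) - a • Γ t) u) s t := by
    simpa using hΓ.inner ℝ (hasDerivWithinAt_const t s u)
  have h3 := hXu.inner ℝ hΓu
  refine ⟨_, (((hfX.sub_const (f u)).sub h1).add
    (((hΨ.add_const (a⁻¹ * f u)).sub h2).const_mul a)).sub (h3.const_mul a), ?_⟩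
  have hc1 := hf (x t) (X t)
  have hc2 := hf (X t) (x t)
  have hy := hyoung (X t)
  have hinv : a * a⁻¹ = 1 := mul_inv_cancel₀ ha0.ne'
  -- This is where `1 / 2 < a` enters, and where the weight `1 / 4` of the second supply term comes
  -- from.
  have hcoef : 0 ≤ a - 1 / (4 * a) := by
    have : a - 1 / (4 * a) = (4 * a ^ 2 - 1) / (4 * a) := by field_simp
    rw [this]
    apply div_nonneg <;> nlinarith
  have hslack : 0 ≤ (1 - a) * (f (X t) - f (x t) - inner ℝ (g (x t)) (X t - x t)) :=
    mul_nonneg (by linarith) (by linarith)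
  have hyc : 0 ≤ a * f (X t) - a ^ 2 * inner ℝ (Γ t) (X t) + a ^ 2 * Ψ t
      - 1 / 4 * a⁻¹ * f (X t) + 1 / 4 * inner ℝ (Γ t) (X t) - 1 / 4 * Ψ t := by
    refine (mul_nonneg hcoef hy).trans_eq ?_
    field_simp
    ring
  have e1 : a * inner ℝ (x t - X t) (Γ t - a⁻¹ • g u)
      = a * inner ℝ (x t - X t) (Γ t) - inner ℝ (x t - X t) (g u) := by
    rw [inner_sub_right, real_inner_smul_right]
    field_simp
  have e2 : 1 / (4 * a) * (bregman f g u (X t) + a * (Ψ t + a⁻¹ * f u - inner ℝ (Γ t) u))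
      = 1 / 4 * a⁻¹ * (f (X t) - inner ℝ (g u) (X t - u)) + 1 / 4 * Ψ t
        - 1 / 4 * inner ℝ (Γ t) u := by
    unfold bregman
    field_simp
    ring
  rw [mul_add a (inner ℝ (X t - u) _), e1, e2]
  simp only [inner_sub_left, inner_sub_right, real_inner_smul_left, real_inner_smul_right,
    real_inner_comm (g (x t)) (X t), real_inner_comm (g (x t)) u, real_inner_comm (g (x t)) (x t),
    real_inner_comm (Γ t) (X t), real_inner_comm (Γ t) (x t), real_inner_comm (Γ t) u,
    real_inner_comm (g u) (X t), real_inner_comm (g u) u, real_inner_comm (g u) (x t)]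
    at hc1 hc2 hslack hyc ⊢
  have hinv' : a⁻¹ * a = 1 := by rw [mul_comm, hinv]
  linarith

/-- The dissipation inequality of an agent: `z` is the price signal it receives, and `M` is
its regularized Gram operator. -/
theorem agentStorage_hasDerivWithinAt (hg : ∀ x, HasFDerivAt f (innerSL ℝ (g x)) x)
    (hf : ∀ x y, f x + inner ℝ (g x) (y - x) ≤ f y) {M : H →L[ℝ] H} {ρ e a : ℝ} (hρ : 0 < ρ)
    (he : e * (1 + 2 * ρ) = 1) (ha : a = (1 + ρ) * e)
    (hM : ∀ u v, inner ℝ (M u) v = inner ℝ u (M v)) (hMe : ∀ u, e * ‖u‖ ^ 2 ≤ inner ℝ (M u) u)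
    {u zu : H} (hu : g u + zu = 0) {x X ξ Γ z : ℝ → H} {x' q : H} {Ψ : ℝ → ℝ} {s : Set ℝ} {t : ℝ}
    (hx : HasDerivWithinAt x x' s t)
    (hX : HasDerivWithinAt X (x t - X t) s t) (hξ : HasDerivWithinAt ξ (X t - a • ξ t) s t)
    (hΓ : HasDerivWithinAt Γ (g (x t) - a • Γ t) s t)
    (hΨ : HasDerivWithinAt Ψ (inner ℝ (g (x t)) (x t) - f (x t) - a * Ψ t) s t)
    (hyoung : ∀ y, 0 ≤ f y - a * inner ℝ (Γ t) y + a * Ψ t)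
    (hz : z t = -(a • Γ t + e • (x t - X t) + (ρ * e) • M (X t - a • ξ t)))
    (hq : q = -(a • (g (x t) - a • Γ t) + e • (x' - (x t - X t))
      + (ρ * e) • M (x t - X t - a • (X t - a • ξ t)))) :
    ∃ S' : ℝ, HasDerivWithinAt
        (fun t => agentStorage f g M ρ e a u (x t) (X t) (ξ t) (Γ t) (Ψ t)) S' s t ∧
      S' ≤ -(inner ℝ (x t - X t) q + 1 / 4 * inner ℝ (X t - u) (z t - zu))
        - (1 / 4 * (bregman f g u (X t) + a * (Ψ t + a⁻¹ * f u - inner ℝ (Γ t) u))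
          + ρ * e ^ 2 * ‖x t - X t - a • (X t - a • ξ t)‖ ^ 2
          + 1 / 4 * (ρ * e ^ 2) * ‖X t - a • ξ t‖ ^ 2) := by
  have he0 : 0 < e := by
    by_contra! h
    nlinarith
  have ha0 : 0 < a := by rw [ha]; positivity
  have ha1 : 1 / 2 < a := by rw [ha]; nlinarith
  have ha2 : a ≤ 1 := by rw [ha]; nlinarith
  obtain ⟨C', hC, hC'⟩ := costStorage_hasDerivWithinAt hg hf ha1 ha2 u hX hΓ hΨ hyoung
  have hp := hx.sub hX
  have hπ := hX.sub (hξ.const_smul a)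
  have hξu := hξ.sub_const (a⁻¹ • u)
  refine ⟨_, (((hC.const_mul a).add ((hasDerivWithinAt_half_norm_sq hp).const_mul e)).add
    ((hasDerivWithinAt_half_inner_self hM hπ).const_mul (ρ * e * a))).add
    ((((hasDerivWithinAt_half_norm_sq (hX.sub_const u)).const_mul e).add
    ((hasDerivWithinAt_half_inner_self hM hξu).const_mul (ρ * e * a))).const_mul (1 / 4)), ?_⟩
  have hC'' := mul_le_mul_of_nonneg_left hC' ha0.le
  have e2 : a * (1 / (4 * a) * (bregman f g u (X t) + a * (Ψ t + a⁻¹ * f u - inner ℝ (Γ t) u)))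
      = 1 / 4 * (bregman f g u (X t) + a * (Ψ t + a⁻¹ * f u - inner ℝ (Γ t) u)) := by
    field_simp
  rw [mul_sub, mul_add, e2] at hC''
  have h1 : a • (Γ t - a⁻¹ • g u) = a • Γ t + zu := by
    rw [smul_sub, smul_inv_smul₀ ha0.ne', eq_neg_of_add_eq_zero_left hu, sub_neg_eq_add]
  have h2 : a • (ξ t - a⁻¹ • u) = (X t - u) - (X t - a • ξ t) := by
    rw [smul_sub, smul_inv_smul₀ ha0.ne']; abel
  set π := X t - a • ξ t
  set p := x t - X t
  -- Here `p = X'` and `π = ξ'`, so `π' = p - a • π`. The supply contains `⟨p, M π'⟩` and the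
  -- storage derivative `a ⟨M π, π'⟩`; the surplus `⟨M π', π'⟩` is dissipated.
  have h3 : p = (p - a • π) + a • π := by abel
  have h4 := mul_le_mul_of_nonneg_left (hMe (p - a • π)) (by positivity : 0 ≤ ρ * e)
  have h5 := mul_le_mul_of_nonneg_left (hMe π) (by positivity : 0 ≤ 1 / 4 * (ρ * e))
  have h6 : inner ℝ p (M (p - a • π))
      = inner ℝ (M (p - a • π)) (p - a • π) + a * inner ℝ (M π) (p - a • π) := by
    generalize p - a • π = r at h3
    rw [h3, inner_add_left, real_inner_smul_left, ← hM π, real_inner_comm]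
  -- As `a • (ξ - a⁻¹ • u) = (X - u) - π`, the `ξ`-energy supplies `⟨M π, X - u⟩` and dissipates `⟨M
  -- π, π⟩`.
  have h7 : a * inner ℝ (M (ξ t - a⁻¹ • u)) π = inner ℝ (M π) (X t - u) - inner ℝ (M π) π := by
    rw [hM, ← real_inner_smul_left, h2, inner_sub_left, real_inner_comm, real_inner_comm (M π) π]
  have h8 : inner ℝ (X t - u) (z t - zu) = -(a * inner ℝ (X t - u) (Γ t - a⁻¹ • g u)
      + e * inner ℝ (X t - u) p + ρ * e * inner ℝ (M π) (X t - u)) := by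
    have : z t - zu = -(a • (Γ t - a⁻¹ • g u) + e • p + (ρ * e) • M π) := by
      rw [h1, hz]; abel
    rw [this, inner_neg_right, inner_add_right, inner_add_right, real_inner_smul_right,
      real_inner_smul_right, real_inner_smul_right, real_inner_comm (M π)]
  have h9 : inner ℝ p q = -(a * inner ℝ p (g (x t) - a • Γ t) + e * inner ℝ p (x' - p)
      + ρ * e * inner ℝ p (M (p - a • π))) := by
    rw [hq, inner_neg_right, inner_add_right, inner_add_right, real_inner_smul_right,
      real_inner_smul_right, real_inner_smul_right]
  rw [h8, h9, h6]
  have h10 : ρ * e * a * inner ℝ (M (ξ t - a⁻¹ • u)) π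
      = ρ * e * (inner ℝ (M π) (X t - u) - inner ℝ (M π) π) := by rw [← h7]; ring
  change a * C' + e * inner ℝ p (x' - p) + ρ * e * a * inner ℝ (M π) (p - a • π)
    + 1 / 4 * (e * inner ℝ (X t - u) p + ρ * e * a * inner ℝ (M (ξ t - a⁻¹ • u)) π) ≤ _
  rw [h10]
  linarith

end Agent

section Agent

variable {H : Type*} [NormedAddCommGroup H] [InnerProductSpace ℝ H]

/-- All terms in `u` cancel on expansion: what remains is the Fenchel–Young gap at `(X, a Γ)`. -/
lemma costStorage_nonneg {f : H → ℝ} {g : H → H} {a : ℝ} (ha : 0 < a) {u X Γ : H} {Ψ : ℝ}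
    (hyoung : ∀ y, 0 ≤ f y - a * inner ℝ Γ y + a * Ψ) : 0 ≤ costStorage f g a u X Γ Ψ := by
  refine (hyoung X).trans_eq ?_
  unfold costStorage bregman
  simp only [inner_sub_left, inner_sub_right, real_inner_smul_right]
  rw [real_inner_comm (g u) X, real_inner_comm (g u) u, real_inner_comm Γ X, real_inner_comm Γ u]
  field_simp
  ring

lemma le_agentStorage {f : H → ℝ} {g : H → H} {M : H →L[ℝ] H} {ρ e a : ℝ} (hρ : 0 < ρ)
    (he : 0 < e) (ha : 0 < a) (hM : ∀ u, 0 ≤ inner ℝ (M u) u) {u x X ξ Γ : H} {Ψ : ℝ}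
    (hyoung : ∀ y, 0 ≤ f y - a * inner ℝ Γ y + a * Ψ) :
    e / 8 * (‖x - X‖ ^ 2 + ‖X - u‖ ^ 2) ≤ agentStorage f g M ρ e a u x X ξ Γ Ψ := by
  have h1 := mul_nonneg ha.le (costStorage_nonneg (g := g) (u := u) (X := X) ha hyoung)
  have h2 : 0 ≤ ρ * e * a * (1 / 2 * inner ℝ (M (X - a • ξ)) (X - a • ξ)) := by
    have := hM (X - a • ξ); positivity
  have h3 : 0 ≤ ρ * e * a * (1 / 2 * inner ℝ (M (ξ - a⁻¹ • u)) (ξ - a⁻¹ • u)) := by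
    have := hM (ξ - a⁻¹ • u); positivity
  have h4 : 0 ≤ e * ‖x - X‖ ^ 2 := by positivity
  unfold agentStorage
  linarith

end Agent

/-! ### The abstract primal-dual flow, its filters and its storage function -/

/-- The data of a primal-dual flow: agents with decision spaces `H i` and costs `f i`, coupled
through the dual space `E`. -/
structure PrimalDual (ι : Type*) (E : Type*) (H : ι → Type*)
    [NormedAddCommGroup E] [InnerProductSpace ℝ E]
    [∀ i, NormedAddCommGroup (H i)] [∀ i, InnerProductSpace ℝ (H i)] where
  f : ∀ i, H i → ℝ
  g : ∀ i, H i → H i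
  A : ∀ i, H i →L[ℝ] E
  B : ∀ i, E →L[ℝ] H i
  L : E →L[ℝ] E
  c : E
  ρ : ι → ℝ
  hasGradient : ∀ i x, HasFDerivAt (f i) (innerSL ℝ (g i x)) x
  convex : ∀ i x y, f i x + inner ℝ (g i x) (y - x) ≤ f i y
  locallyLipschitz : ∀ i, LocallyLipschitz (g i)
  adjoint : ∀ i x v, inner ℝ (A i x) v = inner ℝ x (B i v)
  orthogonal : ∀ i j x, i ≠ j → B j (A i x) = 0
  symm : ∀ u v, inner ℝ (L u) v = inner ℝ u (L v)
  psd : ∀ u, 0 ≤ inner ℝ u (L u)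
  ρ_pos : ∀ i, 0 < ρ i

/-- The state of a primal-dual flow together with the states of the filters that enter its
storage function. -/
structure FilteredState (ι : Type*) (E : Type*) (H : ι → Type*) where
  v : E
  y : E
  x : ∀ i, H i
  ζ : E
  X : ∀ i, H i
  ξ : ∀ i, H i
  Γ : ∀ i, H i
  Ψ : ι → ℝ

namespace PrimalDual

variable {ι : Type*} {E : Type*} {H : ι → Type*}
    [NormedAddCommGroup E] [InnerProductSpace ℝ E]
    [∀ i, NormedAddCommGroup (H i)] [∀ i, InnerProductSpace ℝ (H i)] (N : PrimalDual ι E H)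

/-- The constants `e` and `a` and the operator `M` are tuned so that the residual `r` of the price
identity obeys `r' = -a r`. Matching coefficients forces `a = (1 + ρ) e` and `e (1 + 2 ρ) = 1`, and
the term `B A (x - X)` is absorbed by `M`. -/
noncomputable def e (i : ι) : ℝ := (1 + 2 * N.ρ i)⁻¹

noncomputable def a (i : ι) : ℝ := (1 + N.ρ i) * N.e i

/-- The regularized Gram operator of an agent. -/
noncomputable def M (i : ι) : H i →L[ℝ] H i :=
  N.e i • ContinuousLinearMap.id ℝ (H i) + (N.B i).comp (N.A i)

lemma e_pos (i : ι) : 0 < N.e i := by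
  have := N.ρ_pos i
  unfold e; positivity

lemma a_pos (i : ι) : 0 < N.a i := by
  have := N.ρ_pos i
  have := N.e_pos i
  unfold a; positivity

lemma e_mul (i : ι) : N.e i * (1 + 2 * N.ρ i) = 1 := by
  have := N.ρ_pos i
  unfold e; field_simp

lemma M_apply (i : ι) (u : H i) : N.M i u = N.e i • u + N.B i (N.A i u) := rfl

lemma M_symm (i : ι) (u v : H i) : inner ℝ (N.M i u) v = inner ℝ u (N.M i v) := by
  rw [M_apply, M_apply, inner_add_left, inner_add_right, real_inner_smul_left,
    real_inner_smul_right, ← N.adjoint, real_inner_comm v (N.B i (N.A i u)), ← N.adjoint,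
    real_inner_comm (N.A i u)]

lemma le_inner_M (i : ι) (u : H i) : N.e i * ‖u‖ ^ 2 ≤ inner ℝ (N.M i u) u := by
  rw [N.M_symm, M_apply, inner_add_right, real_inner_smul_right, ← N.adjoint,
    real_inner_self_eq_norm_sq, real_inner_self_eq_norm_sq]
  nlinarith [sq_nonneg ‖N.A i u‖]

lemma inner_M_nonneg (i : ι) (u : H i) : 0 ≤ inner ℝ (N.M i u) u :=
  le_trans (mul_nonneg (N.e_pos i).le (sq_nonneg _)) (N.le_inner_M i u)

variable [Fintype ι]

/-- The optimality conditions, with `y` the equilibrium value of the integral state. -/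
structure IsEquilibrium (u : ∀ i, H i) (vs ys : E) : Prop where
  stationary : ∀ i, N.g i (u i) + N.B i vs = 0
  consensus : N.L vs = 0
  balance : ys = ∑ i, N.A i (u i) - N.c

/-- The right-hand side of the flow. -/
noncomputable def field (z : E × E × (∀ i, H i)) : E × E × (∀ i, H i) :=
  (∑ i, N.A i (z.2.2 i) - N.c - N.L z.1 - z.2.1, N.L z.1,
    fun i => -((1 + N.ρ i) • N.g i (z.2.2 i)) - N.ρ i • N.B i (N.A i (z.2.2 i) - N.c - z.2.1)
      - (1 + N.ρ i) • N.B i z.1)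

/-- The trajectory `σ` follows the flow on `[0, T)`, and its remaining components are the
filtered signals. -/
structure IsFiltered (T : ℝ) (σ : ℝ → FilteredState ι E H) : Prop where
  continuousOn_v : ContinuousOn (fun t => (σ t).v) (Set.Ici 0)
  continuousOn_y : ContinuousOn (fun t => (σ t).y) (Set.Ici 0)
  continuousOn_x : ∀ i, ContinuousOn (fun t => (σ t).x i) (Set.Ici 0)
  flow : ∀ t ∈ Set.Ico 0 T, HasDerivWithinAt (fun t => ((σ t).v, (σ t).y, (σ t).x))
    (N.field ((σ t).v, (σ t).y, (σ t).x)) (Set.Ici 0) t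
  deriv_ζ : ∀ t, 0 ≤ t → HasDerivWithinAt (fun t => (σ t).ζ) ((σ t).v - (σ t).ζ) (Set.Ici 0) t
  deriv_X : ∀ i t, 0 ≤ t →
    HasDerivWithinAt (fun t => (σ t).X i) ((σ t).x i - (σ t).X i) (Set.Ici 0) t
  deriv_ξ : ∀ i t, 0 ≤ t →
    HasDerivWithinAt (fun t => (σ t).ξ i) ((σ t).X i - N.a i • (σ t).ξ i) (Set.Ici 0) t
  deriv_Γ : ∀ i t, 0 ≤ t →
    HasDerivWithinAt (fun t => (σ t).Γ i) (N.g i ((σ t).x i) - N.a i • (σ t).Γ i) (Set.Ici 0) t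
  deriv_Ψ : ∀ i t, 0 ≤ t → HasDerivWithinAt (fun t => (σ t).Ψ i)
    (inner ℝ (N.g i ((σ t).x i)) ((σ t).x i) - N.f i ((σ t).x i) - N.a i * (σ t).Ψ i) (Set.Ici 0) t
  init_ζ : (σ 0).v - (σ 0).ζ = ∑ i, N.A i ((σ 0).X i) - N.c - (σ 0).y
  init_ξ : ∀ i, N.B i (σ 0).ζ = -(N.a i • (σ 0).Γ i + N.e i • ((σ 0).x i - (σ 0).X i)
    + (N.ρ i * N.e i) • N.M i ((σ 0).X i - N.a i • (σ 0).ξ i))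
  init_young : ∀ i y, 0 ≤ N.f i y - N.a i * inner ℝ ((σ 0).Γ i) y + N.a i * (σ 0).Ψ i

namespace IsFiltered

variable {N} {T : ℝ} {σ : ℝ → FilteredState ι E H}

lemma deriv_v (h : N.IsFiltered T σ) {t : ℝ} (ht : t ∈ Set.Ico 0 T) :
    HasDerivWithinAt (fun t => (σ t).v)
      (∑ i, N.A i ((σ t).x i) - N.c - N.L (σ t).v - (σ t).y) (Set.Ici 0) t :=
  (h.flow t ht).fst

lemma deriv_y (h : N.IsFiltered T σ) {t : ℝ} (ht : t ∈ Set.Ico 0 T) :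
    HasDerivWithinAt (fun t => (σ t).y) (N.L (σ t).v) (Set.Ici 0) t :=
  (h.flow t ht).snd.fst

lemma deriv_x (h : N.IsFiltered T σ) (i : ι) {t : ℝ} (ht : t ∈ Set.Ico 0 T) :
    HasDerivWithinAt (fun t => (σ t).x i)
      (-((1 + N.ρ i) • N.g i ((σ t).x i)) - N.ρ i • N.B i (N.A i ((σ t).x i) - N.c - (σ t).y)
        - (1 + N.ρ i) • N.B i (σ t).v) (Set.Ici 0) t :=
  hasDerivWithinAt_pi.1 (h.flow t ht).snd.snd i

/-- Jensen's inequality in differential form: by the gradient inequality at `x t`, the right-hand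
side `r` satisfies `r' ≥ -a r`, and it is nonnegative initially. -/
lemma young (h : N.IsFiltered T σ) (i : ι) (y : H i) {t : ℝ} (ht : 0 ≤ t) :
    0 ≤ N.f i y - N.a i * inner ℝ ((σ t).Γ i) y + N.a i * (σ t).Ψ i := by
  have hd : ∀ t, 0 ≤ t → HasDerivWithinAt
      (fun t => N.f i y - N.a i * inner ℝ ((σ t).Γ i) y + N.a i * (σ t).Ψ i)
      (-(N.a i * inner ℝ (N.g i ((σ t).x i) - N.a i • (σ t).Γ i) y)
        + N.a i * (inner ℝ (N.g i ((σ t).x i)) ((σ t).x i) - N.f i ((σ t).x i)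
          - N.a i * (σ t).Ψ i)) (Set.Ici 0) t := fun t ht => by
    have h1 := (h.deriv_Γ i t ht).inner ℝ (hasDerivWithinAt_const t (Set.Ici 0) y)
    refine (((h1.const_mul (N.a i)).const_sub (N.f i y)).add
      ((h.deriv_Ψ i t ht).const_mul (N.a i))).congr_deriv ?_
    simp
  refine nonneg_of_hasDerivWithinAt_ge_neg_mul (c := N.a i) (T := t)
    (fun t ht => (hd t ht).continuousWithinAt) (fun t ht => hd t ht.1) (fun t ht => ?_)
    (h.init_young i y) t ⟨ht, le_rfl⟩
  have h1 := mul_le_mul_of_nonneg_left (N.convex i ((σ t).x i) y) (N.a_pos i).le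
  simp only [inner_sub_left, inner_sub_right, real_inner_smul_left] at h1 ⊢
  linarith

/-- The difference of the two sides decays at rate 1 and starts at zero; the terms `L v` from `v'`
and `y'` cancel. -/
lemma sub_ζ (h : N.IsFiltered T σ) {t : ℝ} (ht : t ∈ Set.Icc 0 T) :
    (σ t).v - (σ t).ζ = ∑ i, N.A i ((σ t).X i) - N.c - (σ t).y := by
  have hA : ∀ t, 0 ≤ t → HasDerivWithinAt (fun t => ∑ i, N.A i ((σ t).X i))
      (∑ i, N.A i ((σ t).x i - (σ t).X i)) (Set.Ici 0) t := fun t ht =>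
    HasDerivWithinAt.fun_sum fun i _ => (N.A i).hasFDerivAt.comp_hasDerivWithinAt t (h.deriv_X i t ht)
  have := eqOn_zero_of_linear_decay (c := 1) (T := T)
    (r := fun t => (σ t).v - (σ t).ζ - (∑ i, N.A i ((σ t).X i) - N.c - (σ t).y))
    ((h.continuousOn_v.sub fun t ht => (h.deriv_ζ t ht).continuousWithinAt).sub
      ((ContinuousOn.sub (fun t ht => (hA t ht).continuousWithinAt) continuousOn_const).sub
        h.continuousOn_y)) (fun t ht => by
      refine (((h.deriv_v ht).sub (h.deriv_ζ t ht.1)).sub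
        (((hA t ht.1).sub_const N.c).sub (h.deriv_y ht))).congr_deriv ?_
      simp only [map_sub, Finset.sum_sub_distrib, one_smul]
      abel) (by rw [sub_eq_zero]; exact h.init_ζ) t ht
  exact sub_eq_zero.1 this

/-- Orthogonality of the agents decouples them: each agent sees only its own part of the coupling
residual. -/
lemma B_sum (i : ι) (x : ∀ i, H i) : N.B i (∑ j, N.A j (x j)) = N.B i (N.A i (x i)) := by
  rw [map_sum]
  exact Finset.sum_eq_single i (fun j _ hj => N.orthogonal j i _ hj) (by simp)

lemma B_residual (h : N.IsFiltered T σ) (i : ι) {t : ℝ} (ht : t ∈ Set.Icc 0 T) :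
    N.B i (N.A i ((σ t).x i) - N.c - (σ t).y)
      = N.B i ((σ t).v - (σ t).ζ) + N.B i (N.A i ((σ t).x i - (σ t).X i)) := by
  rw [h.sub_ζ ht, map_sub _ _ (σ t).y, map_sub, map_sub _ _ (σ t).y, map_sub, B_sum, map_sub, map_sub]
  abel

lemma price_aux (h : N.IsFiltered T σ) (i : ι) {t : ℝ} (ht : t ∈ Set.Ico 0 T) :
    HasDerivWithinAt (fun t => (σ t).x i)
      (-((1 + N.ρ i) • N.g i ((σ t).x i)) - N.ρ i • (N.B i ((σ t).v - (σ t).ζ)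
        + N.B i (N.A i ((σ t).x i - (σ t).X i)))
        - (1 + N.ρ i) • (N.B i ((σ t).v - (σ t).ζ) + N.B i (σ t).ζ)) (Set.Ici 0) t := by
  refine (h.deriv_x i ht).congr_deriv ?_
  rw [h.B_residual i ⟨ht.1, ht.2.le⟩, ← map_add (N.B i) _ (σ t).ζ, sub_add_cancel]

/-- The residual of this identity decays at rate `a` and starts at zero. It makes the price a
function of the agent's own filtered signals. -/
lemma price (h : N.IsFiltered T σ) (i : ι) {t : ℝ} (ht : t ∈ Set.Icc 0 T) :
    N.B i (σ t).ζ = -(N.a i • (σ t).Γ i + N.e i • ((σ t).x i - (σ t).X i)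
      + (N.ρ i * N.e i) • N.M i ((σ t).X i - N.a i • (σ t).ξ i)) := by
  have hB : ∀ t, 0 ≤ t → HasDerivWithinAt (fun t => N.B i (σ t).ζ)
      (N.B i ((σ t).v - (σ t).ζ)) (Set.Ici 0) t := fun t ht =>
    (N.B i).hasFDerivAt.comp_hasDerivWithinAt t (h.deriv_ζ t ht)
  have hM : ∀ t, 0 ≤ t → HasDerivWithinAt (fun t => N.M i ((σ t).X i - N.a i • (σ t).ξ i))
      (N.M i ((σ t).x i - (σ t).X i - N.a i • ((σ t).X i - N.a i • (σ t).ξ i))) (Set.Ici 0) t :=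
    fun t ht => (N.M i).hasFDerivAt.comp_hasDerivWithinAt t
      ((h.deriv_X i t ht).sub ((h.deriv_ξ i t ht).const_smul (N.a i)))
  have := eqOn_zero_of_linear_decay (c := N.a i) (T := T)
    (r := fun t => N.B i (σ t).ζ + (N.a i • (σ t).Γ i + N.e i • ((σ t).x i - (σ t).X i)
      + (N.ρ i * N.e i) • N.M i ((σ t).X i - N.a i • (σ t).ξ i)))
    (ContinuousOn.add (fun t ht => (hB t ht).continuousWithinAt)
      (((ContinuousOn.const_smul (fun t ht => (h.deriv_Γ i t ht).continuousWithinAt) _).add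
        (((h.continuousOn_x i).sub fun t ht => (h.deriv_X i t ht).continuousWithinAt).const_smul
          _)).add (ContinuousOn.const_smul (fun t ht => (hM t ht).continuousWithinAt) _)))
    (fun t ht => by
      refine ((hB t ht.1).add ((((h.deriv_Γ i t ht.1).const_smul (N.a i)).add
        (((h.price_aux i ht).sub (h.deriv_X i t ht.1)).const_smul (N.e i))).add
        ((hM t ht.1).const_smul (N.ρ i * N.e i)))).congr_deriv ?_
      have he := N.e_mul i
      have ha : N.a i = (1 + N.ρ i) * N.e i := rfl
      rw [map_sub (N.M i) _ (N.a i • _), map_smul, M_apply N i ((σ t).x i - (σ t).X i)]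
      generalize N.B i ((σ t).v - (σ t).ζ) = q
      generalize N.B i (N.A i ((σ t).x i - (σ t).X i)) = n
      generalize N.B i (σ t).ζ = z
      generalize N.M i ((σ t).X i - N.a i • (σ t).ξ i) = m
      generalize (σ t).x i - (σ t).X i = p
      generalize N.g i ((σ t).x i) = g
      rw [ha]
      -- Solving `e (1 + 2 ρ) = 1` for `ρ` turns the coefficient comparison into identities in `e`
      -- alone.
      have he' : N.ρ i = (N.e i)⁻¹ / 2 - 1 / 2 := by
        have := N.e_pos i
        field_simp
        linarith
      have := (N.e_pos i).ne'
      rw [he']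
      match_scalars <;> field_simp <;> ring)
    (by simp only [h.init_ξ i, neg_add_cancel]) t ht
  exact eq_neg_of_add_eq_zero_left this

end IsFiltered

end PrimalDual

namespace PrimalDual

variable {ι : Type*} {E : Type*} {H : ι → Type*}
    [NormedAddCommGroup E] [InnerProductSpace ℝ E]
    [∀ i, NormedAddCommGroup (H i)] [∀ i, InnerProductSpace ℝ (H i)] (N : PrimalDual ι E H)

/-- Two Fenchel–Young defects. If both vanish, `X` minimizes `f - ⟨g u, ·⟩` and `u` minimizes `f - a
⟨Γ, ·⟩`, whence `g X = g u = a Γ`. -/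
noncomputable def gap (u : ∀ i, H i) (σ : FilteredState ι E H) (i : ι) : ℝ :=
  bregman (N.f i) (N.g i) (u i) (σ.X i)
    + N.a i * (σ.Ψ i + (N.a i)⁻¹ * N.f i (u i) - inner ℝ (σ.Γ i) (u i))

variable {N}

/-- Although `Q` need not be symmetric, on the range of `L` its form is the form of `L` on
preimages. -/
lemma inner_generalized_inverse {Q : E →L[ℝ] E} (hQ : ∀ w, N.L (Q (N.L w)) = N.L w) (h k : E) :
    inner ℝ (N.L h) (Q (N.L k)) = inner ℝ h (N.L k) := by rw [N.symm, hQ]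

variable [Fintype ι]

variable (N) in
/-- The storage function of the flow relative to an equilibrium; `Q` is a generalized inverse
of `N.L`. -/
noncomputable def storage (Q : E →L[ℝ] E) (u : ∀ i, H i) (vs ys : E) (σ : FilteredState ι E H) : ℝ :=
  1 / 2 * ‖σ.v - σ.ζ‖ ^ 2 + 1 / 2 * inner ℝ (N.L σ.ζ) σ.ζ
    + 1 / 4 * (1 / 2 * ‖σ.ζ - vs‖ ^ 2
      + 1 / 2 * inner ℝ (σ.y - ys - N.L σ.ζ) (Q (σ.y - ys - N.L σ.ζ)))
    + ∑ i, agentStorage (N.f i) (N.g i) (N.M i) (N.ρ i) (N.e i) (N.a i) (u i)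
      (σ.x i) (σ.X i) (σ.ξ i) (σ.Γ i) (σ.Ψ i)

variable (N) in
/-- The dissipation rate of the storage function. -/
noncomputable def dissipation (u : ∀ i, H i) (σ : FilteredState ι E H) : ℝ :=
  inner ℝ (σ.v - σ.ζ) (N.L (σ.v - σ.ζ)) + 1 / 4 * inner ℝ σ.ζ (N.L σ.ζ)
    + ∑ i, (1 / 4 * N.gap u σ i
      + N.ρ i * N.e i ^ 2 * ‖σ.x i - σ.X i - N.a i • (σ.X i - N.a i • σ.ξ i)‖ ^ 2
      + 1 / 4 * (N.ρ i * N.e i ^ 2) * ‖σ.X i - N.a i • σ.ξ i‖ ^ 2)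

/-- The range condition on `y - ys` makes the `Q`-term equal to the form of `L` at `h - ζ`, hence
nonnegative. -/
lemma storage_ge {Q : E →L[ℝ] E} (hQ : ∀ w, N.L (Q (N.L w)) = N.L w) {u : ∀ i, H i} {vs ys : E}
    {σ : FilteredState ι E H}
    (hyoung : ∀ i y, 0 ≤ N.f i y - N.a i * inner ℝ (σ.Γ i) y + N.a i * σ.Ψ i)
    (hy : ∃ h, σ.y - ys = N.L h) :
    1 / 2 * ‖σ.v - σ.ζ‖ ^ 2 + 1 / 8 * ‖σ.ζ - vs‖ ^ 2
      + ∑ i, N.e i / 8 * (‖σ.x i - σ.X i‖ ^ 2 + ‖σ.X i - u i‖ ^ 2) ≤ N.storage Q u vs ys σ := by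
  obtain ⟨h, hh⟩ := hy
  have h1 := Finset.sum_le_sum fun i (_ : i ∈ Finset.univ) =>
    le_agentStorage (f := N.f i) (g := N.g i) (u := u i) (x := σ.x i) (X := σ.X i) (ξ := σ.ξ i)
      (N.ρ_pos i) (N.e_pos i) (N.a_pos i) (N.inner_M_nonneg i) (hyoung i)
  have h2 := N.psd σ.ζ
  have h3 := N.psd (h - σ.ζ)
  unfold storage
  rw [hh, ← map_sub, inner_generalized_inverse hQ, N.symm σ.ζ]
  linarith

variable {T : ℝ} {σ : ℝ → FilteredState ι E H}

lemma IsFiltered.deriv_sub_ζ (h : N.IsFiltered T σ) {t : ℝ} (ht : t ∈ Set.Icc 0 T) :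
    ∑ i, N.A i ((σ t).x i) - N.c - N.L (σ t).v - (σ t).y - ((σ t).v - (σ t).ζ)
      = ∑ i, N.A i ((σ t).x i - (σ t).X i) - N.L (σ t).ζ - N.L ((σ t).v - (σ t).ζ) := by
  have hL : N.L (σ t).v = N.L (σ t).ζ + N.L ((σ t).v - (σ t).ζ) := by
    rw [← map_add, add_sub_cancel]
  rw [hL]
  generalize N.L ((σ t).v - (σ t).ζ) = l
  rw [h.sub_ζ ht]
  simp only [map_sub, Finset.sum_sub_distrib]
  abel

/-- The dissipation inequality of the flow. -/
theorem storage_hasDerivWithinAt (h : N.IsFiltered T σ) {Q : E →L[ℝ] E}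
    (hQ : ∀ w, N.L (Q (N.L w)) = N.L w) {u : ∀ i, H i} {vs ys : E} (hu : N.IsEquilibrium u vs ys)
    {t : ℝ} (ht : t ∈ Set.Ico 0 T) (hy : ∃ k, (σ t).y - ys = N.L k) :
    ∃ V' : ℝ, HasDerivWithinAt (fun t => N.storage Q u vs ys (σ t)) V' (Set.Ici 0) t ∧
      V' ≤ -N.dissipation u (σ t) := by
  have ht' : t ∈ Set.Icc 0 T := ⟨ht.1, ht.2.le⟩
  -- The time derivative of the price identity: `(B ζ)' = B (v - ζ)`.
  have hp : ∀ i, N.B i ((σ t).v - (σ t).ζ) =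
      -(N.a i • (N.g i ((σ t).x i) - N.a i • (σ t).Γ i)
        + N.e i • ((-((1 + N.ρ i) • N.g i ((σ t).x i)) - N.ρ i • (N.B i ((σ t).v - (σ t).ζ)
          + N.B i (N.A i ((σ t).x i - (σ t).X i)))
          - (1 + N.ρ i) • (N.B i ((σ t).v - (σ t).ζ) + N.B i (σ t).ζ)) - ((σ t).x i - (σ t).X i))
      + (N.ρ i * N.e i) • N.M i ((σ t).x i - (σ t).X i
        - N.a i • ((σ t).X i - N.a i • (σ t).ξ i))) := by
    intro i
    rw [map_sub (N.M i) ((σ t).x i - (σ t).X i), map_smul, h.price i ht', M_apply N i ((σ t).x i - (σ t).X i)]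
    have he := N.e_mul i
    have ha : N.a i = (1 + N.ρ i) * N.e i := rfl
    generalize N.B i ((σ t).v - (σ t).ζ) = q
    generalize N.B i (N.A i ((σ t).x i - (σ t).X i)) = n
    generalize N.M i ((σ t).X i - N.a i • (σ t).ξ i) = m
    generalize (σ t).x i - (σ t).X i = p
    generalize N.g i ((σ t).x i) = g
    rw [ha]
    have he' : N.ρ i = (N.e i)⁻¹ / 2 - 1 / 2 := by
      have := N.e_pos i
      field_simp
      linarith
    have := (N.e_pos i).ne'
    rw [he']
    match_scalars <;> field_simp <;> ring
  choose S' hS hS' using fun i => agentStorage_hasDerivWithinAt (N.hasGradient i) (N.convex i)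
    (N.ρ_pos i) (N.e_mul i) (rfl : N.a i = _) (N.M_symm i) (N.le_inner_M i) (hu.stationary i)
    (z := fun t => N.B i (σ t).ζ) (h.price_aux i ht) (h.deriv_X i t ht.1) (h.deriv_ξ i t ht.1)
    (h.deriv_Γ i t ht.1) (h.deriv_Ψ i t ht.1) (fun y => h.young i y ht.1) (h.price i ht') (hp i)
  have hLζ : HasDerivWithinAt (fun t => N.L (σ t).ζ) (N.L ((σ t).v - (σ t).ζ)) (Set.Ici 0) t :=
    N.L.hasFDerivAt.comp_hasDerivWithinAt t (h.deriv_ζ t ht.1)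
  have hY : HasDerivWithinAt (fun t => (σ t).y - ys - N.L (σ t).ζ) (N.L (σ t).ζ) (Set.Ici 0) t :=
    (((h.deriv_y ht).sub_const ys).sub hLζ).congr_deriv (by rw [map_sub]; abel)
  have hQY : HasDerivWithinAt (fun t => Q ((σ t).y - ys - N.L (σ t).ζ)) (Q (N.L (σ t).ζ))
      (Set.Ici 0) t := Q.hasFDerivAt.comp_hasDerivWithinAt t hY
  have hq : HasDerivWithinAt (fun t => (σ t).v - (σ t).ζ) _ (Set.Ici 0) t :=
    (h.deriv_v ht).sub (h.deriv_ζ t ht.1)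
  have hV := (((hasDerivWithinAt_half_norm_sq hq).add
    (hasDerivWithinAt_half_inner_self N.symm (h.deriv_ζ t ht.1))).add
    (((hasDerivWithinAt_half_norm_sq ((h.deriv_ζ t ht.1).sub_const vs)).add
      ((hY.inner ℝ hQY).const_mul (1 / 2))).const_mul (1 / 4))).add
    (HasDerivWithinAt.fun_sum (u := Finset.univ) fun i _ => hS i)
  refine ⟨_, hV, ?_⟩
  have hsum : ∑ i, S' i ≤ -(∑ i, inner ℝ ((σ t).x i - (σ t).X i) (N.B i ((σ t).v - (σ t).ζ))
      + 1 / 4 * ∑ i, inner ℝ ((σ t).X i - u i) (N.B i (σ t).ζ - N.B i vs))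
      - ∑ i, (1 / 4 * N.gap u (σ t) i
      + N.ρ i * N.e i ^ 2 * ‖(σ t).x i - (σ t).X i - N.a i • ((σ t).X i - N.a i • (σ t).ξ i)‖ ^ 2
      + 1 / 4 * (N.ρ i * N.e i ^ 2) * ‖(σ t).X i - N.a i • (σ t).ξ i‖ ^ 2) := by
    rw [Finset.mul_sum, ← Finset.sum_add_distrib, ← Finset.sum_neg_distrib,
      ← Finset.sum_sub_distrib]
    exact Finset.sum_le_sum fun i _ => hS' i
  obtain ⟨k, hk⟩ := hy
  have e1 : (σ t).y - ys - N.L (σ t).ζ = N.L (k - (σ t).ζ) := by rw [hk, map_sub]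
  have hsub := h.sub_ζ ht'
  have hAx := h.deriv_sub_ζ ht'
  -- With `Y = y - ys - L ζ` this says `ζ' = ∑ A (X - u) - L ζ - Y`, while `Y' = L ζ` by `hY`. So
  -- the network is a dissipative system with input `∑ A (X - u)` and output `ζ - vs`.
  have hYq : N.L (k - (σ t).ζ) = ∑ i, N.A i ((σ t).X i - u i) - N.L (σ t).ζ
      - ((σ t).v - (σ t).ζ) := by
    rw [hsub, map_sub, ← hk, hu.balance]
    simp only [map_sub, Finset.sum_sub_distrib]
    abel
  have e2 : inner ℝ ((σ t).v - (σ t).ζ) (∑ i, N.A i ((σ t).x i - (σ t).X i))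
      = ∑ i, inner ℝ ((σ t).x i - (σ t).X i) (N.B i ((σ t).v - (σ t).ζ)) := by
    rw [inner_sum]
    exact Finset.sum_congr rfl fun i _ => by rw [← N.adjoint, real_inner_comm]
  have e3 : inner ℝ ((σ t).ζ - vs) (∑ i, N.A i ((σ t).X i - u i))
      = ∑ i, inner ℝ ((σ t).X i - u i) (N.B i (σ t).ζ - N.B i vs) := by
    rw [inner_sum]
    exact Finset.sum_congr rfl fun i _ => by rw [← map_sub, ← N.adjoint, real_inner_comm]
  have e4 : inner ℝ ((σ t).ζ - vs) (N.L (k - (σ t).ζ)) = inner ℝ (σ t).ζ (N.L (k - (σ t).ζ)) := by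
    rw [inner_sub_left, ← N.symm vs, hu.consensus, inner_zero_left, sub_zero]
  have e5 : inner ℝ ((σ t).ζ - vs) (N.L (σ t).ζ) = inner ℝ (σ t).ζ (N.L (σ t).ζ) := by
    rw [inner_sub_left, ← N.symm vs, hu.consensus, inner_zero_left, sub_zero]
  have e6 : inner ℝ (k - (σ t).ζ) (N.L (σ t).ζ) = inner ℝ (σ t).ζ (N.L (k - (σ t).ζ)) := by
    rw [← N.symm, real_inner_comm]
  have e7 : inner ℝ (N.L (σ t).ζ) ((σ t).v - (σ t).ζ)
      = inner ℝ ((σ t).v - (σ t).ζ) (N.L (σ t).ζ) := real_inner_comm _ _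
  rw [e1, inner_generalized_inverse hQ, inner_generalized_inverse hQ, e6, ← e4]
  -- Paired with `ζ - vs`, the network equation yields the supply terms of the agents with opposite
  -- sign, by adjointness, and the summed supplies cancel.
  have e8 := congrArg (inner ℝ ((σ t).ζ - vs)) hYq
  rw [inner_sub_right, inner_sub_right, e3, e5] at e8
  rw [hAx, inner_sub_right, inner_sub_right, e2, e7]
  unfold dissipation
  linarith

end PrimalDual

/-! ### Construction of the filters, a priori bounds, global existence -/

namespace PrimalDual

variable {ι : Type*} {E : Type*} {H : ι → Type*}
    [NormedAddCommGroup E] [InnerProductSpace ℝ E]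
    [∀ i, NormedAddCommGroup (H i)] [∀ i, InnerProductSpace ℝ (H i)] (N : PrimalDual ι E H)

lemma continuous_f (i : ι) : Continuous (N.f i) :=
  continuous_iff_continuousAt.2 fun x => (N.hasGradient i x).continuousAt

lemma continuous_g (i : ι) : Continuous (N.g i) := (N.locallyLipschitz i).continuous

lemma M_surjective [∀ i, FiniteDimensional ℝ (H i)] (i : ι) : Function.Surjective (N.M i) := by
  refine (LinearMap.injective_iff_surjective (f := (N.M i : H i →ₗ[ℝ] H i))).1
    ((injective_iff_map_eq_zero _).2 fun u hu => ?_)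
  have h := N.le_inner_M i u
  have hu' : N.M i u = 0 := hu
  rw [hu', inner_zero_left] at h
  have : ‖u‖ ^ 2 ≤ 0 := nonpos_of_mul_nonpos_right h (N.e_pos i)
  exact norm_eq_zero.1 (pow_eq_zero_iff two_ne_zero |>.1 (le_antisymm this (sq_nonneg _)))

variable {N} in
lemma gap_eq (u : ∀ i, H i) (σ : FilteredState ι E H) (i : ι) :
    N.gap u σ i = bregman (N.f i) (N.g i) (u i) (σ.X i)
      + (N.f i (u i) - N.a i * inner ℝ (σ.Γ i) (u i) + N.a i * σ.Ψ i) := by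
  have ha := (N.a_pos i).ne'
  unfold gap
  rw [mul_sub, mul_add, mul_inv_cancel_left₀ ha]
  ring

variable {N} in
lemma gap_nonneg {u : ∀ i, H i} {σ : FilteredState ι E H}
    (hyoung : ∀ i y, 0 ≤ N.f i y - N.a i * inner ℝ (σ.Γ i) y + N.a i * σ.Ψ i) (i : ι) :
    0 ≤ N.gap u σ i := by
  have h1 := bregman_nonneg (N.convex i) (u i) (σ.X i)
  have h2 := hyoung i (u i)
  have ha := (N.a_pos i).ne'
  unfold gap
  rw [mul_sub, mul_add, mul_inv_cancel_left₀ ha]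
  linarith

variable [Fintype ι]

/-- Every trajectory of the flow extends to a filtered trajectory whose initial state depends
only on that of the flow. -/
theorem exists_isFiltered [CompleteSpace E] [∀ i, FiniteDimensional ℝ (H i)]
    (z₀ : E × E × (∀ i, H i)) :
    ∃ σ₀ : FilteredState ι E H, σ₀.y = z₀.2.1 ∧
      ∀ z : ℝ → E × E × (∀ i, H i), ContinuousOn z (Set.Ici 0) → z 0 = z₀ →
      ∃ σ : ℝ → FilteredState ι E H, σ 0 = σ₀ ∧ (∀ t, ((σ t).v, (σ t).y, (σ t).x) = z t) ∧
        ∀ T, (∀ t ∈ Set.Ico 0 T, HasDerivWithinAt z (N.field (z t)) (Set.Ici 0) t) →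
          N.IsFiltered T σ := by
  have : ∀ i, CompleteSpace (H i) := fun i => FiniteDimensional.complete ℝ (H i)
  obtain ⟨v₀, y₀, x₀⟩ := z₀
  -- The price identity at time 0 is solved for `ξ`, which is possible as `M` is onto; the other
  -- filters start at `X = x₀`, `a Γ = g x₀` and `a Ψ = ⟨g x₀, x₀⟩ - f x₀`.
  have hM : ∀ i, ∃ ξ : H i, N.B i (v₀ - (∑ i, N.A i (x₀ i) - N.c - y₀))
      = -(N.a i • ((N.a i)⁻¹ • N.g i (x₀ i)) + N.e i • (x₀ i - x₀ i)
        + (N.ρ i * N.e i) • N.M i (x₀ i - N.a i • ξ)) := fun i => by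
    have ha := (N.a_pos i).ne'
    have hr := (mul_pos (N.ρ_pos i) (N.e_pos i)).ne'
    obtain ⟨π, hπ⟩ := N.M_surjective i ((N.ρ i * N.e i)⁻¹ •
      (-N.B i (v₀ - (∑ i, N.A i (x₀ i) - N.c - y₀)) - N.g i (x₀ i)))
    refine ⟨(N.a i)⁻¹ • (x₀ i - π), ?_⟩
    rw [smul_inv_smul₀ ha, smul_inv_smul₀ ha, sub_sub_cancel, hπ, smul_inv_smul₀ hr]
    simp
  choose ξ₀ hξ₀ using hM
  refine ⟨⟨v₀, y₀, x₀, v₀ - (∑ i, N.A i (x₀ i) - N.c - y₀), x₀, ξ₀,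
    fun i => (N.a i)⁻¹ • N.g i (x₀ i),
    fun i => (N.a i)⁻¹ * (inner ℝ (N.g i (x₀ i)) (x₀ i) - N.f i (x₀ i))⟩, rfl, fun z hz hz0 => ?_⟩
  have hv : ContinuousOn (fun t => (z t).1) (Set.Ici 0) := hz.fst
  have hy : ContinuousOn (fun t => (z t).2.1) (Set.Ici 0) := hz.snd.fst
  have hx : ∀ i, ContinuousOn (fun t => (z t).2.2 i) (Set.Ici 0) := continuousOn_pi.1 hz.snd.snd
  have hg : ∀ i, ContinuousOn (fun t => N.g i ((z t).2.2 i)) (Set.Ici 0) := fun i =>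
    (N.continuous_g i).comp_continuousOn (hx i)
  have hf : ∀ i, ContinuousOn (fun t => N.f i ((z t).2.2 i)) (Set.Ici 0) := fun i =>
    (N.continuous_f i).comp_continuousOn (hx i)
  obtain ⟨ζ, hζ0, hζ⟩ := exists_filter 1 (v₀ - (∑ i, N.A i (x₀ i) - N.c - y₀)) hv
  choose X hX0 hX using fun i => exists_filter 1 (x₀ i) (hx i)
  choose ξ hξ0 hξ using fun i => exists_filter (N.a i) (ξ₀ i) (g := X i)
    (fun t ht => (hX i t ht).continuousWithinAt)
  choose Γ hΓ0 hΓ using fun i => exists_filter (N.a i) ((N.a i)⁻¹ • N.g i (x₀ i)) (hg i)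
  choose Ψ hΨ0 hΨ using fun i => exists_filter (N.a i)
    ((N.a i)⁻¹ * (inner ℝ (N.g i (x₀ i)) (x₀ i) - N.f i (x₀ i))) (((hg i).inner (𝕜 := ℝ) (hx i)).sub (hf i))
  have h0 : (⟨(z 0).1, (z 0).2.1, (z 0).2.2, ζ 0, fun i => X i 0, fun i => ξ i 0,
      fun i => Γ i 0, fun i => Ψ i 0⟩ : FilteredState ι E H) = ⟨v₀, y₀, x₀,
      v₀ - (∑ i, N.A i (x₀ i) - N.c - y₀), x₀, ξ₀, fun i => (N.a i)⁻¹ • N.g i (x₀ i),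
      fun i => (N.a i)⁻¹ * (inner ℝ (N.g i (x₀ i)) (x₀ i) - N.f i (x₀ i))⟩ := by
    simp only [hz0, hζ0, hX0, hξ0, hΓ0, hΨ0]
  let σ : ℝ → FilteredState ι E H := fun t => ⟨(z t).1, (z t).2.1, (z t).2.2, ζ t, fun i => X i t,
    fun i => ξ i t, fun i => Γ i t, fun i => Ψ i t⟩
  have h0' : σ 0 = _ := h0
  refine ⟨σ, h0, fun t => rfl, fun T hT => ⟨hv, hy, hx, hT, ?_, ?_, hξ, hΓ, hΨ, ?_, ?_, ?_⟩⟩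
  · exact fun t ht => (hζ t ht).congr_deriv (by rw [one_smul])
  · exact fun i t ht => (hX i t ht).congr_deriv (by rw [one_smul])
  · rw [h0', sub_sub_cancel]
  · intro i
    rw [h0']
    exact hξ₀ i
  · intro i y
    rw [h0']
    have := N.convex i (x₀ i) y
    have ha := (N.a_pos i).ne'
    simp only [real_inner_smul_left, inner_sub_right, mul_inv_cancel_left₀ ha] at this ⊢
    linarith

variable {N} {T : ℝ} {σ : ℝ → FilteredState ι E H}

/-- Since `y' = L v`, the increment of `y` is `L` of the integral of `v`; a filter of rate 0
produces that integral. -/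
lemma IsFiltered.exists_sub_eq [CompleteSpace E] (h : N.IsFiltered T σ) {ys : E}
    (h0 : ∃ k, (σ 0).y - ys = N.L k) {t : ℝ} (ht : t ∈ Set.Icc 0 T) :
    ∃ k, (σ t).y - ys = N.L k := by
  obtain ⟨k, hk⟩ := h0
  obtain ⟨w, hw0, hw⟩ := exists_filter 0 k h.continuousOn_v
  refine ⟨w t, sub_eq_zero.1 ?_⟩
  have hLw : ∀ t, 0 ≤ t → HasDerivWithinAt (fun t => N.L (w t)) (N.L ((σ t).v)) (Set.Ici 0) t :=
    fun t ht => (N.L.hasFDerivAt.comp_hasDerivWithinAt t (hw t ht)).congr_deriv (by simp)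
  refine eqOn_zero_of_linear_decay (c := 0) (T := T) (r := fun t => (σ t).y - ys - N.L (w t))
    ((h.continuousOn_y.sub continuousOn_const).sub fun t ht => (hLw t ht).continuousWithinAt)
    (fun t ht => (((h.deriv_y ht).sub_const ys).sub (hLw t ht.1)).congr_deriv (by simp))
    (by simp only [hw0, hk, sub_self]) t ht

lemma dissipation_nonneg {u : ∀ i, H i} {σ : FilteredState ι E H}
    (hyoung : ∀ i y, 0 ≤ N.f i y - N.a i * inner ℝ (σ.Γ i) y + N.a i * σ.Ψ i) :
    0 ≤ N.dissipation u σ := by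
  have h1 := N.psd (σ.v - σ.ζ)
  have h2 := N.psd σ.ζ
  refine add_nonneg (by linarith) (Finset.sum_nonneg fun i _ => ?_)
  have := gap_nonneg (u := u) hyoung i
  have := N.ρ_pos i
  positivity

lemma continuous_storage (Q : E →L[ℝ] E) (u : ∀ i, H i) (vs ys : E) :
    Continuous fun s : E × E × (∀ i, H i) × E × (∀ i, H i) × (∀ i, H i) × (∀ i, H i) × (ι → ℝ) =>
      N.storage Q u vs ys ⟨s.1, s.2.1, s.2.2.1, s.2.2.2.1, s.2.2.2.2.1, s.2.2.2.2.2.1,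
        s.2.2.2.2.2.2.1, s.2.2.2.2.2.2.2⟩ := by
  have hf := N.continuous_f
  have hfX : ∀ i, Continuous fun s : E × E × (∀ i, H i) × E × (∀ i, H i) × (∀ i, H i) ×
      (∀ i, H i) × (ι → ℝ) => N.f i (s.2.2.2.2.1 i) := fun i => (hf i).comp (by fun_prop)
  unfold storage agentStorage costStorage bregman
  dsimp only
  fun_prop

lemma tendsto_storage {α : Type*} {l : Filter α} {σ : α → FilteredState ι E H}
    {σ' : FilteredState ι E H} (hv : Tendsto (fun t => (σ t).v) l (𝓝 σ'.v))
    (hy : Tendsto (fun t => (σ t).y) l (𝓝 σ'.y))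
    (hx : ∀ i, Tendsto (fun t => (σ t).x i) l (𝓝 (σ'.x i)))
    (hζ : Tendsto (fun t => (σ t).ζ) l (𝓝 σ'.ζ))
    (hX : ∀ i, Tendsto (fun t => (σ t).X i) l (𝓝 (σ'.X i)))
    (hξ : ∀ i, Tendsto (fun t => (σ t).ξ i) l (𝓝 (σ'.ξ i)))
    (hΓ : ∀ i, Tendsto (fun t => (σ t).Γ i) l (𝓝 (σ'.Γ i)))
    (hΨ : ∀ i, Tendsto (fun t => (σ t).Ψ i) l (𝓝 (σ'.Ψ i)))
    (Q : E →L[ℝ] E) (u : ∀ i, H i) (vs ys : E) :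
    Tendsto (fun t => N.storage Q u vs ys (σ t)) l (𝓝 (N.storage Q u vs ys σ')) := by
  have h : Tendsto (fun t => ((σ t).v, (σ t).y, (σ t).x, (σ t).ζ, (σ t).X, (σ t).ξ, (σ t).Γ,
      (σ t).Ψ)) l (𝓝 (σ'.v, σ'.y, σ'.x, σ'.ζ, σ'.X, σ'.ξ, σ'.Γ, σ'.Ψ)) :=
    hv.prodMk_nhds (hy.prodMk_nhds ((tendsto_pi_nhds.2 hx).prodMk_nhds (hζ.prodMk_nhds
      ((tendsto_pi_nhds.2 hX).prodMk_nhds ((tendsto_pi_nhds.2 hξ).prodMk_nhds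
        ((tendsto_pi_nhds.2 hΓ).prodMk_nhds (tendsto_pi_nhds.2 hΨ)))))))
  have hc := (continuous_storage (N := N) Q u vs ys).tendsto
    (σ'.v, σ'.y, σ'.x, σ'.ζ, σ'.X, σ'.ξ, σ'.Γ, σ'.Ψ)
  have := hc.comp h
  simp only [Function.comp_def] at this
  exact this

lemma IsFiltered.continuousOn_storage (h : N.IsFiltered T σ) (Q : E →L[ℝ] E) (u : ∀ i, H i)
    (vs ys : E) : ContinuousOn (fun t => N.storage Q u vs ys (σ t)) (Set.Ici 0) := fun t ht =>
  tendsto_storage (h.continuousOn_v t ht) (h.continuousOn_y t ht)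
    (fun i => h.continuousOn_x i t ht) (h.deriv_ζ t ht).continuousWithinAt
    (fun i => (h.deriv_X i t ht).continuousWithinAt)
    (fun i => (h.deriv_ξ i t ht).continuousWithinAt)
    (fun i => (h.deriv_Γ i t ht).continuousWithinAt)
    (fun i => (h.deriv_Ψ i t ht).continuousWithinAt) Q u vs ys

theorem storage_antitoneOn [CompleteSpace E] (h : N.IsFiltered T σ) {Q : E →L[ℝ] E}
    (hQ : ∀ w, N.L (Q (N.L w)) = N.L w) {u : ∀ i, H i} {vs ys : E} (hu : N.IsEquilibrium u vs ys)
    (hy : ∃ k, (σ 0).y - ys = N.L k) :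
    AntitoneOn (fun t => N.storage Q u vs ys (σ t)) (Set.Icc 0 T) := by
  choose! V' hV hV' using fun t (ht : t ∈ Set.Ico 0 T) =>
    storage_hasDerivWithinAt h hQ hu ht (h.exists_sub_eq hy ⟨ht.1, ht.2.le⟩)
  exact antitoneOn_of_hasDerivWithinAt_Ici (h.continuousOn_storage Q u vs ys) hV fun t ht =>
    (hV' t ht).trans (neg_nonpos.2 (dissipation_nonneg fun i y => h.young i y ht.1))

/-- The storage controls `v - ζ`, `ζ - vs`, `x - X` and `X - u`; the integral state `y` is recovered
from the identity of `sub_ζ`. -/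
lemma exists_norm_le_of_storage_le (N : PrimalDual ι E H) {Q : E →L[ℝ] E}
    (hQ : ∀ w, N.L (Q (N.L w)) = N.L w) (u : ∀ i, H i) (vs ys : E) (C : ℝ) :
    ∃ R, ∀ σ : FilteredState ι E H,
      (∀ i y, 0 ≤ N.f i y - N.a i * inner ℝ (σ.Γ i) y + N.a i * σ.Ψ i) →
      (∃ h, σ.y - ys = N.L h) → σ.v - σ.ζ = ∑ i, N.A i (σ.X i) - N.c - σ.y →
      N.storage Q u vs ys σ ≤ C →
      ‖σ.v‖ ≤ R ∧ ‖σ.y‖ ≤ R ∧ ‖σ.ζ‖ ≤ R ∧ ∀ i, ‖σ.x i‖ ≤ R ∧ ‖σ.X i‖ ≤ R := by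
  have hS : 0 ≤ ∑ i, 8 * |C| / N.e i := Finset.sum_nonneg fun i _ => by
    have := N.e_pos i
    positivity
  -- The summand 1 ensures `1 ≤ K`, so that `r ^ 2 ≤ K` implies `r ≤ K`.
  set K := 1 + 8 * |C| + ∑ i, 8 * |C| / N.e i with hK
  have hC := abs_nonneg C
  have hK1 : 1 ≤ K := by linarith
  have hsq : ∀ r, r ^ 2 ≤ K → r ≤ K := fun r hr => by nlinarith
  have hU : 0 ≤ ∑ i, ‖u i‖ := Finset.sum_nonneg fun _ _ => norm_nonneg _
  have hA : 0 ≤ ∑ i, ‖N.A i‖ * (‖u i‖ + K) := Finset.sum_nonneg fun i _ => by positivity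
  refine ⟨2 * K + ‖vs‖ + ∑ i, ‖u i‖ + ∑ i, ‖N.A i‖ * (‖u i‖ + K) + ‖N.c‖,
    fun σ hyoung hy hσ hle => ?_⟩
  have h := (storage_ge hQ (u := u) (vs := vs) hyoung hy).trans (hle.trans (le_abs_self C))
  have hp : ∀ i, 0 ≤ N.e i / 8 * (‖σ.x i - σ.X i‖ ^ 2 + ‖σ.X i - u i‖ ^ 2) := fun i => by
    have := N.e_pos i
    positivity
  have hp' := Finset.sum_nonneg fun i (_ : i ∈ Finset.univ) => hp i
  have h1 : ‖σ.v - σ.ζ‖ ≤ K := hsq _ (by nlinarith [sq_nonneg ‖σ.ζ - vs‖])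
  have h2 : ‖σ.ζ - vs‖ ≤ K := hsq _ (by nlinarith [sq_nonneg ‖σ.v - σ.ζ‖])
  have h3 : ∀ i, ‖σ.x i - σ.X i‖ ^ 2 + ‖σ.X i - u i‖ ^ 2 ≤ K := fun i => by
    have h4 := Finset.single_le_sum (fun i _ => hp i) (Finset.mem_univ i)
    have h5 : 8 * |C| / N.e i ≤ ∑ i, 8 * |C| / N.e i :=
      Finset.single_le_sum (f := fun i => 8 * |C| / N.e i) (fun i _ => by
        have := N.e_pos i
        positivity) (Finset.mem_univ i)
    have h6 : ‖σ.x i - σ.X i‖ ^ 2 + ‖σ.X i - u i‖ ^ 2 ≤ 8 * |C| / N.e i := by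
      rw [le_div_iff₀ (N.e_pos i)]
      nlinarith [sq_nonneg ‖σ.v - σ.ζ‖, sq_nonneg ‖σ.ζ - vs‖]
    linarith
  have h4 : ∀ i, ‖σ.x i - σ.X i‖ ≤ K := fun i => hsq _ (by nlinarith [h3 i, sq_nonneg ‖σ.X i - u i‖])
  have h5 : ∀ i, ‖σ.X i - u i‖ ≤ K := fun i => hsq _ (by nlinarith [h3 i, sq_nonneg ‖σ.x i - σ.X i‖])
  have hX : ∀ i, ‖σ.X i‖ ≤ ‖u i‖ + K := fun i => by
    linarith [norm_sub_norm_le (σ.X i) (u i), h5 i]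
  have hx : ∀ i, ‖σ.x i‖ ≤ ‖u i‖ + 2 * K := fun i => by
    linarith [norm_sub_norm_le (σ.x i) (σ.X i), h4 i, hX i]
  have hu : ∀ i, ‖u i‖ ≤ ∑ i, ‖u i‖ := fun i =>
    Finset.single_le_sum (f := fun i => ‖u i‖) (fun _ _ => norm_nonneg _) (Finset.mem_univ i)
  have hζ : ‖σ.ζ‖ ≤ ‖vs‖ + K := by linarith [norm_sub_norm_le σ.ζ vs]
  have hc := norm_nonneg N.c
  have hvs := norm_nonneg vs
  refine ⟨by linarith [norm_sub_norm_le σ.v σ.ζ], ?_, by linarith, fun i =>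
    ⟨by linarith [hx i, hu i], by linarith [hX i, hu i]⟩⟩
  have hy' : σ.y = ∑ i, N.A i (σ.X i) - N.c - (σ.v - σ.ζ) := by rw [hσ]; abel
  have hAX : ‖∑ i, N.A i (σ.X i)‖ ≤ ∑ i, ‖N.A i‖ * (‖u i‖ + K) :=
    norm_sum_le_of_le _ fun i _ => (N.A i).le_opNorm_of_le (hX i)
  rw [hy']
  linarith [norm_sub_le (∑ i, N.A i (σ.X i) - N.c) (σ.v - σ.ζ),
    norm_sub_le (∑ i, N.A i (σ.X i)) N.c]

lemma locallyLipschitz_pi {α : Type*} [PseudoEMetricSpace α] {π : ι → Type*}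
    [∀ i, PseudoEMetricSpace (π i)] {F : α → ∀ i, π i}
    (hF : ∀ i, LocallyLipschitz fun z => F z i) : LocallyLipschitz F := by
  intro z
  choose K t ht hK using fun i => hF i z
  refine ⟨∑ i, K i, ⋂ i, t i, Filter.iInter_mem.2 ht, fun a ha b hb => ?_⟩
  refine edist_pi_le_iff.2 fun i => (hK i (Set.mem_iInter.1 ha i) (Set.mem_iInter.1 hb i)).trans ?_
  gcongr
  exact Finset.single_le_sum (f := K) (fun _ _ => zero_le) (Finset.mem_univ i)

/-- The gradient terms are locally Lipschitz, and what remains is affine, hence smooth. -/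
lemma locallyLipschitz_field (N : PrimalDual ι E H) : LocallyLipschitz N.field := by
  have hg : ∀ i, LocallyLipschitz fun z : E × E × (∀ i, H i) => N.g i (z.2.2 i) := fun i =>
    (N.locallyLipschitz i).comp
      ((ContinuousLinearMap.proj (R := ℝ) (φ := H) i).comp
        ((ContinuousLinearMap.snd ℝ E (∀ i, H i)).comp
          (ContinuousLinearMap.snd ℝ E (E × ∀ i, H i)))).lipschitz.locallyLipschitz
  have h1 : LocallyLipschitz fun z : E × E × (∀ i, H i) =>
      ((0 : E), (0 : E), fun i => -((1 + N.ρ i) • N.g i (z.2.2 i))) :=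
    (LocallyLipschitz.const _).prodMk ((LocallyLipschitz.const _).prodMk
      (locallyLipschitz_pi fun i =>
        (-((1 + N.ρ i) • ContinuousLinearMap.id ℝ (H i))).lipschitz.locallyLipschitz.comp (hg i)))
  have h2 : ContDiff ℝ 1 fun z : E × E × (∀ i, H i) =>
      (∑ i, N.A i (z.2.2 i) - N.c - N.L z.1 - z.2.1, N.L z.1,
        fun i => - N.ρ i • N.B i (N.A i (z.2.2 i) - N.c - z.2.1) - (1 + N.ρ i) • N.B i z.1) := by
    have hx : ∀ i, ContDiff ℝ 1 fun z : E × E × (∀ i, H i) => z.2.2 i := fun i =>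
      ((ContinuousLinearMap.proj (R := ℝ) (φ := H) i).comp
        ((ContinuousLinearMap.snd ℝ E (∀ i, H i)).comp
          (ContinuousLinearMap.snd ℝ E (E × ∀ i, H i)))).contDiff
    have hA : ∀ i, ContDiff ℝ 1 fun z : E × E × (∀ i, H i) => N.A i (z.2.2 i) := fun i =>
      (N.A i).contDiff.comp (hx i)
    have hL : ContDiff ℝ 1 fun z : E × E × (∀ i, H i) => N.L z.1 := N.L.contDiff.comp contDiff_fst
    have hB : ∀ i, ContDiff ℝ 1 fun z : E × E × (∀ i, H i) => N.B i z.1 := fun i =>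
      (N.B i).contDiff.comp contDiff_fst
    refine ((((ContDiff.sum fun i _ => hA i).sub contDiff_const).sub hL).sub
      contDiff_snd.fst).prodMk (hL.prodMk (contDiff_pi.2 fun i => ?_))
    exact (contDiff_const.smul ((N.B i).contDiff.comp
      (((hA i).sub contDiff_const).sub contDiff_snd.fst))).sub (contDiff_const.smul (hB i))
  refine (congrArg LocallyLipschitz (funext fun z => ?_)).mpr (h1.add h2.locallyLipschitz)
  refine Prod.ext (zero_add _).symm (Prod.ext (zero_add _).symm (funext fun i => ?_))
  simp only [field, Prod.snd_add, Pi.add_apply, neg_smul]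
  abel

/-- The flow has a global solution for all initial values in the range of the equilibrium. -/
theorem exists_solution [FiniteDimensional ℝ E] [∀ i, FiniteDimensional ℝ (H i)]
    (N : PrimalDual ι E H) {u : ∀ i, H i} {vs ys : E} (hu : N.IsEquilibrium u vs ys)
    (z₀ : E × E × (∀ i, H i)) (hy : ∃ k, z₀.2.1 - ys = N.L k) :
    ∃ z : ℝ → E × E × (∀ i, H i), z 0 = z₀ ∧
      ∀ t, 0 ≤ t → HasDerivWithinAt z (N.field (z t)) (Set.Ici 0) t := by
  have : CompleteSpace E := FiniteDimensional.complete ℝ E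
  have : ProperSpace (E × E × (∀ i, H i)) := FiniteDimensional.proper ℝ _
  obtain ⟨Q, hQ⟩ := exists_generalized_inverse N.L
  obtain ⟨σ₀, hσ₀, hσ⟩ := N.exists_isFiltered z₀
  obtain ⟨R, hR⟩ := N.exists_norm_le_of_storage_le hQ u vs ys (N.storage Q u vs ys σ₀)
  -- The initial filter state, hence the initial storage level, depends only on `z₀`, so the bound
  -- `R` does not depend on the time interval.
  refine exists_solution_of_apriori_bound N.locallyLipschitz_field z₀ R fun T hT z hz hz0 hflow => ?_
  obtain ⟨σ, h0, hσz, hfil⟩ := hσ z hz hz0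
  have h := hfil T hflow
  have hy0 : ∃ k, (σ 0).y - ys = N.L k := by rwa [h0, hσ₀]
  have hT' : T ∈ Set.Icc 0 T := ⟨hT, le_rfl⟩
  obtain ⟨hv, hyb, -, hx⟩ := hR (σ T) (fun i y => h.young i y hT) (h.exists_sub_eq hy0 hT')
    (h.sub_ζ hT') (by
      have := storage_antitoneOn h hQ hu hy0 ⟨le_rfl, hT⟩ hT' hT
      simpa only [h0] using this)
  rw [← hσz]
  exact norm_prod_le_iff.2 ⟨hv, norm_prod_le_iff.2 ⟨hyb,
    (pi_norm_le_iff_of_nonneg ((norm_nonneg _).trans hv)).2 fun i => (hx i).1⟩⟩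

end PrimalDual

/-! ### Calculus of bounded signals and of signals with bounded derivative -/

section Bounded

variable {Z W : Type*} [NormedAddCommGroup Z] [NormedAddCommGroup W]

/-- The signal `z` is bounded on `[0, ∞)`. -/
def BoundedSignal (z : ℝ → Z) : Prop := ∃ K : ℝ, ∀ t, 0 ≤ t → ‖z t‖ ≤ K

namespace BoundedSignal

variable {z z' : ℝ → Z}

lemma const (c : Z) : BoundedSignal fun _ : ℝ => c := ⟨‖c‖, fun _ _ => le_rfl⟩

lemma add (h : BoundedSignal z) (h' : BoundedSignal z') : BoundedSignal fun t => z t + z' t := by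
  obtain ⟨K, hK⟩ := h
  obtain ⟨K', hK'⟩ := h'
  exact ⟨K + K', fun t ht => norm_add_le_of_le (hK t ht) (hK' t ht)⟩

lemma sub (h : BoundedSignal z) (h' : BoundedSignal z') : BoundedSignal fun t => z t - z' t := by
  obtain ⟨K, hK⟩ := h
  obtain ⟨K', hK'⟩ := h'
  exact ⟨K + K', fun t ht => norm_sub_le_of_le (hK t ht) (hK' t ht)⟩

lemma sum {ι : Type*} (s : Finset ι) {z : ι → ℝ → Z} (h : ∀ i ∈ s, BoundedSignal (z i)) :
    BoundedSignal fun t => ∑ i ∈ s, z i t := by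
  choose! K hK using h
  exact ⟨∑ i ∈ s, K i, fun t ht => norm_sum_le_of_le s fun i hi => hK i hi t ht⟩

lemma smul [NormedSpace ℝ Z] (c : ℝ) (h : BoundedSignal z) : BoundedSignal fun t => c • z t := by
  obtain ⟨K, hK⟩ := h
  exact ⟨‖c‖ * K, fun t ht => by
    rw [norm_smul]
    exact mul_le_mul_of_nonneg_left (hK t ht) (norm_nonneg c)⟩

lemma clm [NormedSpace ℝ Z] [NormedSpace ℝ W] (A : Z →L[ℝ] W) (h : BoundedSignal z) :
    BoundedSignal fun t => A (z t) := by
  obtain ⟨K, hK⟩ := h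
  exact ⟨‖A‖ * K, fun t ht => A.le_opNorm_of_le (hK t ht)⟩

lemma inner [InnerProductSpace ℝ Z] (h : BoundedSignal z) (h' : BoundedSignal z') :
    BoundedSignal fun t => inner ℝ (z t) (z' t) := by
  obtain ⟨K, hK⟩ := h
  obtain ⟨K', hK'⟩ := h'
  exact ⟨K * K', fun t ht => (norm_inner_le_norm _ _).trans
    (mul_le_mul (hK t ht) (hK' t ht) (norm_nonneg _) ((norm_nonneg _).trans (hK t ht)))⟩

lemma comp_continuous [ProperSpace Z] {F : Z → W} (hF : Continuous F) (h : BoundedSignal z) :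
    BoundedSignal fun t => F (z t) := by
  obtain ⟨K, hK⟩ := h
  obtain ⟨C, hC⟩ := (isCompact_closedBall (0 : Z) K).exists_bound_of_continuousOn hF.continuousOn
  exact ⟨C, fun t ht => hC _ (by simpa using hK t ht)⟩

/-- A stable first-order filter has a bounded output if its input is bounded. -/
lemma of_filter [InnerProductSpace ℝ Z] {g : ℝ → Z} {c : ℝ} (hc : 0 < c) (hg : BoundedSignal g)
    (hz : ∀ t, 0 ≤ t → HasDerivWithinAt z (g t - c • z t) (Set.Ici 0) t) : BoundedSignal z := by
  obtain ⟨K, hK⟩ := hg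
  have hK0 : 0 ≤ K := (norm_nonneg _).trans (hK 0 le_rfl)
  have hd : ∀ t, 0 ≤ t → HasDerivWithinAt
      (fun t => ((K / c) ^ 2 + ‖z 0‖ ^ 2) - 2 * (1 / 2 * ‖z t‖ ^ 2))
      (-(2 * Inner.inner ℝ (z t) (g t - c • z t))) (Set.Ici 0) t := fun t ht =>
    ((hasDerivWithinAt_half_norm_sq (hz t ht)).const_mul 2).const_sub _
  refine ⟨K / c + ‖z 0‖, fun t ht => ?_⟩
  have := nonneg_of_hasDerivWithinAt_ge_neg_mul (c := c) (T := t)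
    (fun t ht => (hd t ht).continuousWithinAt) (fun t ht => hd t ht.1) (fun t ht => by
      have h1 := real_inner_le_norm (z t) (g t)
      have h2 := mul_le_mul_of_nonneg_left (hK t ht.1) (norm_nonneg (z t))
      -- Completing the square shows that `(K / c) ^ 2 + ‖z 0‖ ^ 2 - ‖z‖ ^ 2` stays nonnegative.
      have h3 : 0 ≤ c * (‖z t‖ - K / c) ^ 2 + c * ‖z 0‖ ^ 2 := by positivity
      have h4 : c * (‖z t‖ - K / c) ^ 2 = c * ‖z t‖ ^ 2 - 2 * (‖z t‖ * K) + c * (K / c) ^ 2 := by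
        field_simp
        ring
      rw [inner_sub_right, real_inner_smul_right, real_inner_self_eq_norm_sq]
      nlinarith) (by nlinarith [sq_nonneg (K / c)]) t ⟨ht, le_rfl⟩
  have h5 : 0 ≤ K / c := by positivity
  exact abs_le_of_sq_le_sq' (by nlinarith [norm_nonneg (z 0)]) (by positivity) |>.2

end BoundedSignal

/-- The signal `z` is bounded on `[0, ∞)` and has a bounded derivative. -/
def SlowSignal [NormedSpace ℝ Z] (z : ℝ → Z) : Prop :=
  BoundedSignal z ∧ ∃ z', BoundedSignal z' ∧ ∀ t, 0 ≤ t → HasDerivWithinAt z (z' t) (Set.Ici 0) t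

namespace SlowSignal

variable [NormedSpace ℝ Z] [NormedSpace ℝ W] {z z' : ℝ → Z}

lemma const (c : Z) : SlowSignal fun _ : ℝ => c :=
  ⟨.const c, fun _ => 0, .const 0, fun t _ => hasDerivWithinAt_const t _ c⟩

lemma add (h : SlowSignal z) (h' : SlowSignal z') : SlowSignal fun t => z t + z' t := by
  obtain ⟨hb, w, hw, hd⟩ := h
  obtain ⟨hb', w', hw', hd'⟩ := h'
  exact ⟨hb.add hb', _, hw.add hw', fun t ht => (hd t ht).add (hd' t ht)⟩

lemma sub (h : SlowSignal z) (h' : SlowSignal z') : SlowSignal fun t => z t - z' t := by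
  obtain ⟨hb, w, hw, hd⟩ := h
  obtain ⟨hb', w', hw', hd'⟩ := h'
  exact ⟨hb.sub hb', _, hw.sub hw', fun t ht => (hd t ht).sub (hd' t ht)⟩

lemma smul (c : ℝ) (h : SlowSignal z) : SlowSignal fun t => c • z t := by
  obtain ⟨hb, w, hw, hd⟩ := h
  exact ⟨hb.smul c, _, hw.smul c, fun t ht => (hd t ht).const_smul c⟩

lemma sum {ι : Type*} (s : Finset ι) {z : ι → ℝ → Z} (h : ∀ i ∈ s, SlowSignal (z i)) :
    SlowSignal fun t => ∑ i ∈ s, z i t := by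
  choose! hb w hw hd using h
  exact ⟨.sum s hb, _, .sum s hw, fun t ht => HasDerivWithinAt.fun_sum fun i hi => hd i hi t ht⟩

lemma clm (A : Z →L[ℝ] W) (h : SlowSignal z) : SlowSignal fun t => A (z t) := by
  obtain ⟨hb, w, hw, hd⟩ := h
  exact ⟨hb.clm A, _, hw.clm A, fun t ht => A.hasFDerivAt.comp_hasDerivWithinAt t (hd t ht)⟩

end SlowSignal

namespace SlowSignal

variable [InnerProductSpace ℝ Z] {z z' : ℝ → Z}

lemma inner (h : SlowSignal z) (h' : SlowSignal z') :
    SlowSignal fun t => inner ℝ (z t) (z' t) := by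
  obtain ⟨hb, w, hw, hd⟩ := h
  obtain ⟨hb', w', hw', hd'⟩ := h'
  exact ⟨hb.inner hb', _, (hb.inner hw').add (hw.inner hb'), fun t ht =>
    (hd t ht).inner ℝ (hd' t ht)⟩

lemma norm_sq (h : SlowSignal z) : SlowSignal fun t => ‖z t‖ ^ 2 := by
  simpa only [real_inner_self_eq_norm_sq] using h.inner h

lemma comp [ProperSpace Z] {f : Z → ℝ} {g : Z → Z} (hf : ∀ x, HasFDerivAt f (innerSL ℝ (g x)) x)
    (hg : Continuous g) (h : SlowSignal z) : SlowSignal fun t => f (z t) := by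
  obtain ⟨hb, w, hw, hd⟩ := h
  exact ⟨hb.comp_continuous (continuous_iff_continuousAt.2 fun x => (hf x).continuousAt), _,
    (hb.comp_continuous hg).inner hw, fun t ht => (hf (z t)).comp_hasDerivWithinAt t (hd t ht)⟩

end SlowSignal

lemma tendsto_zero_of_nonneg_of_mul_le {α : Type*} {l : Filter α} {a b : α → ℝ} {k : ℝ}
    (hk : 0 < k) (hb : Tendsto b l (𝓝 0)) (ha : ∀ᶠ t in l, 0 ≤ a t) (hab : ∀ᶠ t in l, k * a t ≤ b t) :
    Tendsto a l (𝓝 0) := by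
  refine squeeze_zero' (g := fun t => k⁻¹ * b t) ha ?_ (by simpa using hb.const_mul k⁻¹)
  filter_upwards [hab] with t ht
  rwa [le_inv_mul_iff₀ hk]

lemma tendsto_zero_of_sq_norm {α : Type*} {l : Filter α} {z : α → Z} {k : ℝ} {b : α → ℝ}
    (hk : 0 < k) (hb : Tendsto b l (𝓝 0)) (h : ∀ᶠ t in l, k * ‖z t‖ ^ 2 ≤ b t) :
    Tendsto z l (𝓝 0) := by
  have h1 := tendsto_zero_of_nonneg_of_mul_le hk hb (Eventually.of_forall fun t => sq_nonneg ‖z t‖) h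
  have h2 := h1.sqrt
  simp only [Real.sqrt_sq (norm_nonneg _), Real.sqrt_zero] at h2
  exact tendsto_zero_iff_norm_tendsto_zero.2 h2

end Bounded

lemma eq_zero_of_hasFDerivAt_of_le {H : Type*} [NormedAddCommGroup H] [InnerProductSpace ℝ H]
    {f : H → ℝ} {d x c : H} (hf : HasFDerivAt f (innerSL ℝ d) x)
    (h : ∀ y, f x - inner ℝ c x ≤ f y - inner ℝ c y) : d = c := by
  have h1 : HasFDerivAt (fun y => f y - inner ℝ c y) (innerSL ℝ d - innerSL ℝ c) x :=
    hf.sub (innerSL ℝ c).hasFDerivAt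
  have h2 : IsLocalMin (fun y => f y - inner ℝ c y) x := Eventually.of_forall h
  have h3 := h2.hasFDerivAt_eq_zero h1
  rw [← map_sub] at h3
  have h4 : innerSL ℝ (d - c) (d - c) = 0 := by rw [h3]; rfl
  exact sub_eq_zero.1 (inner_self_eq_zero.1 h4)

/-! ### Boundedness of trajectories and decay of the dissipation rate -/

namespace PrimalDual

variable {ι : Type*} {E : Type*} {H : ι → Type*} [Fintype ι]
    [NormedAddCommGroup E] [InnerProductSpace ℝ E]
    [∀ i, NormedAddCommGroup (H i)] [∀ i, InnerProductSpace ℝ (H i)] {N : PrimalDual ι E H}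

/-- All components of a filtered trajectory are bounded. -/
structure IsBounded (σ : ℝ → FilteredState ι E H) : Prop where
  v : BoundedSignal fun t => (σ t).v
  y : BoundedSignal fun t => (σ t).y
  x : ∀ i, BoundedSignal fun t => (σ t).x i
  ζ : BoundedSignal fun t => (σ t).ζ
  X : ∀ i, BoundedSignal fun t => (σ t).X i
  ξ : ∀ i, BoundedSignal fun t => (σ t).ξ i
  Γ : ∀ i, BoundedSignal fun t => (σ t).Γ i
  Ψ : ∀ i, BoundedSignal fun t => (σ t).Ψ i

variable {σ : ℝ → FilteredState ι E H}

lemma isBounded_of_isFiltered [CompleteSpace E] [∀ i, FiniteDimensional ℝ (H i)]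
    (h : ∀ T, N.IsFiltered T σ)
    {Q : E →L[ℝ] E} (hQ : ∀ w, N.L (Q (N.L w)) = N.L w) {u : ∀ i, H i} {vs ys : E}
    (hu : N.IsEquilibrium u vs ys) (hy : ∃ k, (σ 0).y - ys = N.L k) : IsBounded σ := by
  have : ∀ i, ProperSpace (H i) := fun i => FiniteDimensional.proper ℝ _
  obtain ⟨R, hR⟩ := N.exists_norm_le_of_storage_le hQ u vs ys (N.storage Q u vs ys (σ 0))
  have hR' := fun t (ht : 0 ≤ t) => hR (σ t) (fun i y => (h t).young i y ht)
    ((h t).exists_sub_eq hy ⟨ht, le_rfl⟩) ((h t).sub_ζ ⟨ht, le_rfl⟩)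
    (storage_antitoneOn (h t) hQ hu hy ⟨le_rfl, ht⟩ ⟨ht, le_rfl⟩ ht)
  have hx : ∀ i, BoundedSignal fun t => (σ t).x i := fun i => ⟨R, fun t ht => ((hR' t ht).2.2.2 i).1⟩
  have hX : ∀ i, BoundedSignal fun t => (σ t).X i := fun i => ⟨R, fun t ht => ((hR' t ht).2.2.2 i).2⟩
  have hg : ∀ i, BoundedSignal fun t => N.g i ((σ t).x i) := fun i =>
    (hx i).comp_continuous (N.continuous_g i)
  have hf : ∀ i, BoundedSignal fun t => N.f i ((σ t).x i) := fun i =>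
    (hx i).comp_continuous (N.continuous_f i)
  exact ⟨⟨R, fun t ht => (hR' t ht).1⟩, ⟨R, fun t ht => (hR' t ht).2.1⟩, hx,
    ⟨R, fun t ht => (hR' t ht).2.2.1⟩, hX, fun i => .of_filter (N.a_pos i) (hX i) ((h 0).deriv_ξ i),
    fun i => .of_filter (N.a_pos i) (hg i) ((h 0).deriv_Γ i),
    fun i => .of_filter (N.a_pos i) (((hg i).inner (hx i)).sub (hf i)) ((h 0).deriv_Ψ i)⟩

/-- The dissipation rate has a bounded derivative along bounded trajectories. -/
lemma slowSignal_dissipation [∀ i, FiniteDimensional ℝ (H i)]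
    (h : ∀ T, N.IsFiltered T σ) (hb : IsBounded σ) (u : ∀ i, H i) :
    SlowSignal fun t => N.dissipation u (σ t) := by
  have : ∀ i, ProperSpace (H i) := fun i => FiniteDimensional.proper ℝ _
  have hI : ∀ t : ℝ, 0 ≤ t → t ∈ Set.Ico 0 (t + 1) := fun t ht => ⟨ht, by linarith⟩
  have hg : ∀ i, BoundedSignal fun t => N.g i ((σ t).x i) := fun i =>
    (hb.x i).comp_continuous (N.continuous_g i)
  have hf : ∀ i, BoundedSignal fun t => N.f i ((σ t).x i) := fun i =>
    (hb.x i).comp_continuous (N.continuous_f i)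
  have sv : SlowSignal fun t => (σ t).v := ⟨hb.v, _,
    (((BoundedSignal.sum Finset.univ fun i _ => (hb.x i).clm (N.A i)).sub
      (.const N.c)).sub (hb.v.clm N.L)).sub hb.y, fun t ht => (h (t + 1)).deriv_v (hI t ht)⟩
  have sζ : SlowSignal fun t => (σ t).ζ := ⟨hb.ζ, _, hb.v.sub hb.ζ, (h 0).deriv_ζ⟩
  have sx : ∀ i, SlowSignal fun t => (σ t).x i := fun i => ⟨hb.x i, _,
    ((((hg i).smul (1 + N.ρ i)).smul (-1)).sub (((((hb.x i).clm (N.A i)).sub (.const N.c)).sub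
      hb.y).clm (N.B i) |>.smul (N.ρ i))).sub ((hb.v.clm (N.B i)).smul (1 + N.ρ i)), fun t ht =>
      ((h (t + 1)).deriv_x i (hI t ht)).congr_deriv (by rw [neg_one_smul])⟩
  have sX : ∀ i, SlowSignal fun t => (σ t).X i := fun i =>
    ⟨hb.X i, _, (hb.x i).sub (hb.X i), (h 0).deriv_X i⟩
  have sξ : ∀ i, SlowSignal fun t => (σ t).ξ i := fun i =>
    ⟨hb.ξ i, _, (hb.X i).sub ((hb.ξ i).smul (N.a i)), (h 0).deriv_ξ i⟩
  have sΓ : ∀ i, SlowSignal fun t => (σ t).Γ i := fun i =>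
    ⟨hb.Γ i, _, (hg i).sub ((hb.Γ i).smul (N.a i)), (h 0).deriv_Γ i⟩
  have sΨ : ∀ i, SlowSignal fun t => (σ t).Ψ i := fun i =>
    ⟨hb.Ψ i, _, (((hg i).inner (hb.x i)).sub (hf i)).sub ((hb.Ψ i).smul (N.a i)), (h 0).deriv_Ψ i⟩
  have sq := sv.sub sζ
  have sπ := fun i => (sX i).sub ((sξ i).smul (N.a i))
  -- Only `f` is evaluated along the moving point `X`, and `g` only at the fixed point `u`, so
  -- continuity of `g` suffices.
  have sgap : ∀ i, SlowSignal fun t => N.gap u (σ t) i := fun i =>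
    ((((sX i).comp (N.hasGradient i) (N.continuous_g i)).sub (.const (N.f i (u i)))).sub
      ((SlowSignal.const (N.g i (u i))).inner ((sX i).sub (.const (u i))))).add
      ((((sΨ i).add (.const ((N.a i)⁻¹ * N.f i (u i)))).sub ((sΓ i).inner (.const (u i)))).smul
        (N.a i))
  exact ((sq.inner (sq.clm N.L)).add ((sζ.inner (sζ.clm N.L)).smul (1 / 4))).add
    (.sum Finset.univ fun i _ => (((sgap i).smul (1 / 4)).add
      (((((sx i).sub (sX i)).sub ((sπ i).smul (N.a i))).norm_sq).smul (N.ρ i * N.e i ^ 2))).add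
      ((sπ i).norm_sq.smul (1 / 4 * (N.ρ i * N.e i ^ 2))))

/-- Along bounded trajectories the dissipation rate vanishes asymptotically. -/
lemma tendsto_dissipation [CompleteSpace E] [∀ i, FiniteDimensional ℝ (H i)]
    (h : ∀ T, N.IsFiltered T σ)
    {Q : E →L[ℝ] E} (hQ : ∀ w, N.L (Q (N.L w)) = N.L w) {u : ∀ i, H i} {vs ys : E}
    (hu : N.IsEquilibrium u vs ys) (hy : ∃ k, (σ 0).y - ys = N.L k) :
    Tendsto (fun t => N.dissipation u (σ t)) atTop (𝓝 0) := by
  obtain ⟨-, w', ⟨K, hK⟩, hw⟩ :=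
    slowSignal_dissipation h (isBounded_of_isFiltered h hQ hu hy) u
  choose! V' hV hV' using fun t (ht : 0 ≤ t) =>
    storage_hasDerivWithinAt (h (t + 1)) hQ hu (t := t) ⟨ht, by linarith⟩
      ((h t).exists_sub_eq hy ⟨ht, le_rfl⟩)
  refine tendsto_zero_of_dissipation hV hV' (fun t ht => ?_)
    (fun t ht => dissipation_nonneg fun i y => (h t).young i y ht) hw hK
  refine le_trans ?_ (storage_ge hQ (fun i y => (h t).young i y ht)
    ((h t).exists_sub_eq hy ⟨ht, le_rfl⟩))
  refine add_nonneg (by positivity) (Finset.sum_nonneg fun i _ => ?_)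
  have := N.e_pos i
  positivity

/-- Each summand of the dissipation rate is nonnegative and so tends to zero. As `v - ζ` appears
only through `L`, its own decay needs a further argument: it is the derivative of the bounded signal
`ζ`, and its derivative tends to zero. -/
lemma tendsto_of_dissipation (h : ∀ T, N.IsFiltered T σ) (hb : IsBounded σ) {u : ∀ i, H i}
    (hd : Tendsto (fun t => N.dissipation u (σ t)) atTop (𝓝 0)) :
    Tendsto (fun t => (σ t).v - (σ t).ζ) atTop (𝓝 0) ∧
    Tendsto (fun t => N.L (σ t).ζ) atTop (𝓝 0) ∧
    ∀ i, Tendsto (fun t => N.gap u (σ t) i) atTop (𝓝 0) ∧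
      Tendsto (fun t => (σ t).x i - (σ t).X i) atTop (𝓝 0) ∧
      Tendsto (fun t => (σ t).X i - N.a i • (σ t).ξ i) atTop (𝓝 0) := by
  have hg : ∀ i, ∀ᶠ t in atTop, 0 ≤ N.gap u (σ t) i := fun i => by
    filter_upwards [eventually_ge_atTop 0] with t ht
    exact gap_nonneg (fun i y => (h t).young i y ht) i
  have hs : ∀ t, 0 ≤ t → ∀ i, 0 ≤ 1 / 4 * N.gap u (σ t) i
      + N.ρ i * N.e i ^ 2 * ‖(σ t).x i - (σ t).X i - N.a i • ((σ t).X i - N.a i • (σ t).ξ i)‖ ^ 2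
      + 1 / 4 * (N.ρ i * N.e i ^ 2) * ‖(σ t).X i - N.a i • (σ t).ξ i‖ ^ 2 := fun t ht i => by
    have := gap_nonneg (u := u) (fun i y => (h t).young i y ht) i
    have := N.ρ_pos i
    positivity
  have hle : ∀ t, 0 ≤ t → ∀ i, 1 / 4 * N.gap u (σ t) i
      + N.ρ i * N.e i ^ 2 * ‖(σ t).x i - (σ t).X i - N.a i • ((σ t).X i - N.a i • (σ t).ξ i)‖ ^ 2
      + 1 / 4 * (N.ρ i * N.e i ^ 2) * ‖(σ t).X i - N.a i • (σ t).ξ i‖ ^ 2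
      ≤ N.dissipation u (σ t) := fun t ht i => by
    have h1 := Finset.single_le_sum (fun i _ => hs t ht i) (Finset.mem_univ i)
    have := N.psd ((σ t).v - (σ t).ζ)
    have := N.psd (σ t).ζ
    unfold dissipation
    linarith
  have hk : ∀ i, 0 < N.ρ i * N.e i ^ 2 := fun i => by
    have := N.ρ_pos i
    have := N.e_pos i
    positivity
  have hπ : ∀ i, Tendsto (fun t => (σ t).X i - N.a i • (σ t).ξ i) atTop (𝓝 0) := fun i => by
    refine tendsto_zero_of_sq_norm (k := 1 / 4 * (N.ρ i * N.e i ^ 2)) (by linarith [hk i]) hd ?_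
    filter_upwards [eventually_ge_atTop 0, hg i] with t ht hgt
    have := mul_nonneg (hk i).le
      (sq_nonneg ‖(σ t).x i - (σ t).X i - N.a i • ((σ t).X i - N.a i • (σ t).ξ i)‖)
    linarith [hle t ht i]
  have hp : ∀ i, Tendsto (fun t => (σ t).x i - (σ t).X i) atTop (𝓝 0) := fun i => by
    have h1 : Tendsto (fun t => (σ t).x i - (σ t).X i - N.a i • ((σ t).X i - N.a i • (σ t).ξ i))
        atTop (𝓝 0) := by
      refine tendsto_zero_of_sq_norm (hk i) hd ?_
      filter_upwards [eventually_ge_atTop 0, hg i] with t ht hgt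
      have := mul_nonneg (hk i).le (sq_nonneg ‖(σ t).X i - N.a i • (σ t).ξ i‖)
      linarith [hle t ht i]
    simpa using h1.add ((hπ i).const_smul (N.a i))
  have hsum : ∀ t, 0 ≤ t → inner ℝ ((σ t).v - (σ t).ζ) (N.L ((σ t).v - (σ t).ζ))
      + 1 / 4 * inner ℝ (σ t).ζ (N.L (σ t).ζ) ≤ N.dissipation u (σ t) := fun t ht => by
    have := Finset.sum_nonneg fun i (_ : i ∈ Finset.univ) => hs t ht i
    unfold dissipation
    linarith
  obtain ⟨C, hC0, hC⟩ := norm_sq_apply_le_of_psd N.symm N.psd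
  have hLq : Tendsto (fun t => N.L ((σ t).v - (σ t).ζ)) atTop (𝓝 0) := by
    refine tendsto_zero_of_sq_norm one_pos (by simpa using hd.const_mul C) ?_
    filter_upwards [eventually_ge_atTop 0] with t ht
    have := mul_le_mul_of_nonneg_left (hsum t ht) hC0
    nlinarith [hC ((σ t).v - (σ t).ζ), mul_nonneg hC0 (N.psd (σ t).ζ)]
  have hLζ : Tendsto (fun t => N.L (σ t).ζ) atTop (𝓝 0) := by
    refine tendsto_zero_of_sq_norm one_pos (by simpa using (hd.const_mul C).const_mul 4) ?_
    filter_upwards [eventually_ge_atTop 0] with t ht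
    have := mul_le_mul_of_nonneg_left (hsum t ht) hC0
    nlinarith [hC (σ t).ζ, mul_nonneg hC0 (N.psd ((σ t).v - (σ t).ζ))]
  refine ⟨?_, hLζ, fun i => ⟨?_, hp i, hπ i⟩⟩
  · obtain ⟨B, hB⟩ := hb.ζ
    refine tendsto_zero_of_bounded_primitive ((h 0).deriv_ζ) (B := B)
      (q' := fun t => ∑ i, N.A i ((σ t).x i - (σ t).X i) - N.L (σ t).ζ - N.L ((σ t).v - (σ t).ζ))
      (fun t ht => ?_) hB ?_
    · refine (((h (t + 1)).deriv_v ⟨ht, by linarith⟩).sub ((h 0).deriv_ζ t ht)).congr_deriv ?_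
      exact (h t).deriv_sub_ζ ⟨ht, le_rfl⟩
    · have h1 : Tendsto (fun t => ∑ i, N.A i ((σ t).x i - (σ t).X i)) atTop (𝓝 0) := by
        have := tendsto_finsetSum Finset.univ fun i _ => ((N.A i).continuous.tendsto 0).comp (hp i)
        simpa [Function.comp_def] using this
      simpa using (h1.sub hLζ).sub hLq
  · refine tendsto_zero_of_nonneg_of_mul_le (k := 1 / 4) (by norm_num) hd (hg i) ?_
    filter_upwards [eventually_ge_atTop 0, hg i] with t ht hgt
    have h1 := mul_nonneg (hk i).le
      (sq_nonneg ‖(σ t).x i - (σ t).X i - N.a i • ((σ t).X i - N.a i • (σ t).ξ i)‖)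
    have h2 := mul_nonneg (hk i).le (sq_nonneg ‖(σ t).X i - N.a i • (σ t).ξ i‖)
    linarith [hle t ht i]

end PrimalDual

/-! ### Convergence to an equilibrium -/

namespace PrimalDual

variable {ι : Type*} {E : Type*} {H : ι → Type*} [Fintype ι]
    [NormedAddCommGroup E] [InnerProductSpace ℝ E]
    [∀ i, NormedAddCommGroup (H i)] [∀ i, InnerProductSpace ℝ (H i)] {N : PrimalDual ι E H}
    {σ : ℝ → FilteredState ι E H}

lemma IsBounded.exists_tendsto_subseq [FiniteDimensional ℝ E] [∀ i, FiniteDimensional ℝ (H i)]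
    (hb : IsBounded σ) : ∃ (τ : ℕ → ℝ) (ζ : E) (X Γ : ∀ i, H i), Tendsto τ atTop atTop ∧
      Tendsto (fun n => (σ (τ n)).ζ) atTop (𝓝 ζ) ∧
      (∀ i, Tendsto (fun n => (σ (τ n)).X i) atTop (𝓝 (X i))) ∧
      ∀ i, Tendsto (fun n => (σ (τ n)).Γ i) atTop (𝓝 (Γ i)) := by
  have : ProperSpace (E × (∀ i, H i) × (∀ i, H i)) := FiniteDimensional.proper ℝ _
  obtain ⟨K₁, h₁⟩ := hb.ζ
  choose K₂ h₂ using hb.X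
  choose K₃ h₃ using hb.Γ
  have hbd : ∀ n : ℕ, ((σ n).ζ, (σ n).X, (σ n).Γ) ∈ Metric.closedBall
      (0 : E × (∀ i, H i) × (∀ i, H i)) (|K₁| + ∑ i, (|K₂ i| + |K₃ i|)) := fun n => by
    have hn : (0 : ℝ) ≤ n := Nat.cast_nonneg n
    have hs : 0 ≤ ∑ i, (|K₂ i| + |K₃ i|) := Finset.sum_nonneg fun i _ => by positivity
    have hi : ∀ i, |K₂ i| + |K₃ i| ≤ ∑ i, (|K₂ i| + |K₃ i|) := fun i =>
      Finset.single_le_sum (f := fun i => |K₂ i| + |K₃ i|) (fun i _ => by positivity)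
        (Finset.mem_univ i)
    rw [mem_closedBall_zero_iff]
    have h1 := abs_nonneg K₁
    refine norm_prod_le_iff.2 ⟨by linarith [h₁ n hn, le_abs_self K₁], norm_prod_le_iff.2
      ⟨(pi_norm_le_iff_of_nonneg (by positivity)).2 fun i => ?_,
        (pi_norm_le_iff_of_nonneg (by positivity)).2 fun i => ?_⟩⟩
    · linarith [h₂ i n hn, le_abs_self (K₂ i), hi i, abs_nonneg (K₃ i)]
    · linarith [h₃ i n hn, le_abs_self (K₃ i), hi i, abs_nonneg (K₂ i)]
  obtain ⟨⟨ζ, X, Γ⟩, -, φ, hφ, hlim⟩ := (isCompact_closedBall _ _).tendsto_subseq hbd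
  have hlim' : Tendsto (fun n => ((σ (φ n)).ζ, (σ (φ n)).X, (σ (φ n)).Γ)) atTop (𝓝 (ζ, X, Γ)) := hlim
  exact ⟨fun n => φ n, ζ, X, Γ, tendsto_natCast_atTop_atTop.comp hφ.tendsto_atTop, hlim'.fst_nhds,
    tendsto_pi_nhds.1 hlim'.snd_nhds.fst_nhds, tendsto_pi_nhds.1 hlim'.snd_nhds.snd_nhds⟩

/-- A filtered trajectory converges to an equilibrium. -/
theorem exists_tendsto_of_isFiltered [FiniteDimensional ℝ E] [∀ i, FiniteDimensional ℝ (H i)]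
    (h : ∀ T, N.IsFiltered T σ) {u : ∀ i, H i} {vs ys : E}
    (hu : N.IsEquilibrium u vs ys) (hy : ∃ k, (σ 0).y - ys = N.L k) :
    ∃ (u' : ∀ i, H i) (vs' ys' : E), N.IsEquilibrium u' vs' ys' ∧ (∃ k, (σ 0).y - ys' = N.L k) ∧
      Tendsto (fun t => (σ t).v) atTop (𝓝 vs') ∧
      ∀ i, Tendsto (fun t => (σ t).x i) atTop (𝓝 (u' i)) := by
  have : CompleteSpace E := FiniteDimensional.complete ℝ E
  obtain ⟨Q, hQ⟩ := exists_generalized_inverse N.L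
  have hb := isBounded_of_isFiltered h hQ hu hy
  obtain ⟨hq, hLζ, hag⟩ := tendsto_of_dissipation h hb (tendsto_dissipation h hQ hu hy)
  obtain ⟨τ, ζ, X, Γ, hτ, hζ, hX, hΓ⟩ := hb.exists_tendsto_subseq
  have hτ0 : ∀ᶠ n in atTop, 0 ≤ τ n := hτ.eventually_ge_atTop 0
  have hqτ := hq.comp hτ
  have hgτ := fun i => (hag i).1.comp hτ
  have hpτ := fun i => (hag i).2.1.comp hτ
  have hπτ := fun i => (hag i).2.2.comp hτ
  simp only [Function.comp_def] at hqτ hgτ hpτ hπτ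
  have hfX : ∀ i, Tendsto (fun n => N.f i ((σ (τ n)).X i)) atTop (𝓝 (N.f i (X i))) := fun i =>
    ((N.continuous_f i).tendsto _).comp (hX i)
  have hbr : ∀ i, Tendsto (fun n => bregman (N.f i) (N.g i) (u i) ((σ (τ n)).X i)) atTop
      (𝓝 (bregman (N.f i) (N.g i) (u i) (X i))) := fun i =>
    ((hfX i).sub_const _).sub (tendsto_const_nhds.inner ((hX i).sub_const _))
  have hbr0 : ∀ i, bregman (N.f i) (N.g i) (u i) (X i) = 0 := fun i => by
    refine tendsto_nhds_unique (hbr i) (squeeze_zero' (.of_forall fun n =>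
      bregman_nonneg (N.convex i) _ _) ?_ (hgτ i))
    filter_upwards [hτ0] with n hn
    rw [gap_eq]
    linarith [(h (τ n)).young i (u i) hn]
  -- No compactness is used for `Ψ`: the vanishing gap determines its limit.
  have hΨ : ∀ i, Tendsto (fun n => (σ (τ n)).Ψ i) atTop
      (𝓝 ((N.a i)⁻¹ * (N.a i * inner ℝ (Γ i) (u i) - N.f i (u i)))) := fun i => by
    have h1 := ((((hgτ i).sub (hbr i)).sub_const (N.f i (u i))).add
      (((hΓ i).inner (tendsto_const_nhds (x := u i))).const_mul (N.a i))).const_mul (N.a i)⁻¹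
    rw [hbr0, sub_zero, zero_sub, neg_add_eq_sub] at h1
    refine h1.congr fun n => ?_
    have ha := (N.a_pos i).ne'
    rw [gap_eq]
    field_simp
    ring
  -- In the limit Young's inequality holds with equality at `u`, so `u` minimizes `f - a ⟨Γ, ·⟩`.
  have hgu : ∀ i, N.g i (u i) = N.a i • Γ i := fun i => by
    refine eq_zero_of_hasFDerivAt_of_le (N.hasGradient i (u i)) fun y => ?_
    have h1 := ((((hΓ i).inner (tendsto_const_nhds (x := y))).const_mul (N.a i)).const_sub
      (N.f i y)).add ((hΨ i).const_mul (N.a i))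
    have h2 := ge_of_tendsto h1 (b := 0) (by
      filter_upwards [hτ0] with n hn using (h (τ n)).young i y hn)
    rw [mul_inv_cancel_left₀ (N.a_pos i).ne'] at h2
    rw [real_inner_smul_left, real_inner_smul_left]
    linarith
  -- A vanishing Bregman distance makes `X` a minimizer of `f - ⟨g u, ·⟩`. The minimizers `X` and
  -- `u` may differ, but their gradients agree.
  have hgX : ∀ i, N.g i (X i) = N.g i (u i) := fun i => by
    refine eq_zero_of_hasFDerivAt_of_le (N.hasGradient i (X i)) fun y => ?_
    have h1 := bregman_nonneg (N.convex i) (u i) y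
    have h2 := hbr0 i
    unfold bregman at h1 h2
    rw [inner_sub_right] at h1 h2
    linarith
  have hBζ : ∀ i, N.B i ζ = -(N.a i • Γ i) := fun i => by
    have h1 : Tendsto (fun n => N.B i (σ (τ n)).ζ) atTop (𝓝 (N.B i ζ)) :=
      ((N.B i).continuous.tendsto _).comp hζ
    have h2 : Tendsto (fun n => N.M i ((σ (τ n)).X i - N.a i • (σ (τ n)).ξ i)) atTop (𝓝 0) := by
      simpa [Function.comp_def] using ((N.M i).continuous.tendsto 0).comp (hπτ i)
    have h3 := ((((hΓ i).const_smul (N.a i)).add ((hpτ i).const_smul (N.e i))).add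
      (h2.const_smul (N.ρ i * N.e i))).neg
    simp only [smul_zero, add_zero] at h3
    refine tendsto_nhds_unique (h1.congr' ?_) h3
    filter_upwards [hτ0] with n hn using (h (τ n)).price i ⟨hn, le_rfl⟩
  have hAX : Tendsto (fun n => ∑ i, N.A i ((σ (τ n)).X i)) atTop (𝓝 (∑ i, N.A i (X i))) :=
    tendsto_finsetSum _ fun i _ => ((N.A i).continuous.tendsto _).comp (hX i)
  have hyτ : Tendsto (fun n => (σ (τ n)).y) atTop (𝓝 (∑ i, N.A i (X i) - N.c)) := by
    have h1 := (hAX.sub_const N.c).sub hqτ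
    rw [sub_zero] at h1
    refine h1.congr' ?_
    filter_upwards [hτ0] with n hn
    rw [(h (τ n)).sub_ζ ⟨hn, le_rfl⟩]
    abel
  have hLζ0 : N.L ζ = 0 := tendsto_nhds_unique ((N.L.continuous.tendsto _).comp hζ) (hLζ.comp hτ)
  have hu' : N.IsEquilibrium X ζ (∑ i, N.A i (X i) - N.c) :=
    ⟨fun i => by rw [hgX, hgu, hBζ, add_neg_cancel], hLζ0, rfl⟩
  have hy' : ∃ k, (σ 0).y - (∑ i, N.A i (X i) - N.c) = N.L k := by
    -- `L ∘ Q` fixes the range of `L` pointwise, and by continuity fixes limits of elements of that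
    -- range.
    have h1 : N.L (Q (∑ i, N.A i (X i) - N.c - ys)) = ∑ i, N.A i (X i) - N.c - ys := by
      refine tendsto_nhds_unique (((N.L.comp Q).continuous.tendsto _).comp (hyτ.sub_const ys))
        ((hyτ.sub_const ys).congr' ?_)
      filter_upwards [hτ0] with n hn
      obtain ⟨k, hk⟩ := (h (τ n)).exists_sub_eq hy (t := τ n) ⟨hn, le_rfl⟩
      simp only [Function.comp_apply, ContinuousLinearMap.comp_apply, hk, hQ]
    obtain ⟨k, hk⟩ := hy
    refine ⟨k - Q (∑ i, N.A i (X i) - N.c - ys), ?_⟩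
    rw [map_sub, h1, ← hk]
    abel
  have hξ : ∀ i, Tendsto (fun n => (σ (τ n)).ξ i) atTop (𝓝 ((N.a i)⁻¹ • X i)) := fun i => by
    have h1 := ((hX i).sub (hπτ i)).const_smul (N.a i)⁻¹
    simpa only [sub_sub_cancel, inv_smul_smul₀ (N.a_pos i).ne', sub_zero] using h1
  have hV := tendsto_storage (N := N) (l := atTop) (σ := fun n => σ (τ n))
    (σ' := ⟨ζ, ∑ i, N.A i (X i) - N.c, X, ζ, X, fun i => (N.a i)⁻¹ • X i, Γ,
      fun i => (N.a i)⁻¹ * (N.a i * inner ℝ (Γ i) (u i) - N.f i (u i))⟩)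
    (by simpa using hqτ.add hζ) hyτ (fun i => by simpa using (hpτ i).add (hX i)) hζ hX hξ hΓ hΨ
    Q X ζ (∑ i, N.A i (X i) - N.c)
  have hV0 : N.storage Q X ζ (∑ i, N.A i (X i) - N.c) ⟨ζ, ∑ i, N.A i (X i) - N.c, X, ζ, X,
      fun i => (N.a i)⁻¹ • X i, Γ,
      fun i => (N.a i)⁻¹ * (N.a i * inner ℝ (Γ i) (u i) - N.f i (u i))⟩ = 0 := by
    have h1 : ∀ i, N.f i (X i) - N.f i (u i) - N.a i * inner ℝ (Γ i) (X i - u i) = 0 := fun i => by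
      have := hbr0 i
      rwa [bregman, hgu, real_inner_smul_left] at this
    have h2 : ∀ i, agentStorage (N.f i) (N.g i) (N.M i) (N.ρ i) (N.e i) (N.a i) (X i) (X i) (X i)
        ((N.a i)⁻¹ • X i) (Γ i) ((N.a i)⁻¹ * (N.a i * inner ℝ (Γ i) (u i) - N.f i (u i))) = 0 := by
      intro i
      have ha := (N.a_pos i).ne'
      have h3 := h1 i
      rw [inner_sub_right] at h3
      have h4 : costStorage (N.f i) (N.g i) (N.a i) (X i) (X i) (Γ i)
          ((N.a i)⁻¹ * (N.a i * inner ℝ (Γ i) (u i) - N.f i (u i))) = 0 := by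
        unfold costStorage bregman
        simp only [sub_self, inner_zero_right, inner_zero_left, mul_zero, sub_zero, zero_add]
        rw [mul_sub, mul_add, mul_inv_cancel_left₀ ha, mul_inv_cancel_left₀ ha]
        linarith
      unfold agentStorage
      rw [h4, smul_inv_smul₀ ha]
      simp
    unfold storage
    simp only [h2, hLζ0]
    simp
  rw [hV0] at hV
  -- The storage relative to the cluster point is nonnegative and nonincreasing, and tends to zero
  -- along `τ`.
  have hVt : Tendsto (fun t => N.storage Q X ζ (∑ i, N.A i (X i) - N.c) (σ t)) atTop (𝓝 0) := by
    refine tendsto_order.2 ⟨fun r hr => ?_, fun r hr => ?_⟩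
    · filter_upwards [eventually_ge_atTop 0] with t ht
      refine hr.trans_le (le_trans ?_ (storage_ge hQ (fun i y => (h t).young i y ht)
        ((h t).exists_sub_eq hy' ⟨ht, le_rfl⟩)))
      refine add_nonneg (by positivity) (Finset.sum_nonneg fun i _ => ?_)
      have := N.e_pos i
      positivity
    · obtain ⟨n, hn, hn0⟩ := ((hV.eventually (gt_mem_nhds hr)).and hτ0).exists
      filter_upwards [eventually_ge_atTop (τ n)] with t ht
      exact (storage_antitoneOn (h t) hQ hu' hy' ⟨hn0, ht⟩ ⟨hn0.trans ht, le_rfl⟩ ht).trans_lt hn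
  have hge : ∀ᶠ t in atTop, 1 / 8 * ‖(σ t).ζ - ζ‖ ^ 2
      + ∑ i, N.e i / 8 * (‖(σ t).x i - (σ t).X i‖ ^ 2 + ‖(σ t).X i - X i‖ ^ 2)
      ≤ N.storage Q X ζ (∑ i, N.A i (X i) - N.c) (σ t) := by
    filter_upwards [eventually_ge_atTop 0] with t ht
    have := storage_ge hQ (u := X) (vs := ζ) (fun i y => (h t).young i y ht)
      ((h t).exists_sub_eq hy' ⟨ht, le_rfl⟩)
    linarith [sq_nonneg ‖(σ t).v - (σ t).ζ‖]
  have hnn : ∀ t i, 0 ≤ N.e i / 8 * (‖(σ t).x i - (σ t).X i‖ ^ 2 + ‖(σ t).X i - X i‖ ^ 2) :=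
    fun t i => by
      have := N.e_pos i
      positivity
  refine ⟨X, ζ, _, hu', hy', ?_, fun i => ?_⟩
  · have h1 : Tendsto (fun t => (σ t).ζ - ζ) atTop (𝓝 0) := by
      refine tendsto_zero_of_sq_norm (k := 1 / 8) (by norm_num) hVt ?_
      filter_upwards [hge] with t ht
      linarith [Finset.sum_nonneg fun i (_ : i ∈ Finset.univ) => hnn t i]
    simpa using (hq.add h1).add_const ζ
  · have h1 : Tendsto (fun t => (σ t).X i - X i) atTop (𝓝 0) := by
      refine tendsto_zero_of_sq_norm (k := N.e i / 8) (by linarith [N.e_pos i]) hVt ?_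
      filter_upwards [hge] with t ht
      have h2 := Finset.single_le_sum (fun i _ => hnn t i) (Finset.mem_univ i)
      have h3 := mul_nonneg (N.e_pos i).le (sq_nonneg ‖(σ t).x i - (σ t).X i‖)
      nlinarith [sq_nonneg ‖(σ t).ζ - ζ‖]
    simpa using ((hag i).2.1.add h1).add_const (X i)

/-- Every solution of the flow converges to an equilibrium. -/
theorem exists_tendsto [FiniteDimensional ℝ E] [∀ i, FiniteDimensional ℝ (H i)]
    (N : PrimalDual ι E H) {u : ∀ i, H i} {vs ys : E} (hu : N.IsEquilibrium u vs ys)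
    {z : ℝ → E × E × (∀ i, H i)} (hy : ∃ k, (z 0).2.1 - ys = N.L k)
    (hz : ∀ t, 0 ≤ t → HasDerivWithinAt z (N.field (z t)) (Set.Ici 0) t) :
    ∃ (u' : ∀ i, H i) (vs' ys' : E), N.IsEquilibrium u' vs' ys' ∧
      (∃ k, (z 0).2.1 - ys' = N.L k) ∧ Tendsto (fun t => (z t).1) atTop (𝓝 vs') ∧
      ∀ i, Tendsto (fun t => (z t).2.2 i) atTop (𝓝 (u' i)) := by
  have : CompleteSpace E := FiniteDimensional.complete ℝ E
  obtain ⟨σ₀, -, hσ⟩ := N.exists_isFiltered (z 0)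
  obtain ⟨σ, -, hσz, hfil⟩ := hσ z (fun t ht => (hz t ht).continuousWithinAt) rfl
  have h : ∀ T, N.IsFiltered T σ := fun T => hfil T fun t ht => hz t ht.1
  simp only [← hσz] at hy ⊢
  exact exists_tendsto_of_isFiltered h hu hy

end PrimalDual

lemma real_inner_eq_sum {J : Type*} [Fintype J] (x y : EuclideanSpace ℝ J) :
    inner ℝ x y = ∑ s, x s * y s := by
  rw [PiLp.inner_apply]
  exact Finset.sum_congr rfl fun s _ => by simp [mul_comm]

/-! ### Weighted Laplacians of the clusters: kernel and range -/

section Laplacian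

variable {κ : Type*} [Fintype κ] {F : κ → Type*} [∀ k, Fintype (F k)]

/-- The direct sum of weighted graph Laplacians on the fibres `F k`. -/
noncomputable def laplacian (w : ∀ k, F k → F k → ℝ) :
    EuclideanSpace ℝ (Σ k, F k) →L[ℝ] EuclideanSpace ℝ (Σ k, F k) :=
  LinearMap.toContinuousLinearMap
    { toFun := fun v => WithLp.toLp 2 fun s => ∑ j, w s.1 s.2 j * (v s - v ⟨s.1, j⟩)
      map_add' := fun u v => by
        ext s
        simp only [PiLp.add_apply, ← Finset.sum_add_distrib]
        exact Finset.sum_congr rfl fun j _ => by ring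
      map_smul' := fun c v => by
        ext s
        simp only [PiLp.smul_apply, smul_eq_mul, RingHom.id_apply, Finset.mul_sum]
        exact Finset.sum_congr rfl fun j _ => by ring }

variable {w : ∀ k, F k → F k → ℝ}

lemma laplacian_apply (v : EuclideanSpace ℝ (Σ k, F k)) (k : κ) (l : F k) :
    laplacian w v ⟨k, l⟩ = ∑ j, w k l j * (v ⟨k, l⟩ - v ⟨k, j⟩) := rfl

lemma sum_laplacian (hw : ∀ k l j, w k l j = w k j l) (v : EuclideanSpace ℝ (Σ k, F k)) (k : κ) :
    ∑ l, laplacian w v ⟨k, l⟩ = 0 := by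
  have h : ∑ l, laplacian w v ⟨k, l⟩ = -∑ l, laplacian w v ⟨k, l⟩ := by
    simp only [laplacian_apply]
    nth_rewrite 1 [Finset.sum_comm]
    rw [← Finset.sum_neg_distrib]
    refine Finset.sum_congr rfl fun l _ => ?_
    rw [← Finset.sum_neg_distrib]
    exact Finset.sum_congr rfl fun j _ => by rw [hw k j l]; ring
  linarith

lemma inner_laplacian (hw : ∀ k l j, w k l j = w k j l) (u v : EuclideanSpace ℝ (Σ k, F k)) :
    inner ℝ u (laplacian w v)
      = 1 / 2 * ∑ k, ∑ l, ∑ j, w k l j * ((u ⟨k, l⟩ - u ⟨k, j⟩) * (v ⟨k, l⟩ - v ⟨k, j⟩)) := by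
  rw [real_inner_eq_sum, Fintype.sum_sigma, Finset.mul_sum]
  refine Finset.sum_congr rfl fun k _ => ?_
  have h1 : ∑ l, u ⟨k, l⟩ * laplacian w v ⟨k, l⟩
      = ∑ l, ∑ j, w k l j * (u ⟨k, l⟩ * (v ⟨k, l⟩ - v ⟨k, j⟩)) := by
    refine Finset.sum_congr rfl fun l _ => ?_
    rw [laplacian_apply, Finset.mul_sum]
    exact Finset.sum_congr rfl fun j _ => by ring
  have h2 : ∑ l, ∑ j, w k l j * (u ⟨k, l⟩ * (v ⟨k, l⟩ - v ⟨k, j⟩))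
      = -∑ l, ∑ j, w k l j * (u ⟨k, j⟩ * (v ⟨k, l⟩ - v ⟨k, j⟩)) := by
    rw [Finset.sum_comm, ← Finset.sum_neg_distrib]
    refine Finset.sum_congr rfl fun l _ => ?_
    rw [← Finset.sum_neg_distrib]
    exact Finset.sum_congr rfl fun j _ => by rw [hw k j l]; ring
  have h3 : ∑ l, ∑ j, w k l j * ((u ⟨k, l⟩ - u ⟨k, j⟩) * (v ⟨k, l⟩ - v ⟨k, j⟩))
      = ∑ l, ∑ j, w k l j * (u ⟨k, l⟩ * (v ⟨k, l⟩ - v ⟨k, j⟩))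
        - ∑ l, ∑ j, w k l j * (u ⟨k, j⟩ * (v ⟨k, l⟩ - v ⟨k, j⟩)) := by
    rw [← Finset.sum_sub_distrib]
    refine Finset.sum_congr rfl fun l _ => ?_
    rw [← Finset.sum_sub_distrib]
    exact Finset.sum_congr rfl fun j _ => by ring
  rw [h1, h3]
  linarith

lemma laplacian_symm (hw : ∀ k l j, w k l j = w k j l) (u v : EuclideanSpace ℝ (Σ k, F k)) :
    inner ℝ (laplacian w u) v = inner ℝ u (laplacian w v) := by
  rw [real_inner_comm, inner_laplacian hw, inner_laplacian hw]
  simp only [mul_comm (v _ - v _)]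

lemma laplacian_psd (hw : ∀ k l j, w k l j = w k j l) (h0 : ∀ k l j, 0 ≤ w k l j)
    (u : EuclideanSpace ℝ (Σ k, F k)) : 0 ≤ inner ℝ u (laplacian w u) := by
  rw [inner_laplacian hw]
  exact mul_nonneg (by norm_num) (Finset.sum_nonneg fun k _ => Finset.sum_nonneg fun l _ =>
    Finset.sum_nonneg fun j _ => mul_nonneg (h0 k l j) (mul_self_nonneg _))

/-- Every term of the Dirichlet form vanishes, so `v` agrees across each edge and then along walks.
-/
lemma eq_of_laplacian_eq_zero (hw : ∀ k l j, w k l j = w k j l) (h0 : ∀ k l j, 0 ≤ w k l j)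
    {Gr : ∀ k, SimpleGraph (F k)} (hadj : ∀ k l j, (Gr k).Adj l j → 0 < w k l j)
    (hconn : ∀ k, (Gr k).Connected) {v : EuclideanSpace ℝ (Σ k, F k)} (hv : laplacian w v = 0)
    (k : κ) (l j : F k) : v ⟨k, l⟩ = v ⟨k, j⟩ := by
  have h := inner_laplacian hw v v
  rw [hv, inner_zero_right] at h
  have hn : ∀ k l j, 0 ≤ w k l j * ((v ⟨k, l⟩ - v ⟨k, j⟩) * (v ⟨k, l⟩ - v ⟨k, j⟩)) := fun k l j =>
    mul_nonneg (h0 k l j) (mul_self_nonneg _)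
  have h1 : ∀ l j, w k l j * ((v ⟨k, l⟩ - v ⟨k, j⟩) * (v ⟨k, l⟩ - v ⟨k, j⟩)) = 0 := fun l j => by
    have h2 := (Finset.sum_eq_zero_iff_of_nonneg fun k _ => Finset.sum_nonneg fun l _ =>
      Finset.sum_nonneg fun j _ => hn k l j).1 (by linarith :
        ∑ k, ∑ l, ∑ j, w k l j * ((v ⟨k, l⟩ - v ⟨k, j⟩) * (v ⟨k, l⟩ - v ⟨k, j⟩)) = 0) k
        (Finset.mem_univ k)
    have h3 := (Finset.sum_eq_zero_iff_of_nonneg fun l _ =>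
      Finset.sum_nonneg fun j _ => hn k l j).1 h2 l (Finset.mem_univ l)
    exact (Finset.sum_eq_zero_iff_of_nonneg fun j _ => hn k l j).1 h3 j (Finset.mem_univ j)
  obtain ⟨p⟩ := (hconn k).preconnected l j
  induction p with
  | nil => rfl
  | cons hab _ ih =>
    rw [← ih]
    have := (mul_eq_zero.1 (h1 _ _)).resolve_left (hadj k _ _ hab).ne'
    exact sub_eq_zero.1 (mul_self_eq_zero.1 this)

/-- The range of a symmetric operator is the orthogonal complement of its kernel, which here
consists of vectors constant on each fibre. -/
lemma exists_laplacian_eq (hw : ∀ k l j, w k l j = w k j l) (h0 : ∀ k l j, 0 ≤ w k l j)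
    {Gr : ∀ k, SimpleGraph (F k)} (hadj : ∀ k l j, (Gr k).Adj l j → 0 < w k l j)
    (hconn : ∀ k, (Gr k).Connected) {y : EuclideanSpace ℝ (Σ k, F k)}
    (hy : ∀ k, ∑ l, y ⟨k, l⟩ = 0) : ∃ h, y = laplacian w h := by
  have hsymm : (laplacian w : EuclideanSpace ℝ (Σ k, F k) →ₗ[ℝ] _).IsSymmetric :=
    laplacian_symm hw
  have hmem : y ∈ (LinearMap.range (laplacian w : EuclideanSpace ℝ (Σ k, F k) →ₗ[ℝ] _))ᗮᗮ := by
    rw [hsymm.orthogonal_range, Submodule.mem_orthogonal]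
    intro v hv
    have hv' : laplacian w v = 0 := hv
    rw [real_inner_eq_sum, Fintype.sum_sigma]
    refine Finset.sum_eq_zero fun k _ => ?_
    obtain ⟨l₀⟩ := (hconn k).nonempty
    rw [Finset.sum_congr rfl fun l _ => by
      rw [eq_of_laplacian_eq_zero hw h0 hadj hconn hv' k l l₀], ← Finset.mul_sum, hy, mul_zero]
  rw [Submodule.orthogonal_orthogonal] at hmem
  obtain ⟨h, hh⟩ := hmem
  exact ⟨h, hh.symm⟩

end Laplacian

/-! ### The gradient inequality and existence of KKT points -/

section Convexity

variable {H : Type*} [NormedAddCommGroup H] [InnerProductSpace ℝ H]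

lemma add_inner_le_of_convexOn {f : H → ℝ} (hf : ConvexOn ℝ Set.univ f) {d x : H}
    (hd : HasFDerivAt f (innerSL ℝ d) x) (y : H) : f x + inner ℝ d (y - x) ≤ f y := by
  have hc : ConvexOn ℝ Set.univ fun t : ℝ => f (AffineMap.lineMap x y t) :=
    hf.comp_affineMap (AffineMap.lineMap x y)
  have hl : HasDerivAt (fun t : ℝ => AffineMap.lineMap x y t) (y - x) 0 :=
    AffineMap.hasDerivAt_lineMap
  have hd' : HasDerivAt (fun t : ℝ => f (AffineMap.lineMap x y t)) (inner ℝ d (y - x)) 0 := by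
    have h0 : HasFDerivAt f (innerSL ℝ d) (AffineMap.lineMap x y (0 : ℝ)) := by simpa using hd
    exact h0.comp_hasDerivAt 0 hl
  have := hc.le_slope_of_hasDerivAt (Set.mem_univ 0) (Set.mem_univ 1) zero_lt_one hd'
  simp only [slope_def_field, AffineMap.lineMap_apply_one, AffineMap.lineMap_apply_zero] at this
  linarith

end Convexity

namespace Problem

variable {N p : ℕ} {n : Fin N → ℕ} {P : Problem N p n}

lemma Assumptions.hasFDerivAt (hP : P.Assumptions) (i : Fin N) (x : EuclideanSpace ℝ (Fin (n i))) :
    HasFDerivAt (P.localCost i) (innerSL ℝ (gradient (P.localCost i) x)) x := by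
  have hd := hP.differentiable i
  have h : Differentiable ℝ (P.localCost i) := by
    unfold localCost
    fun_prop
  refine ((h x).hasGradientAt.hasFDerivAt).congr_fderiv ?_
  ext y
  rfl

lemma Assumptions.convexOn (hP : P.Assumptions) (i : Fin N) :
    ConvexOn ℝ Set.univ (P.localCost i) := by
  refine ⟨convex_univ, fun x _ y _ a b ha hb hab => ?_⟩
  simp only [localCost, smul_eq_mul, Finset.mul_sum, ← Finset.sum_add_distrib]
  exact Finset.sum_le_sum fun l _ =>
    (hP.convex i l).2 (Set.mem_univ (x l)) (Set.mem_univ (y l)) ha hb hab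

/-- A minimizer of the problem satisfies the KKT conditions. -/
lemma Assumptions.exists_isKKT (hP : P.Assumptions) : ∃ ν x, P.IsKKT ν x := by
  obtain ⟨x, hx, hmin⟩ := hP.optimum
  let φ : Fin p → Decision n →ₗ[ℝ] ℝ := fun k =>
    ∑ i, (innerSL ℝ (P.row i k) : EuclideanSpace ℝ (Fin (n i)) →ₗ[ℝ] ℝ).comp (LinearMap.proj i)
  let K : Decision n →ₗ[ℝ] ℝ := ∑ i, (innerSL ℝ (gradient (P.localCost i) (x i)) :
    EuclideanSpace ℝ (Fin (n i)) →ₗ[ℝ] ℝ).comp (LinearMap.proj i)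
  have hφ : ∀ k d, φ k d = ∑ i, inner ℝ (P.row i k) (d i) := fun k d => by
    simp [φ, LinearMap.sum_apply]
  have hK : ∀ d, K d = ∑ i, inner ℝ (gradient (P.localCost i) (x i)) (d i) := fun d => by
    simp [K, LinearMap.sum_apply]
  -- Along a direction that preserves all constraints the cost has a minimum at the minimizer `x`,
  -- so its derivative vanishes.
  have hle : ⨅ k, LinearMap.ker (φ k) ≤ LinearMap.ker K := by
    intro d hd
    rw [Submodule.mem_iInf] at hd
    have hd' : ∀ k, ∑ i, inner ℝ (P.row i k) (d i) = 0 := fun k => by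
      rw [← hφ]
      exact hd k
    have hder : HasDerivAt (fun t : ℝ => P.cost (x + t • d)) (K d) 0 := by
      rw [hK]
      refine HasDerivAt.fun_sum fun i _ => ?_
      have h1 : HasDerivAt (fun t : ℝ => x i + t • d i) (d i) 0 := by
        simpa using ((hasDerivAt_id (0 : ℝ)).smul_const (d i)).const_add (x i)
      have h2 : HasFDerivAt (P.localCost i) (innerSL ℝ (gradient (P.localCost i) (x i)))
          (x i + (0 : ℝ) • d i) := by simpa using hP.hasFDerivAt i (x i)
      exact h2.comp_hasDerivAt 0 h1
    have hloc : IsLocalMin (fun t : ℝ => P.cost (x + t • d)) 0 := by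
      refine Eventually.of_forall fun t => ?_
      have : x + t • d ∈ P.feasibleSet := fun k => by
        simp only [Pi.add_apply, Pi.smul_apply, inner_add_right, inner_smul_right,
          Finset.sum_add_distrib, ← Finset.mul_sum]
        rw [hd' k, mul_zero, add_zero]
        exact hx k
      simpa using hmin this
    exact hloc.hasDerivAt_eq_zero hder
  -- A functional that vanishes on the common kernel of the constraint functionals is a combination
  -- of them; the multipliers are its negated coefficients.
  obtain ⟨c, hc⟩ := (Submodule.mem_span_range_iff_exists_fun ℝ).1 (mem_span_of_iInf_ker_le_ker hle)
  refine ⟨fun k => -c k, x, fun i => ?_, hx⟩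
  refine ext_inner_right ℝ fun h => ?_
  have h1 := LinearMap.congr_fun hc (Pi.single i h)
  have h2 : ∀ d : ∀ j, EuclideanSpace ℝ (Fin (n j)),
      ∑ j, inner ℝ (d j) ((Pi.single i h : Decision n) j) = inner ℝ (d i) h := fun d => by
    rw [Finset.sum_eq_single i (fun j _ hj => by rw [Pi.single_eq_of_ne hj, inner_zero_right])
      (by simp), Pi.single_eq_same]
  simp only [LinearMap.sum_apply, LinearMap.smul_apply, hφ, hK] at h1
  rw [h2] at h1
  simp only [fun k => h2 fun j => P.row j k, smul_eq_mul] at h1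
  simp only [inner_add_left, sum_inner, real_inner_smul_left, inner_zero_left, ← h1, neg_mul,
    Finset.sum_neg_distrib, add_neg_cancel]

end Problem

/-! ### The distributed algorithm as a primal-dual flow -/

variable {N p : ℕ} {n : Fin N → ℕ} (P : Problem N p n) (V : Fin p → Finset (Fin N))

/-- The transposed weighting matrix of agent `i`, acting on the stacked dual variables. -/
noncomputable def dualMap (i : Fin N) :
    EuclideanSpace ℝ (Σ k, V k) →L[ℝ] EuclideanSpace ℝ (Fin (n i)) :=
  ∑ k : {k // i ∈ V k}, (EuclideanSpace.proj (⟨k, ⟨i, k.2⟩⟩ : Σ k, V k)).smulRight (P.row i k)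

lemma dualMap_apply (i : Fin N) (v : EuclideanSpace ℝ (Σ k, V k)) :
    dualMap P V i v = ∑ k : {k // i ∈ V k}, v ⟨k, ⟨i, k.2⟩⟩ • P.row i k := by
  simp [dualMap]

/-- The contribution of agent `i` to the stacked constraints. -/
noncomputable def primalMap (i : Fin N) :
    EuclideanSpace ℝ (Fin (n i)) →L[ℝ] EuclideanSpace ℝ (Σ k, V k) :=
  ContinuousLinearMap.adjoint (dualMap P V i)

lemma primalMap_apply (i : Fin N) (x : EuclideanSpace ℝ (Fin (n i))) (k : Fin p) (l : V k) :
    primalMap P V i x ⟨k, l⟩ = if (l : Fin N) = i then inner ℝ (P.row i k) x else 0 := by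
  have h : primalMap P V i x ⟨k, l⟩
      = inner ℝ (dualMap P V i (EuclideanSpace.single ⟨k, l⟩ 1)) x := by
    rw [primalMap, ← ContinuousLinearMap.adjoint_inner_right, EuclideanSpace.inner_single_left]
    simp
  rw [h, dualMap_apply]
  split_ifs with hl
  · subst hl
    rw [Finset.sum_eq_single ⟨k, l.2⟩ (fun j _ hj => ?_) (by simp)]
    · simp
    · rw [PiLp.single_apply, if_neg fun h => hj (Subtype.ext (congrArg Sigma.fst h)),
        zero_smul]
  · rw [Finset.sum_eq_zero fun j _ => ?_, inner_zero_left]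
    rw [PiLp.single_apply, if_neg fun h => hl ?_, zero_smul]
    have := congrArg (fun s : Σ k, V k => (s.2 : Fin N)) h
    exact this.symm

lemma sum_primalMap_apply (x : Decision n) (k : Fin p) (l : V k) :
    (∑ i, primalMap P V i (x i)) ⟨k, l⟩ = inner ℝ (P.row l k) (x l) := by
  rw [WithLp.ofLp_sum, Finset.sum_apply]
  simp only [primalMap_apply]
  simp

/-- The primal-dual flow that corresponds to the distributed algorithm. -/
noncomputable def primalDual (hP : P.Assumptions) (G : WeightedGraph N)
    (bbar : (k : Fin p) → V k → ℝ) {β : Fin p → ℝ} (hβ : ∀ k, 0 < β k) {ρ : Fin N → ℝ}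
    (hρ : ∀ i, 0 < ρ i) : PrimalDual (Fin N) (EuclideanSpace ℝ (Σ k, V k))
      (fun i => EuclideanSpace ℝ (Fin (n i))) where
  f := P.localCost
  g i := gradient (P.localCost i)
  A := primalMap P V
  B := dualMap P V
  L := laplacian fun k (l j : V k) => β k * G.a l j
  c := WithLp.toLp 2 fun s => bbar s.1 s.2
  ρ := ρ
  hasGradient := hP.hasFDerivAt
  convex i x := add_inner_le_of_convexOn (hP.convexOn i) (hP.hasFDerivAt i x)
  locallyLipschitz := hP.locallyLipschitz
  adjoint i x v := ContinuousLinearMap.adjoint_inner_left _ _ _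
  orthogonal i j x hij := by
    rw [dualMap_apply]
    refine Finset.sum_eq_zero fun k _ => ?_
    rw [primalMap_apply, if_neg (Ne.symm hij), zero_smul]
  symm := laplacian_symm fun k l j => by rw [G.symm]
  psd := laplacian_psd (fun k l j => by rw [G.symm]) fun k l j =>
    mul_nonneg (hβ k).le (G.nonneg _ _)
  ρ_pos := hρ

section Flow

variable {P V} (hP : P.Assumptions) {G : WeightedGraph N} {bbar : (k : Fin p) → V k → ℝ}
    {β : Fin p → ℝ} (hβ : ∀ k, 0 < β k) {ρ : Fin N → ℝ} (hρ : ∀ i, 0 < ρ i)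

/-- The stacked state of the algorithm. -/
noncomputable def stack (v y : (k : Fin p) → V k → ℝ) (x : Decision n) :
    EuclideanSpace ℝ (Σ k, V k) × EuclideanSpace ℝ (Σ k, V k) × Decision n :=
  (WithLp.toLp 2 fun s => v s.1 s.2, WithLp.toLp 2 fun s => y s.1 s.2, x)

lemma hasDerivWithinAt_euclidean {J : Type*} [Fintype J] {z : ℝ → EuclideanSpace ℝ J}
    {z' : EuclideanSpace ℝ J} {s : Set ℝ} {t : ℝ} :
    HasDerivWithinAt z z' s t ↔ ∀ j, HasDerivWithinAt (fun t => z t j) (z' j) s t := by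
  rw [← hasDerivWithinAt_pi]
  refine ⟨fun h => ?_, fun h => ?_⟩
  · exact (EuclideanSpace.equiv J ℝ).hasFDerivAt.comp_hasDerivWithinAt t h
  · exact (EuclideanSpace.equiv J ℝ).symm.hasFDerivAt.comp_hasDerivWithinAt t h

lemma isSolution_iff {v y : ℝ → (k : Fin p) → V k → ℝ} {x : ℝ → Decision n} :
    IsSolution P G V bbar β ρ v y x ↔ ∀ t, 0 ≤ t → HasDerivWithinAt
      (fun t => stack (v t) (y t) (x t))
      ((primalDual P V hP G bbar hβ hρ).field (stack (v t) (y t) (x t))) (Set.Ici 0) t := by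
  have hL : ∀ (v : (k : Fin p) → V k → ℝ) (k : Fin p) (l : V k),
      laplacian (fun k (l j : V k) => β k * G.a l j) (WithLp.toLp 2 fun s => v s.1 s.2) ⟨k, l⟩
        = β k * ∑ j : V k, G.a l j * (v k l - v k j) := fun v k l => by
    rw [laplacian_apply, Finset.mul_sum]
    exact Finset.sum_congr rfl fun j _ => mul_assoc _ _ _
  have hB : ∀ (v y : (k : Fin p) → V k → ℝ) (x : Decision n) (i : Fin N),
      ((primalDual P V hP G bbar hβ hρ).field (stack v y x)).2.2 i
      = -((1 + ρ i) • gradient (P.localCost i) (x i))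
        - ρ i • ∑ k : {k // i ∈ V k},
            (inner ℝ (P.row i k) (x i) - bbar k ⟨i, k.2⟩) • P.row i k
        + ρ i • ∑ k : {k // i ∈ V k}, y k ⟨i, k.2⟩ • P.row i k
        - (1 + ρ i) • ∑ k : {k // i ∈ V k}, v k ⟨i, k.2⟩ • P.row i k := fun v y x i => by
    have h1 : dualMap P V i (primalMap P V i (x i) - WithLp.toLp 2 (fun s => bbar s.1 s.2)
        - WithLp.toLp 2 (fun s => y s.1 s.2))
        = ∑ k : {k // i ∈ V k}, (inner ℝ (P.row i k) (x i) - bbar k ⟨i, k.2⟩) • P.row i k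
          - ∑ k : {k // i ∈ V k}, y k ⟨i, k.2⟩ • P.row i k := by
      rw [dualMap_apply, ← Finset.sum_sub_distrib]
      refine Finset.sum_congr rfl fun k _ => ?_
      rw [← sub_smul, PiLp.sub_apply, PiLp.sub_apply, primalMap_apply, if_pos rfl]
    have h2 : ((primalDual P V hP G bbar hβ hρ).field (stack v y x)).2.2 i
      = -((1 + ρ i) • gradient (P.localCost i) (x i))
        - ρ i • dualMap P V i (primalMap P V i (x i) - WithLp.toLp 2 (fun s => bbar s.1 s.2)
          - WithLp.toLp 2 (fun s => y s.1 s.2))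
        - (1 + ρ i) • dualMap P V i (WithLp.toLp 2 fun s => v s.1 s.2) := rfl
    rw [h2, h1, dualMap_apply, smul_sub]
    abel
  have hA : ∀ (v y : (k : Fin p) → V k → ℝ) (x : Decision n) (k : Fin p) (l : V k),
      ((primalDual P V hP G bbar hβ hρ).field (stack v y x)).1 ⟨k, l⟩
      = (inner ℝ (P.row l k) (x l) - bbar k l) - β k * ∑ j : V k, G.a l j * (v k l - v k j)
        - y k l := fun v y x k l => by
    have h2 : ((primalDual P V hP G bbar hβ hρ).field (stack v y x)).1 ⟨k, l⟩
        = (∑ i, primalMap P V i (x i)) ⟨k, l⟩ - bbar k l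
          - laplacian (fun k (l j : V k) => β k * G.a l j) (WithLp.toLp 2 fun s => v s.1 s.2) ⟨k, l⟩
          - y k l := rfl
    rw [h2, hL, sum_primalMap_apply]
  constructor
  · intro h t ht
    refine (hasDerivWithinAt_euclidean.2 fun s => ?_).prodMk
      ((hasDerivWithinAt_euclidean.2 fun s => ?_).prodMk (hasDerivWithinAt_pi.2 fun i => ?_))
    · exact (h.v_eq t ht s.1 s.2).congr_deriv (hA _ _ _ _ _).symm
    · exact (h.y_eq t ht s.1 s.2).congr_deriv (hL _ _ _).symm
    · exact (h.x_eq t ht i).congr_deriv (hB _ _ _ _).symm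
  · intro h
    refine ⟨fun t ht k l => ?_, fun t ht k l => ?_, fun t ht i => ?_⟩
    · exact (hasDerivWithinAt_euclidean.1 (h t ht).snd.fst ⟨k, l⟩).congr_deriv (hL _ _ _)
    · exact (hasDerivWithinAt_euclidean.1 (h t ht).fst ⟨k, l⟩).congr_deriv (hA _ _ _ _ _)
    · exact (hasDerivWithinAt_pi.1 (h t ht).snd.snd i).congr_deriv (hB _ _ _ _)

end Flow

/-! ### Equilibria of the flow and KKT points -/

section Equilibria

variable {P V}

lemma row_eq_zero (hV : ∀ (k : Fin p) (i : Fin N), P.w i k ≠ 0 → i ∈ V k) {i : Fin N} (k : Fin p)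
    (hi : i ∉ V k) : P.row i k = 0 := by
  rw [Problem.row, not_not.1 (mt (hV k i) hi)]
  rfl

lemma weight_pos {G : WeightedGraph N} {β : Fin p → ℝ} (hβ : ∀ k, 0 < β k) (k : Fin p) (l j : V k)
    (h : (G.graph.comap (Subtype.val : V k → Fin N)).Adj l j) : 0 < β k * G.a l j := by
  refine mul_pos (hβ k) ?_
  rcases h.2 with h | h
  · exact h
  · rwa [G.symm]

lemma sum_constraint (hV : ∀ (k : Fin p) (i : Fin N), P.w i k ≠ 0 → i ∈ V k) (x : Decision n)
    (k : Fin p) : ∑ l : V k, inner ℝ (P.row l k) (x l) = ∑ i, inner ℝ (P.row i k) (x i) := by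
  rw [Finset.sum_coe_sort (V k) fun i => inner ℝ (P.row i k) (x i)]
  refine Finset.sum_subset (Finset.subset_univ _) fun i _ hi => ?_
  rw [row_eq_zero hV k hi, inner_zero_left]

lemma dualMap_const (hV : ∀ (k : Fin p) (i : Fin N), P.w i k ≠ 0 → i ∈ V k) (ν : Fin p → ℝ)
    (i : Fin N) : dualMap P V i (WithLp.toLp 2 fun s => ν s.1) = ∑ k, ν k • P.row i k := by
  rw [dualMap_apply]
  refine (Finset.sum_subtype {k | i ∈ V k} (by simp) fun k => ν k • P.row i k).symm.trans ?_
  refine Finset.sum_subset (Finset.subset_univ _) fun k _ hk => ?_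
  rw [row_eq_zero hV k (by simpa using hk), smul_zero]

variable (hP : P.Assumptions) {G : WeightedGraph N} {bbar : (k : Fin p) → V k → ℝ}
    {β : Fin p → ℝ} (hβ : ∀ k, 0 < β k) {ρ : Fin N → ℝ} (hρ : ∀ i, 0 < ρ i)

/-- Summed over a cluster, the equilibrium integral state is the residual of the corresponding
constraint. This links the zero-sum condition on `y` to feasibility. -/
lemma sum_balance (hV : ∀ (k : Fin p) (i : Fin N), P.w i k ≠ 0 → i ∈ V k)
    (hbbar : ∀ k, ∑ l, bbar k l = P.b k) {u : Decision n} {vs ys : EuclideanSpace ℝ (Σ k, V k)}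
    (h : (primalDual P V hP G bbar hβ hρ).IsEquilibrium u vs ys) (k : Fin p) :
    ∑ l, ys ⟨k, l⟩ = ∑ i, inner ℝ (P.row i k) (u i) - P.b k := by
  have h1 : ∀ l, ys ⟨k, l⟩ = inner ℝ (P.row l k) (u l) - bbar k l := fun l => by
    rw [← sum_primalMap_apply P V, h.balance]
    rfl
  rw [Finset.sum_congr rfl fun l _ => h1 l, Finset.sum_sub_distrib, hbbar, sum_constraint hV]

lemma isEquilibrium_of_isKKT (hV : ∀ (k : Fin p) (i : Fin N), P.w i k ≠ 0 → i ∈ V k)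
    {ν : Fin p → ℝ} {x : Decision n} (h : P.IsKKT ν x) :
    (primalDual P V hP G bbar hβ hρ).IsEquilibrium x (WithLp.toLp 2 fun s => ν s.1)
      (∑ i, primalMap P V i (x i) - WithLp.toLp 2 fun s => bbar s.1 s.2) := by
  refine ⟨fun i => ?_, ?_, rfl⟩
  · rw [← h.1 i, ← dualMap_const hV]
    rfl
  · change laplacian _ _ = 0
    ext ⟨k, l⟩
    simp [laplacian_apply]

lemma exists_L_eq (hconn : ∀ k, (G.graph.induce (V k : Set (Fin N))).Connected)
    {y : EuclideanSpace ℝ (Σ k, V k)} (hy : ∀ k, ∑ l, y ⟨k, l⟩ = 0) :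
    ∃ h, y = (primalDual P V hP G bbar hβ hρ).L h :=
  exists_laplacian_eq (fun k l j => by rw [G.symm]) (fun k l j => mul_nonneg (hβ k).le (G.nonneg _ _))
    (Gr := fun k => G.graph.comap (Subtype.val : V k → Fin N)) (weight_pos hβ) hconn hy

/-- The kernel of `L` gives consensus on one multiplier per constraint. Elements of its range have
zero sum on each cluster, so `ys` inherits zero sums from `y₀`, which is feasibility. -/
lemma exists_isKKT_of_isEquilibrium (hV : ∀ (k : Fin p) (i : Fin N), P.w i k ≠ 0 → i ∈ V k)
    (hconn : ∀ k, (G.graph.induce (V k : Set (Fin N))).Connected)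
    (hbbar : ∀ k, ∑ l, bbar k l = P.b k) {u : Decision n} {vs ys y₀ : EuclideanSpace ℝ (Σ k, V k)}
    (h : (primalDual P V hP G bbar hβ hρ).IsEquilibrium u vs ys) (hy₀ : ∀ k, ∑ l, y₀ ⟨k, l⟩ = 0)
    (hy : ∃ k, y₀ - ys = (primalDual P V hP G bbar hβ hρ).L k) :
    ∃ ν, P.IsKKT ν u ∧ ∀ k (l : V k), vs ⟨k, l⟩ = ν k := by
  have hν : ∀ k, ∃ r, ∀ l : V k, vs ⟨k, l⟩ = r := fun k => by
    obtain ⟨l₀⟩ := (hconn k).nonempty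
    exact ⟨_, fun l => eq_of_laplacian_eq_zero (fun k l j => by rw [G.symm])
      (fun k l j => mul_nonneg (hβ k).le (G.nonneg _ _))
      (Gr := fun k => G.graph.comap (Subtype.val : V k → Fin N)) (weight_pos hβ) hconn
      h.consensus k l l₀⟩
  choose ν hν using hν
  have hvs : vs = WithLp.toLp 2 fun s => ν s.1 := by
    ext ⟨k, l⟩
    exact hν k l
  refine ⟨ν, ⟨fun i => ?_, fun k => ?_⟩, hν⟩
  · rw [← dualMap_const hV, ← hvs]
    exact h.stationary i
  · obtain ⟨w, hw⟩ := hy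
    have h1 : ∑ l, (y₀ - ys) ⟨k, l⟩ = 0 := by
      rw [hw]
      exact sum_laplacian (fun k l j => by rw [G.symm]) w k
    simp only [PiLp.sub_apply, Finset.sum_sub_distrib, hy₀] at h1
    linarith [sum_balance hP hβ hρ hV hbbar h k]

end Equilibria

end ClusterAllocation

theorem theorem1 {N p : ℕ} {n : Fin N → ℕ}
    (P : ClusterAllocation.Problem N p n) (hP : P.Assumptions)
    (G : ClusterAllocation.WeightedGraph N) (V : Fin p → Finset (Fin N))
    (hV : ∀ (k : Fin p) (i : Fin N), P.w i k ≠ 0 → i ∈ V k)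
    (hconn : ∀ k, (G.graph.induce (V k : Set (Fin N))).Connected)
    (bbar : (k : Fin p) → V k → ℝ) (hbbar : ∀ k, ∑ l, bbar k l = P.b k)
    (β : Fin p → ℝ) (hβ : ∀ k, 0 < β k)
    (ρ : Fin N → ℝ) (hρ : ∀ i, 0 < ρ i)
    (v₀ y₀ : (k : Fin p) → V k → ℝ) (x₀ : ClusterAllocation.Decision n)
    (hy₀ : ∀ k, ∑ l, y₀ k l = 0) :
    (∃ v y x, ClusterAllocation.IsSolution P G V bbar β ρ v y x ∧
      v 0 = v₀ ∧ y 0 = y₀ ∧ x 0 = x₀) ∧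
    ∀ v y x, ClusterAllocation.IsSolution P G V bbar β ρ v y x →
      v 0 = v₀ → y 0 = y₀ → x 0 = x₀ →
      ∃ (ν : Fin p → ℝ) (xs : ClusterAllocation.Decision n), P.IsKKT ν xs ∧
        (∀ (k : Fin p) (l : V k), Tendsto (fun t => v t k l) atTop (𝓝 (ν k))) ∧
        ∀ i, Tendsto (fun t => x t i) atTop (𝓝 (xs i)) := by
  obtain ⟨ν', x', hKKT⟩ := hP.exists_isKKT
  set D := ClusterAllocation.primalDual P V hP G bbar hβ hρ with hD
  have hu : D.IsEquilibrium x' _ _ :=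
    ClusterAllocation.isEquilibrium_of_isKKT hP hβ hρ hV hKKT
  -- At a KKT point the equilibrium integral state has zero sum on each cluster, as does `y₀`; by
  -- connectedness their difference lies in the range of `L`.
  have hy : ∃ k, (ClusterAllocation.stack v₀ y₀ x₀).2.1
      - (∑ i, ClusterAllocation.primalMap P V i (x' i) - WithLp.toLp 2 fun s => bbar s.1 s.2)
      = D.L k := by
    refine ClusterAllocation.exists_L_eq hP hβ hρ hconn fun k => ?_
    have h1 := ClusterAllocation.sum_balance hP hβ hρ hV hbbar hu k
    rw [hKKT.2 k, sub_self] at h1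
    have h2 := Finset.sum_sub_distrib (s := Finset.univ) (fun l : V k => y₀ k l)
      fun l => (∑ i, ClusterAllocation.primalMap P V i (x' i)
        - WithLp.toLp 2 fun s : Σ k, V k => bbar s.1 s.2) ⟨k, l⟩
    rw [h1, hy₀ k, sub_zero] at h2
    exact h2
  refine ⟨?_, fun v y x hsol hv hy' hx => ?_⟩
  · obtain ⟨z, hz0, hz⟩ := D.exists_solution hu (ClusterAllocation.stack v₀ y₀ x₀) hy
    refine ⟨fun t k l => (z t).1 ⟨k, l⟩, fun t k l => (z t).2.1 ⟨k, l⟩, fun t => (z t).2.2,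
      (ClusterAllocation.isSolution_iff hP hβ hρ).2 hz, ?_, ?_, ?_⟩
    · simp only [hz0]
      rfl
    · simp only [hz0]
      rfl
    · simp only [hz0]
      rfl
  · obtain ⟨u, vs, ys, heq, hys, hvlim, hxlim⟩ := D.exists_tendsto hu
      (z := fun t => ClusterAllocation.stack (v t) (y t) (x t)) (by rwa [hv, hy', hx])
      ((ClusterAllocation.isSolution_iff hP hβ hρ).1 hsol)
    obtain ⟨ν, hν, hvs⟩ := ClusterAllocation.exists_isKKT_of_isEquilibrium hP hβ hρ hV hconn hbbar
      heq (fun k => by rw [hy']; exact hy₀ k) hys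
    refine ⟨ν, u, hν, fun k l => ?_, hxlim⟩
    rw [← hvs k l]
    exact ((PiLp.continuous_apply 2 _ _).tendsto vs).comp hvlim
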